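/- Let $X$ be a proper CAT(0)-space with visual boundary $\partial X$, let $\Delta\subset\partial X\times\partial X$ be the diagonal, and let $G<\mathrm{Iso}(X)$ be a closed subgroup (for the compact open topology) with limit set $\Lambda\subset\partial X$ and left Haar measure $\mu$. Assume that $G$ is non-elementary, i.e. $\Lambda$ has at least three points and $G$ fixes no point of $\partial X$. A geodesic $\gamma:\mathbb R\to X$ is $B$-contracting if for every closed metric ball $K$ disjoint from $\gamma(\mathbb R)$ the shortest distance projection of $K$ into $\gamma(\mathbb R)$ has diameter at most $B$. An isometry $g$ is rank-one if its displacement function $x\mapsto d(x,gx)$ has a positive minimum and if for some $B'>0$ it has a $B'$-contracting axis, i.e. a $B'$-contracting geodesic which it translates by this minimum. For $B>0$ let $\mathcal A(B)\subset\partial X\times\partial X-\Delta$ be the set of pairs of points which are connected by a $B$-contracting geodesic, and let $T(B)$ be the set of triples $(a_1,a_2,a_3)$ of pairwise distinct points of $\Lambda$ with $(a_1,a_2),(a_2,a_3),(a_3,a_1)\in\mathcal A(B)$. Let $C_b(G\times G)$ be the space of continuous bounded real functions on $G\times G$ with the compact open topology. For $p\in(1,\infty)$, an $L^p(G\times G,\mu\times\mu)$-valued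 continuous bounded two-cocycle on $T(B)$ is a continuous map $\omega:T(B)\to L^p(G\times G,\mu\times\mu)$ with bounded image such that (i) for all $g\in G$ and $t\in T(B)$, $\omega(gt)(gh,gu)=\omega(t)(h,u)$ for almost every $(h,u)$; (ii) $\omega\circ\sigma=\mathrm{sgn}(\sigma)\,\omega$ for every permutation $\sigma$ of the three variables; (iii) $\omega(a_2,a_3,a_4)-\omega(a_1,a_3,a_4)+\omega(a_1,a_2,a_4)-\omega(a_1,a_2,a_3)=0$ for all pairwise distinct $a_1,\dots,a_4\in\Lambda$ with $(a_i,a_j)\in\mathcal A(B)$ for all $i\neq j$. **Theorem.** Let $x_0\in X$, let $B>0$ and let $(a,b,\xi)\in T(B)$ be such that $(a,b)$ is the pair of fixed points in $\partial X$ of a rank-one element of $G$. Then there is a continuous map $\alpha:\mathcal A(B)\to C_b(G\times G)$ with the following properties. 1. $\alpha(g\sigma,g\eta)(gh,gu)=\alpha(\sigma,\eta)(h,u)$ and $\alpha(\eta,\sigma)=-\alpha(\sigma,\eta)$ for all $(\sigma,\eta)\in\mathcal A(B)$ and $g,h,u\in G$. 2. For every $(\sigma,\eta)\in\mathcal A(B)$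 and all open neighborhoods $A_1$ of $\sigma$ and $A_2$ of $\eta$ in $X\cup\partial X$, the intersection of the support of $\alpha(\sigma,\eta)$ with $\{(g,h)\in G\times G\mid gx_0\in X-(A_1\cup A_2)\}$ is compact. 3. For every $p\in(1,\infty)$ the assignment $\omega(\sigma,\eta,\beta)=\alpha(\sigma,\eta)+\alpha(\eta,\beta)+\alpha(\beta,\sigma)$ is an $L^p(G\times G,\mu\times\mu)$-valued continuous bounded two-cocycle on $T(B)$. 4. $\omega(a,b,\xi)\neq 0$. 5. If $G$ does not act transitively on $\Lambda\times\Lambda-\Delta$ and if $(a_i,b_i)\in\mathcal A(B)$ $(i=1,\dots,k)$ are pairs of fixed points of rank-one elements of $G$ whose $G$-orbits are disjoint from the $G$-orbit of $(a,b)$, then $\alpha$ can be chosen, with properties 1-4, in such a way that its support, viewed as the support of a function on $\mathcal A(B)\times G\times G$, contains no point $(a_i,b_i,z)$ with $1\le i\le k$ and $z\in G\times G$. -/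

import Mathlib

open Set Filter Topology MeasureTheory
open scoped NNReal ENNReal

namespace RankOne

/-! ### Spaces of nonpositive curvature -/

/-- A CAT(0)-space: a geodesic metric space in which every geodesic triangle is at least as thin
as its comparison triangle in the Euclidean plane.  Here `p` lies on a side from `x` to `y`, `q`
on a side from `x` to `z`, and `p'`, `q'` are the comparison points of `p`, `q` in the comparison
triangle `x'`, `y'`, `z'`. -/
structure IsCAT0 (X : Type*) [MetricSpace X] : Prop where
  geodesic : ∀ x y : X, ∃ γ : ℝ → X, γ 0 = x ∧ γ (dist x y) = y ∧
    ∀ s ∈ Icc 0 (dist x y), ∀ t ∈ Icc 0 (dist x y), dist (γ s) (γ t) = |s - t|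
  comparison : ∀ (x y z p q : X) (x' y' z' p' q' : EuclideanSpace ℝ (Fin 2)),
    dist x' y' = dist x y → dist y' z' = dist y z → dist x' z' = dist x z →
    dist x p + dist p y = dist x y → dist x' p' = dist x p → dist p' y' = dist p y →
    dist x q + dist q z = dist x z → dist x' q' = dist x q → dist q' z' = dist q z →
    dist p q ≤ dist p' q'

/-! ### The visual boundary and the compactification -/

section Boundary

variable (X : Type*) [MetricSpace X]

/-- Geodesic rays in `X` (with arbitrary starting point), with the topology of uniform convergence
on compact sets. -/
abbrev GeodesicRay : Type _ := {c : C(ℝ≥0, X) // Isometry c}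

/-- Two rays are asymptotic if they stay at bounded distance. -/
instance asymptoticSetoid : Setoid (GeodesicRay X) where
  r c c' := ∃ C : ℝ, ∀ t, dist (c.1 t) (c'.1 t) ≤ C
  iseqv :=
    { refl := fun c => ⟨0, fun t => by simp⟩
      symm := fun {c c'} ⟨C, h⟩ => ⟨C, fun t => by rw [dist_comm]; exact h t⟩
      trans := fun {c c' c''} ⟨C, h⟩ ⟨C', h'⟩ =>
        ⟨C + C', fun t => (dist_triangle _ _ _).trans (add_le_add (h t) (h' t))⟩ }

/-- The visual boundary `∂X`: asymptote classes of geodesic rays.  Its topology is the quotient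
of the topology of uniform convergence on compact sets on the space of all rays.  (In a proper
CAT(0)-space every class has exactly one ray starting at a given point `x`, which depends
continuously on a ray of the class, so this is the usual topology on the rays from `x`.) -/
abbrev Boundary : Type _ := Quotient (asymptoticSetoid X)

/-- The set `X ∪ ∂X`. -/
inductive Bordification : Type _
  | point (x : X) : Bordification
  | ideal (ξ : Boundary X) : Bordification

/-- Generalized rays: geodesic rays, and geodesic segments `[0, T] → X` extended by a constant
map to `[T, ∞)`, with the topology of uniform convergence on compact sets. -/
abbrev GeneralizedRay : Type _ :=
  {c : C(ℝ≥0, X) // Isometry c ∨ ∃ T : ℝ≥0, ∀ s t, dist (c s) (c t) = dist (min s T) (min t T)}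

variable {X}

open Classical in
/-- The endpoint in `X ∪ ∂X` of a generalized ray. -/
noncomputable def GeneralizedRay.endpoint (c : GeneralizedRay X) : Bordification X :=
  if h : Isometry c.1 then .ideal (Quotient.mk _ ⟨c.1, h⟩)
  else .point (c.1 (Classical.choose (c.2.resolve_left h)))

/-- The cone topology on `X ∪ ∂X`: the quotient topology for the endpoint map on generalized rays.
(As for `∂X`, this is the topology of uniform convergence on compact sets of the generalized rays
which start at a fixed point.) -/
noncomputable instance : TopologicalSpace (Bordification X) :=
  TopologicalSpace.coinduced GeneralizedRay.endpoint inferInstance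

/-- The endpoint `γ(∞)` of a geodesic line. -/
def posEnd (γ : ℝ → X) (hγ : Isometry γ) : Boundary X :=
  Quotient.mk _ ⟨⟨fun t : ℝ≥0 => γ t, hγ.continuous.comp NNReal.continuous_coe⟩,
    hγ.comp isometry_subtype_coe⟩

/-- The endpoint `γ(-∞)` of a geodesic line. -/
def negEnd (γ : ℝ → X) (hγ : Isometry γ) : Boundary X :=
  posEnd (fun t => γ (-t)) (hγ.comp (IsometryEquiv.neg ℝ).isometry)

end Boundary

/-! ### Isometries -/

section Isometries

variable {X : Type*} [MetricSpace X]

/-- The compact open topology on the isometry group. -/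
instance : TopologicalSpace (X ≃ᵢ X) :=
  TopologicalSpace.induced (fun g => (⟨g, g.continuous⟩ : C(X, X))) inferInstance

/-- The image of a geodesic ray under an isometry. -/
def mapRay (g : X ≃ᵢ X) (c : GeodesicRay X) : GeodesicRay X :=
  ⟨⟨fun t => g (c.1 t), g.continuous.comp c.1.continuous⟩, g.isometry.comp c.2⟩

/-- The action of the isometry group on the visual boundary. -/
instance : MulAction (X ≃ᵢ X) (Boundary X) where
  smul g := Quotient.map (mapRay g) fun c c' ⟨C, h⟩ =>
    ⟨C, fun t => by simpa [mapRay, g.isometry.dist_eq] using h t⟩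
  one_smul ξ := Quotient.inductionOn ξ fun c => rfl
  mul_smul g h ξ := Quotient.inductionOn ξ fun c => rfl

/-- `g` is axial: its displacement function has a positive minimum. -/
def IsAxial (g : X ≃ᵢ X) : Prop :=
  ∃ τ : ℝ, 0 < τ ∧ IsLeast (range fun x => dist x (g x)) τ

/-- `γ` is an oriented axis for `g`: a geodesic line which `g` translates by the minimal
displacement of `g`. -/
def IsAxis (g : X ≃ᵢ X) (γ : ℝ → X) : Prop :=
  Isometry γ ∧ ∃ τ : ℝ, IsLeast (range fun x => dist x (g x)) τ ∧ ∀ t, g (γ t) = γ (t + τ)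

/-- A geodesic with image `S` is `B`-contracting: for every closed ball `K` disjoint from `S`, the
shortest distance projection of `K` into `S` has diameter at most `B`. -/
def IsContracting (B : ℝ) (S : Set X) : Prop :=
  ∀ (z : X) (r : ℝ), Disjoint (Metric.closedBall z r) S →
    ∀ x ∈ Metric.closedBall z r, ∀ y ∈ Metric.closedBall z r, ∀ p ∈ S, ∀ q ∈ S,
      dist x p = Metric.infDist x S → dist y q = Metric.infDist y S → dist p q ≤ B

/-- `g` is rank-one: it is axial and has an axis which is `B`-contracting for some `B > 0`. -/
def IsRankOne (g : X ≃ᵢ X) : Prop :=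
  IsAxial g ∧ ∃ B : ℝ, 0 < B ∧ ∃ γ : ℝ → X, IsAxis g γ ∧ IsContracting B (range γ)

/-- `𝒜(B)`: the pairs of distinct points in `∂X` which are connected by a `B`-contracting
geodesic. -/
def contractingPairs (X : Type*) [MetricSpace X] (B : ℝ) : Set (Boundary X × Boundary X) :=
  {a | a.1 ≠ a.2 ∧ ∃ (γ : ℝ → X) (hγ : Isometry γ),
    negEnd γ hγ = a.1 ∧ posEnd γ hγ = a.2 ∧ IsContracting B (range γ)}

variable (G : Subgroup (X ≃ᵢ X))

/-- The limit set of `G`: the accumulation points in `∂X` of an orbit of `G` on `X`.  (It does not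
depend on the orbit.) -/
def limitSet : Set (Boundary X) :=
  {ξ | ∃ x : X, AccPt (Bordification.ideal ξ)
    (𝓟 (range fun g : G => Bordification.point ((g : X ≃ᵢ X) x)))}

/-- `G` is non-elementary: its limit set contains at least three points, and `G` does not fix a
point in `∂X`. -/
def IsNonElementary : Prop :=
  3 ≤ (limitSet G).encard ∧ ¬ ∃ ξ : Boundary X, ∀ g : G, g • ξ = ξ

/-- `G` acts transitively on the complement of the diagonal in `Λ × Λ`. -/
def IsTransitiveOnPairs : Prop :=
  ∀ a ∈ limitSet G, ∀ b ∈ limitSet G, ∀ a' ∈ limitSet G, ∀ b' ∈ limitSet G,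
    a ≠ b → a' ≠ b' → ∃ g : G, g • a = a' ∧ g • b = b'

/-- `(a, b)` is the pair of fixed points in `∂X` of a rank-one element of `G`. -/
def IsRankOnePair (a b : Boundary X) : Prop :=
  a ≠ b ∧ ∃ g : X ≃ᵢ X, g ∈ G ∧ IsRankOne g ∧ {ξ : Boundary X | g • ξ = ξ} = {a, b}

/-- `T(B)`: triples of pairwise distinct points in the limit set whose consecutive pairs (indices
modulo three) are in `𝒜(B)`. -/
def contractingTriples (B : ℝ) : Set (Fin 3 → Boundary X) :=
  {t | (∀ i, t i ∈ limitSet G) ∧ Function.Injective t ∧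
    ∀ i, (t i, t (i + 1)) ∈ contractingPairs X B}

/-! ### Cocycles -/

variable [MeasurableSpace G] (μ : Measure G)

/-- `ω` is a continuous bounded two-cocycle for the action of `G` on `T(B)` with values in
`L^p(G × G, μ × μ)`; only the restriction of `ω` to `T(B)` matters.  The group `G` acts on
`L^p(G × G, μ × μ)` by left translation. -/
structure IsContinuousBoundedCocycle (B : ℝ) (p : ℝ≥0∞) [Fact (1 ≤ p)]
    (ω : (Fin 3 → Boundary X) → Lp ℝ p (μ.prod μ)) : Prop where
  continuousOn : ContinuousOn ω (contractingTriples G B)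
  bounded : ∃ C : ℝ, ∀ t ∈ contractingTriples G B, ‖ω t‖ ≤ C
  equivariant : ∀ g : G, ∀ t ∈ contractingTriples G B,
    ∀ᵐ z ∂(μ.prod μ), ω (g • t) (g * z.1, g * z.2) = ω t z
  antisymmetric : ∀ σ : Equiv.Perm (Fin 3), ∀ t ∈ contractingTriples G B,
    ω (t ∘ σ) = (Equiv.Perm.sign σ : ℤ) • ω t
  cocycle : ∀ a₁ a₂ a₃ a₄ : Boundary X, [a₁, a₂, a₃, a₄].Nodup →
    (∀ a ∈ [a₁, a₂, a₃, a₄], a ∈ limitSet G) →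
    (∀ a ∈ [a₁, a₂, a₃, a₄], ∀ b ∈ [a₁, a₂, a₃, a₄], a ≠ b → (a, b) ∈ contractingPairs X B) →
    ω ![a₂, a₃, a₄] - ω ![a₁, a₃, a₄] + ω ![a₁, a₂, a₄] - ω ![a₁, a₂, a₃] = 0

/-- The requirements on the map `α : 𝒜(B) → C_b(G × G)`; only the restriction of `α` to `𝒜(B)`
matters.  The space `C(G × G, ℝ)` carries the compact open topology. -/
structure IsAdmissibleMap (B : ℝ) (x₀ : X) (a b ξ : Boundary X)
    (α : Boundary X × Boundary X → C(G × G, ℝ)) : Prop where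
  continuousOn : ContinuousOn α (contractingPairs X B)
  bounded : ∀ c ∈ contractingPairs X B, ∃ C : ℝ, ∀ z, |α c z| ≤ C
  equivariant : ∀ c ∈ contractingPairs X B, ∀ g : G, ∀ z : G × G,
    α (g • c) (g * z.1, g * z.2) = α c z
  antisymmetric : ∀ c ∈ contractingPairs X B, α c.swap = -α c
  /-- controlled support -/
  support : ∀ c ∈ contractingPairs X B, ∀ A₁ A₂ : Set (Bordification X),
    IsOpen A₁ → Bordification.ideal c.1 ∈ A₁ → IsOpen A₂ → Bordification.ideal c.2 ∈ A₂ →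
    IsCompact (tsupport (α c) ∩
      {z : G × G | Bordification.point ((z.1 : X ≃ᵢ X) x₀) ∉ A₁ ∪ A₂})
  /-- For every `p ∈ (1, ∞)`, the coboundary of `α` is an `L^p`-valued cocycle which does not
  vanish at `(a, b, ξ)`. -/
  coboundary : ∀ (p : ℝ≥0∞) [Fact (1 ≤ p)], 1 < p → p < ∞ →
    ∃ ω : (Fin 3 → Boundary X) → Lp ℝ p (μ.prod μ),
      (∀ t ∈ contractingTriples G B, ω t =ᵐ[μ.prod μ]
        fun z => α (t 0, t 1) z + α (t 1, t 2) z + α (t 2, t 0) z) ∧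
      IsContinuousBoundedCocycle G μ B p ω ∧ ω ![a, b, ξ] ≠ 0

/-- The support of `α`, regarded as a function on `𝒜(B) × (G × G)`. -/
def pairSupport (B : ℝ) (α : Boundary X × Boundary X → C(G × G, ℝ)) :
    Set ((Boundary X × Boundary X) × (G × G)) :=
  closure {v | v.1 ∈ contractingPairs X B ∧ α v.1 v.2 ≠ 0}

end Isometries

end RankOne

open RankOne

namespace RankOne

/-! ### Comparison geometry -/

section CAT0

variable {X : Type*} [MetricSpace X]

/-! The cochain records how a pair of boundary points looks from an orbit point. Fix a radius `r`
and two points `u`, `v` at distance at least 3. For `(σ, η)` and `g`, follow the rays from `g x₀` to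
`σ` and `η` for time `r`, and compare the two points reached with `g u` and `g v` by an
antisymmetrized product of bump functions (`pairFun`, `pairKernel`). A factor depending only on `d(g
x₀, h x₀)` turns this into a function on `G × G` (`cochain`). It is bounded, continuous, equivariant
and antisymmetric, because the formula is natural under isometries and the points reached depend
continuously on the data.

The geometric core is `Joins.infDist_mul_dist_le`. If a `B`-contracting line joins `ξ` to `η` and
`x` lies at distance `d` from it, the rays from `x` to `ξ` and to `η` both pass at time `d` within
`8 * B` of the projection of `x`. By convexity they are `O(1/d)` apart at the fixed time `r`. This
has two consequences. A nonzero value of the kernel needs points at distance at least 1, hence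
forces `g x₀` into a bounded neighborhood of the line, which controls the support. And the cyclic
sum over a triple is at most four times the distance of any two of the three points reached
(`abs_pairFun_sum_le`), so it is `O(1/(1 + d))` for the largest distance `d` from `g x₀` to a side.

The second ingredient is that points within `m` of all three sides of an ideal triangle form a set
of diameter at most `10 * m` (`IsCAT0.dist_le_of_infDist_le`, by Busemann functions). Therefore the
elements `g` with nonzero coboundary and largest side distance about `2 ^ n` have measure `O(2 ^
n)`, while the `p`-th power of the value there is `O(2 ^ (-p * n))`. The resulting geometric series
converges exactly for `p > 1`, uniformly in the triple (`exists_tail_bound`); this gives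
boundedness, and together with uniform convergence on compact sets also continuity in `L^p`.

For nonvanishing, `u` and `v` are the points at time `r` on the rays from `x₀` to the ends of one
side of the triangle `(a, b, ξ)`, with `r` so large that the three rays have separated; the
coboundary is then 1 at the identity. For the last assertion that side must avoid the orbits of the
given pairs in both orientations. The orbit of the endpoint pair of a contracting axis is closed
(`HasContractingAxis.exists_smul_eq`), so a large `r` keeps the support away from such pairs. The
side `(a, b)` itself may fail, since `(b, a)` can lie in the orbit of a given pair. But if all three
sides failed, all would be axes, axes with a common endpoint would be equivalent, and going around
the triangle would produce an element exchanging `a` and `b`, a contradiction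
(`exists_side_not_mem_orbit`). -/

theorem exists_comparison_triangle {a b c : ℝ} (ha : 0 ≤ a) (hb : 0 ≤ b) (hc : 0 ≤ c)
    (h1 : a ≤ b + c) (h2 : b ≤ a + c) (h3 : c ≤ a + b) :
    ∃ x y z : EuclideanSpace ℝ (Fin 2), dist x y = a ∧ dist y z = b ∧ dist x z = c := by
  rcases ha.eq_or_lt with rfl | ha
  · have : b = c := by linarith
    subst this
    exact ⟨!₂[0, 0], !₂[0, 0], !₂[b, 0], by simp, by simp [EuclideanSpace.dist_eq, Real.sqrt_sq hb],
      by simp [EuclideanSpace.dist_eq, Real.sqrt_sq hb]⟩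
  -- With the side of length `a` on the first axis, the law of cosines dictates the abscissa `u` of
  -- the third vertex.
  · set u := (a ^ 2 + c ^ 2 - b ^ 2) / (2 * a) with hu
    have hua : 2 * a * u = a ^ 2 + c ^ 2 - b ^ 2 := by rw [hu]; field_simp
    have hv : 0 ≤ c ^ 2 - u ^ 2 := by
      have h4 : u ≤ c := by
        rw [hu, div_le_iff₀ (by positivity)]; nlinarith
      have h5 : -c ≤ u := by
        rw [hu, le_div_iff₀ (by positivity)]; nlinarith
      nlinarith
    refine ⟨!₂[0, 0], !₂[a, 0], !₂[u, Real.sqrt (c ^ 2 - u ^ 2)], ?_, ?_, ?_⟩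
    · simp [EuclideanSpace.dist_eq, Real.sqrt_sq ha.le]
    · simp only [EuclideanSpace.dist_eq, Fin.sum_univ_two, Real.dist_eq, sq_abs]
      simp [Real.sq_sqrt hv]
      rw [Real.sqrt_eq_iff_mul_self_eq (by nlinarith) hb]
      nlinarith
    · simp only [EuclideanSpace.dist_eq, Fin.sum_univ_two, Real.dist_eq, sq_abs]
      simp [Real.sq_sqrt hv, hc]

theorem IsCAT0.exists_comparison (x y z : X) :
    ∃ x' y' z' : EuclideanSpace ℝ (Fin 2),
      dist x' y' = dist x y ∧ dist y' z' = dist y z ∧ dist x' z' = dist x z :=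
  exists_comparison_triangle dist_nonneg dist_nonneg dist_nonneg
    (by linarith [dist_triangle x z y, dist_comm y z])
    (by linarith [dist_triangle y x z, dist_comm y x])
    (by linarith [dist_triangle x y z])

theorem IsCAT0.dist_le_mul (hX : IsCAT0 X) {x y z p q : X} {t : ℝ} (h0 : 0 ≤ t) (h1 : t ≤ 1)
    (hp : dist x p = t * dist x y) (hp' : dist p y = (1 - t) * dist x y)
    (hq : dist x q = t * dist x z) (hq' : dist q z = (1 - t) * dist x z) :
    dist p q ≤ t * dist y z := by
  obtain ⟨x', y', z', hxy, hyz, hxz⟩ := IsCAT0.exists_comparison x y z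
  have n0 : ‖t‖ = t := by rw [Real.norm_eq_abs, abs_of_nonneg h0]
  have n1 : ‖1 - t‖ = 1 - t := by rw [Real.norm_eq_abs, abs_of_nonneg (by linarith)]
  have := hX.comparison x y z p q x' y' z' (AffineMap.lineMap x' y' t) (AffineMap.lineMap x' z' t)
    hxy hyz hxz (by rw [hp, hp']; ring) (by rw [dist_left_lineMap, n0, hxy, hp])
    (by rw [dist_lineMap_right, n1, hxy, hp']) (by rw [hq, hq']; ring)
    (by rw [dist_left_lineMap, n0, hxz, hq]) (by rw [dist_lineMap_right, n1, hxz, hq'])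
  refine this.trans_eq ?_
  have e : AffineMap.lineMap x' y' t - AffineMap.lineMap x' z' t = t • (y' - z') := by
    simp only [AffineMap.lineMap_apply, vsub_eq_sub, vadd_eq_add, smul_sub]
    abel
  rw [dist_eq_norm, e, norm_smul, n0, ← dist_eq_norm, hyz]

theorem IsCAT0.dist_le_convex (hX : IsCAT0 X) {x y z p : X} {t : ℝ} (h0 : 0 ≤ t) (h1 : t ≤ 1)
    (hp : dist y p = t * dist y z) (hp' : dist p z = (1 - t) * dist y z) :
    dist x p ≤ (1 - t) * dist x y + t * dist x z := by
  obtain ⟨y', z', x', hyz, hzx, hyx⟩ := IsCAT0.exists_comparison y z x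
  have n0 : ‖t‖ = t := by rw [Real.norm_eq_abs, abs_of_nonneg h0]
  have n1 : ‖1 - t‖ = 1 - t := by rw [Real.norm_eq_abs, abs_of_nonneg (by linarith)]
  have := hX.comparison y z x p x y' z' x' (AffineMap.lineMap y' z' t) x'
    hyz hzx hyx (by rw [hp, hp']; ring) (by rw [dist_left_lineMap, n0, hyz, hp])
    (by rw [dist_lineMap_right, n1, hyz, hp']) (by simp) hyx (by simp)
  rw [dist_comm x p]
  refine this.trans ?_
  have e : AffineMap.lineMap y' z' t - x' = (1 - t) • (y' - x') + t • (z' - x') := by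
    simp only [AffineMap.lineMap_apply, vsub_eq_sub, vadd_eq_add, smul_sub, sub_smul, one_smul]
    abel
  rw [dist_eq_norm, e, dist_comm x y, dist_comm x z, ← hyx, ← hzx, dist_eq_norm, dist_eq_norm]
  refine (norm_add_le _ _).trans_eq ?_
  rw [norm_smul, norm_smul, n0, n1]

/-! ### Geodesic rays -/

theorem GeodesicRay.dist_eq (c : GeodesicRay X) (s t : ℝ≥0) :
    dist (c.1 s) (c.1 t) = |(s : ℝ) - t| := by
  rw [c.2.dist_eq, NNReal.dist_eq]

theorem GeodesicRay.dist_eq' (c : GeodesicRay X) {s t : ℝ≥0} (h : s ≤ t) :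
    dist (c.1 s) (c.1 t) = t - s := by
  rw [c.dist_eq, abs_sub_comm, abs_of_nonneg (sub_nonneg.2 (by exact_mod_cast h))]

theorem IsCAT0.mul_dist_le (hX : IsCAT0 X) {c c' : GeodesicRay X} (h : c.1 0 = c'.1 0)
    {s t : ℝ≥0} (hst : s ≤ t) : t * dist (c.1 s) (c'.1 s) ≤ s * dist (c.1 t) (c'.1 t) := by
  rcases eq_or_ne t 0 with rfl | ht
  · have : s = 0 := le_antisymm hst zero_le
    simp [this]
  have ht' : (0 : ℝ) < t := by exact_mod_cast pos_iff_ne_zero.2 ht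
  have hst' : (s : ℝ) ≤ t := by exact_mod_cast hst
  have e1 : ∀ c : GeodesicRay X, dist (c.1 0) (c.1 s) = (s / t : ℝ) * dist (c.1 0) (c.1 t) := by
    intro c
    rw [c.dist_eq' zero_le, c.dist_eq' zero_le]
    simp only [NNReal.coe_zero, sub_zero]
    field_simp
  have e2 : ∀ c : GeodesicRay X, dist (c.1 s) (c.1 t) = (1 - s / t : ℝ) * dist (c.1 0) (c.1 t) := by
    intro c
    rw [c.dist_eq' hst, c.dist_eq' zero_le]
    simp only [NNReal.coe_zero, sub_zero]
    field_simp
  have := hX.dist_le_mul (t := s / t) (by positivity) (by rw [div_le_one ht']; exact hst')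
    (e1 c) (e2 c) (h ▸ e1 c') (h ▸ e2 c')
  rw [div_mul_eq_mul_div, le_div_iff₀ ht'] at this
  linarith

/-- The midpoints of a triangle side seen from one vertex: `c s` and a point of `[x, c n]`. -/
theorem IsCAT0.dist_segment_ray_le (hX : IsCAT0 X) (c : GeodesicRay X) (x p : X) (n s : ℝ≥0)
    (hs : s ≤ dist x (c.1 n)) (hxp : dist x p = s)
    (hpc : dist p (c.1 n) = dist x (c.1 n) - s) :
    dist p (c.1 s) ≤ 2 * dist x (c.1 0) := by
  set L := dist x (c.1 n) with hL
  set D := dist x (c.1 0)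
  have hcn : dist (c.1 0) (c.1 n) = n := by rw [c.dist_eq' zero_le]; simp
  have h1 : L ≤ D + n := by have := dist_triangle x (c.1 0) (c.1 n); linarith
  have h2 : n ≤ D + L := by
    have := dist_triangle (c.1 0) x (c.1 n); rw [dist_comm (c.1 0) x] at this; linarith
  rcases (dist_nonneg : 0 ≤ L).eq_or_lt with h0 | h0
  · have hs0 : s = 0 := le_antisymm (by rw [hL, ← h0] at hs; exact_mod_cast hs) zero_le
    have : x = p := by rw [← dist_eq_zero, hxp, hs0]; simp
    subst this
    rw [hs0]
    have : (0 : ℝ) ≤ D := dist_nonneg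
    change D ≤ 2 * D
    linarith
  have hL0 : L ≠ 0 := h0.ne'
  -- The point `c r` divides `[c 0, c n]` in the ratio in which `p` divides `[x, c n]`, so thinness
  -- of the triangle applies to it; `r` and `s` differ by at most `D`.
  set r : ℝ≥0 := ⟨s * n / L, by positivity⟩ with hr
  have hr' : (r : ℝ) = s * n / L := rfl
  have hsL : (s : ℝ) / L ≤ 1 := by rw [div_le_one h0]; exact hs
  have hsL0 : 0 ≤ (s : ℝ) / L := by positivity
  have hrn : r ≤ n := by
    have : (r : ℝ) ≤ n := by
      rw [hr', mul_div_right_comm]; exact mul_le_of_le_one_left n.2 hsL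
    exact_mod_cast this
  have key := hX.dist_le_mul (x := c.1 n) (y := x) (z := c.1 0) (p := p) (q := c.1 r)
    (t := 1 - s / L) (by linarith) (by linarith)
    (by rw [dist_comm, hpc, dist_comm, ← hL]; field_simp)
    (by rw [dist_comm, hxp, dist_comm _ x, ← hL]; field_simp; ring)
    (by rw [dist_comm, c.dist_eq' hrn, dist_comm (c.1 n), hcn, hr']; ring)
    (by rw [dist_comm, c.dist_eq' zero_le, dist_comm (c.1 n), hcn, hr']; simp; ring)
  have h3 : dist (c.1 r) (c.1 s) ≤ D := by
    rw [c.dist_eq, hr']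
    have : (s : ℝ) * n / L - s = (s / L) * (n - L) := by field_simp
    rw [this, abs_mul, abs_of_nonneg hsL0]
    have : |(n : ℝ) - L| ≤ D := abs_le.2 ⟨by linarith, by linarith⟩
    calc (s : ℝ) / L * |(n : ℝ) - L| ≤ 1 * D := by gcongr
      _ = D := one_mul _
  have h4 : (1 - s / L) * D ≤ D := mul_le_of_le_one_left dist_nonneg (by linarith)
  have := dist_triangle p (c.1 r) (c.1 s)
  linarith

theorem IsCAT0.exists_segment (hX : IsCAT0 X) (x y : X) (s : ℝ) (h0 : 0 ≤ s) (h1 : s ≤ dist x y) :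
    ∃ p, dist x p = s ∧ dist p y = dist x y - s := by
  obtain ⟨e, e0, e1, he⟩ := hX.geodesic x y
  have hd : (0 : ℝ) ≤ dist x y := dist_nonneg
  refine ⟨e s, ?_, ?_⟩
  · rw [← e0, he 0 ⟨le_rfl, hd⟩ s ⟨h0, h1⟩, zero_sub, abs_neg, abs_of_nonneg h0]
  · conv_lhs => rw [← e1]
    rw [he s ⟨h0, h1⟩ _ ⟨hd, le_rfl⟩, abs_sub_comm, abs_of_nonneg (by linarith)]

/-- A bounded convex function on a half line cannot increase. Concretely, a diagonal from `c 0` to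
`c' T` splits the quadrilateral into two triangles; the far side contributes at most `t / T * C`,
which vanishes as `T` grows. -/
theorem IsCAT0.dist_le_of_asymptotic (hX : IsCAT0 X) {c c' : GeodesicRay X} (h : c ≈ c')
    (t : ℝ≥0) : dist (c.1 t) (c'.1 t) ≤ dist (c.1 0) (c'.1 0) := by
  obtain ⟨C, hC⟩ := h
  have hC0 : 0 ≤ C := dist_nonneg.trans (hC 0)
  refine le_of_forall_pos_le_add fun ε hε => ?_
  obtain ⟨T, hT⟩ := exists_nat_gt (max (t : ℝ) ((t : ℝ) * C / ε))
  have hTt : (t : ℝ) < T := (le_max_left _ _).trans_lt hT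
  have hT0 : (0 : ℝ) < T := t.2.trans_lt hTt
  have hTC : (t : ℝ) * C / ε < T := (le_max_right _ _).trans_lt hT
  set T' : ℝ≥0 := (T : ℝ≥0)
  have hT' : ((T' : ℝ≥0) : ℝ) = T := by simp [T']
  have htT : t ≤ T' := by
    have : (t : ℝ) ≤ T' := by rw [hT']; exact hTt.le
    exact_mod_cast this
  set l : ℝ := t / T
  have hl0 : 0 ≤ l := by positivity
  have hl1 : l ≤ 1 := by rw [div_le_one hT0]; exact hTt.le
  have hlT : l * T = t := by simp only [l]; field_simp
  set L := dist (c.1 0) (c'.1 T')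
  obtain ⟨p, hp, hp'⟩ := hX.exists_segment (c.1 0) (c'.1 T') (l * L)
    (by positivity) (mul_le_of_le_one_left dist_nonneg hl1)
  have d1 : ∀ c : GeodesicRay X, dist (c.1 0) (c.1 T') = T := fun c => by
    rw [c.dist_eq' zero_le, hT']; simp
  have d2 : ∀ c : GeodesicRay X, dist (c.1 0) (c.1 t) = t := fun c => by
    rw [c.dist_eq' zero_le]; simp
  have d3 : ∀ c : GeodesicRay X, dist (c.1 t) (c.1 T') = T - t := fun c => by
    rw [c.dist_eq' htT, hT']
  have k1 := hX.dist_le_mul (x := c.1 0) (y := c.1 T') (z := c'.1 T') (p := c.1 t) (q := p) hl0 hl1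
    (by rw [d1, d2, hlT]) (by rw [d1, d3]; linarith) hp (by rw [hp']; ring)
  have k2 := hX.dist_le_mul (x := c'.1 T') (y := c.1 0) (z := c'.1 0) (p := p) (q := c'.1 t)
    (t := 1 - l) (by linarith) (by linarith)
    (by rw [dist_comm, hp', dist_comm (c'.1 T')]; ring)
    (by rw [dist_comm, hp, dist_comm (c'.1 T')]; ring)
    (by rw [dist_comm, d3, dist_comm, d1]; linarith)
    (by rw [dist_comm, d2, dist_comm, d1]; linarith)
  have k3 : l * dist (c.1 T') (c'.1 T') ≤ ε := by
    refine (mul_le_mul_of_nonneg_left (hC T') hl0).trans ?_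
    rw [div_lt_iff₀ hε] at hTC
    simp only [l]
    rw [div_mul_eq_mul_div, div_le_iff₀ hT0]
    linarith
  have k4 : (1 - l) * dist (c.1 0) (c'.1 0) ≤ dist (c.1 0) (c'.1 0) :=
    mul_le_of_le_one_left dist_nonneg (by linarith)
  have := dist_triangle (c.1 t) p (c'.1 t)
  linarith

theorem IsCAT0.eq_of_asymptotic (hX : IsCAT0 X) {c c' : GeodesicRay X} (h : c ≈ c')
    (h0 : c.1 0 = c'.1 0) : c = c' := by
  apply Subtype.ext
  ext t
  have := hX.dist_le_of_asymptotic h t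
  rw [h0, dist_self] at this
  exact dist_le_zero.1 this

/-- The ray is a limit of the segments from `x` to `c n`. A single ultrafilter makes all the points
at fixed times converge simultaneously, by compactness of balls. -/
theorem IsCAT0.exists_ray [ProperSpace X] (hX : IsCAT0 X) (x : X) (c : GeodesicRay X) :
    ∃ c' : GeodesicRay X, c'.1 0 = x ∧ c' ≈ c := by
  choose e e0 e1 he using fun n : ℕ => hX.geodesic x (c.1 (n : ℝ≥0))
  have hL : Tendsto (fun n : ℕ => dist x (c.1 n)) atTop atTop := by
    refine tendsto_atTop_mono (f := fun n : ℕ => (n : ℝ) - dist x (c.1 0)) (fun n => ?_)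
      (tendsto_atTop_add_const_right _ _ tendsto_natCast_atTop_atTop)
    have := dist_triangle (c.1 0) x (c.1 n)
    rw [c.dist_eq' zero_le, dist_comm (c.1 0) x] at this
    simp at this
    linarith
  have hd : ∀ n : ℕ, ∀ s : ℝ≥0, (s : ℝ) ≤ dist x (c.1 n) → (s : ℝ) ∈ Icc 0 (dist x (c.1 n)) :=
    fun n s h => ⟨s.2, h⟩
  let U : Ultrafilter ℕ := hyperfilter ℕ
  have hU : (U : Filter ℕ) ≤ atTop := Nat.hyperfilter_le_atTop
  have ev : ∀ s : ℝ≥0, ∀ᶠ n : ℕ in (U : Filter ℕ), (s : ℝ) ≤ dist x (c.1 n) := fun s =>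
    hU (hL.eventually_ge_atTop _)
  have hdx : ∀ n : ℕ, ∀ s : ℝ≥0, (s : ℝ) ≤ dist x (c.1 n) → dist x (e n s) = s := fun n s h => by
    conv_lhs => rw [← e0 n]
    rw [he n 0 (hd n 0 (by simp)) s (hd n s h)]
    simp
  have hlim : ∀ s : ℝ≥0, ∃ y, Tendsto (fun n => e n s) U (𝓝 y) := fun s => by
    obtain ⟨y, -, hy⟩ := (isCompact_closedBall x (s : ℝ)).ultrafilter_le_nhds
      (U.map fun n => e n s) (by
        rw [le_principal_iff]
        change ∀ᶠ n in (U : Filter ℕ), e n s ∈ Metric.closedBall x s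
        filter_upwards [ev s] with n hn
        rw [Metric.mem_closedBall, dist_comm, hdx n s hn])
    exact ⟨y, hy⟩
  choose f hf using hlim
  have hiso : Isometry f := Isometry.of_dist_eq fun s t => by
    refine tendsto_nhds_unique ((hf s).dist (hf t)) ?_
    refine tendsto_const_nhds.congr' ?_
    filter_upwards [ev s, ev t] with n hs ht
    rw [he n s (hd n s hs) t (hd n t ht), NNReal.dist_eq]
  refine ⟨⟨⟨f, hiso.continuous⟩, hiso⟩, ?_, 2 * dist x (c.1 0), fun s => ?_⟩
  · refine tendsto_nhds_unique (hf 0) (tendsto_const_nhds.congr fun n => ?_)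
    rw [NNReal.coe_zero, e0]
  · refine le_of_tendsto ((hf s).dist tendsto_const_nhds) ?_
    filter_upwards [ev s] with n hn
    refine hX.dist_segment_ray_le c x (e n s) n s hn (hdx n s hn) ?_
    conv_lhs => rw [← e1 n]
    rw [he n s (hd n s hn) _ ⟨dist_nonneg, le_rfl⟩, abs_sub_comm, abs_of_nonneg (by linarith)]

end CAT0
/-! ### The ray from a point to a boundary point -/

section Rays

variable {X : Type*} [MetricSpace X]

open Classical in
/-- The point at distance `r` from `x` on the ray from `x` in the class `ξ` (if there is one). -/
noncomputable def rayPoint (x : X) (r : ℝ≥0) (ξ : Boundary X) : X :=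
  if h : ∃ c : GeodesicRay X, c.1 0 = x ∧ Quotient.mk _ c = ξ then (Classical.choose h).1 r else x

theorem IsCAT0.rayPoint_eq (hX : IsCAT0 X) (c : GeodesicRay X) (r : ℝ≥0) :
    rayPoint (c.1 0) r (Quotient.mk _ c) = c.1 r := by
  have h : ∃ c' : GeodesicRay X, c'.1 0 = c.1 0 ∧
    (Quotient.mk _ c' : Boundary X) = Quotient.mk _ c := ⟨c, rfl, rfl⟩
  rw [rayPoint, dif_pos h, hX.eq_of_asymptotic (Quotient.exact (Classical.choose_spec h).2)
    (Classical.choose_spec h).1]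

theorem IsCAT0.exists_ray_of_boundary [ProperSpace X] (hX : IsCAT0 X) (x : X) (ξ : Boundary X) :
    ∃ c : GeodesicRay X, c.1 0 = x ∧ Quotient.mk _ c = ξ ∧ ∀ r, rayPoint x r ξ = c.1 r := by
  induction ξ using Quotient.inductionOn with | _ c =>
  obtain ⟨c', h0, h⟩ := hX.exists_ray x c
  refine ⟨c', h0, Quotient.sound h, fun r => ?_⟩
  rw [← h0, ← hX.rayPoint_eq c' r]
  congr 1
  exact (Quotient.sound h).symm

theorem smul_mk (g : X ≃ᵢ X) (c : GeodesicRay X) :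
    g • (Quotient.mk _ c : Boundary X) = Quotient.mk _ (mapRay g c) := rfl

variable [ProperSpace X]

theorem IsCAT0.rayPoint_zero (hX : IsCAT0 X) (x : X) (ξ : Boundary X) : rayPoint x 0 ξ = x := by
  obtain ⟨c, h0, -, h⟩ := hX.exists_ray_of_boundary x ξ
  rw [h, h0]

theorem IsCAT0.dist_rayPoint_rayPoint (hX : IsCAT0 X) (x : X) (ξ : Boundary X) (r s : ℝ≥0) :
    dist (rayPoint x r ξ) (rayPoint x s ξ) = |(r : ℝ) - s| := by
  obtain ⟨c, h0, -, h⟩ := hX.exists_ray_of_boundary x ξ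
  rw [h, h, c.dist_eq]

theorem IsCAT0.dist_rayPoint (hX : IsCAT0 X) (x : X) (r : ℝ≥0) (ξ : Boundary X) :
    dist x (rayPoint x r ξ) = r := by
  have := hX.dist_rayPoint_rayPoint x ξ 0 r
  rwa [hX.rayPoint_zero, NNReal.coe_zero, zero_sub, abs_neg, abs_of_nonneg r.coe_nonneg] at this

theorem IsCAT0.dist_rayPoint_le (hX : IsCAT0 X) (x y : X) (r : ℝ≥0) (ξ : Boundary X) :
    dist (rayPoint x r ξ) (rayPoint y r ξ) ≤ dist x y := by
  obtain ⟨c, h0, hc, h⟩ := hX.exists_ray_of_boundary x ξ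
  obtain ⟨c', h0', hc', h'⟩ := hX.exists_ray_of_boundary y ξ
  rw [h, h', ← h0, ← h0']
  exact hX.dist_le_of_asymptotic (Quotient.exact (hc.trans hc'.symm)) r

theorem IsCAT0.dist_rayPoint_ray_le (hX : IsCAT0 X) (x : X) (c : GeodesicRay X) (r : ℝ≥0) :
    dist (rayPoint x r (Quotient.mk _ c)) (c.1 r) ≤ dist x (c.1 0) := by
  rw [← hX.rayPoint_eq c r]
  exact hX.dist_rayPoint_le _ _ _ _

theorem IsCAT0.mul_dist_rayPoint_le (hX : IsCAT0 X) (x : X) (ξ η : Boundary X) {s t : ℝ≥0}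
    (hst : s ≤ t) : t * dist (rayPoint x s ξ) (rayPoint x s η) ≤
      s * dist (rayPoint x t ξ) (rayPoint x t η) := by
  obtain ⟨c, h0, -, h⟩ := hX.exists_ray_of_boundary x ξ
  obtain ⟨c', h0', -, h'⟩ := hX.exists_ray_of_boundary x η
  simp only [h, h']
  exact hX.mul_dist_le (h0.trans h0'.symm) hst

theorem IsCAT0.dist_rayPoint_mono (hX : IsCAT0 X) (x : X) (ξ η : Boundary X) {s t : ℝ≥0}
    (hst : s ≤ t) : dist (rayPoint x s ξ) (rayPoint x s η) ≤
      dist (rayPoint x t ξ) (rayPoint x t η) := by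
  rcases eq_or_ne t 0 with rfl | ht
  · rw [le_antisymm hst zero_le]
  have ht' : (0 : ℝ) < t := by exact_mod_cast pos_iff_ne_zero.2 ht
  have h1 := hX.mul_dist_rayPoint_le x ξ η hst
  have h2 : (s : ℝ) * dist (rayPoint x t ξ) (rayPoint x t η) ≤
      t * dist (rayPoint x t ξ) (rayPoint x t η) := by gcongr
  exact le_of_mul_le_mul_left (h1.trans h2) ht'

theorem IsCAT0.eq_of_rayPoint_eq (hX : IsCAT0 X) (x : X) {ξ η : Boundary X}
    (h : ∀ r, rayPoint x r ξ = rayPoint x r η) : ξ = η := by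
  obtain ⟨c, h0, hc, h1⟩ := hX.exists_ray_of_boundary x ξ
  obtain ⟨c', h0', hc', h1'⟩ := hX.exists_ray_of_boundary x η
  rw [← hc, ← hc']
  congr 1
  apply Subtype.ext
  ext r
  rw [← h1, ← h1', h]

theorem IsCAT0.tendsto_dist_rayPoint (hX : IsCAT0 X) (x : X) {ξ η : Boundary X} (h : ξ ≠ η) :
    Tendsto (fun r => dist (rayPoint x r ξ) (rayPoint x r η)) atTop atTop := by
  have : ∃ s, rayPoint x s ξ ≠ rayPoint x s η := by
    by_contra! hn
    exact h (hX.eq_of_rayPoint_eq x hn)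
  obtain ⟨s, hs⟩ := this
  have hd := dist_pos.2 hs
  have hs0 : (0 : ℝ) < s := by
    rcases eq_or_ne s 0 with rfl | h0
    · simp [hX.rayPoint_zero] at hs
    · exact_mod_cast pos_iff_ne_zero.2 h0
  refine tendsto_atTop_mono' (f₁ := fun r : ℝ≥0 =>
    dist (rayPoint x s ξ) (rayPoint x s η) / s * (r : ℝ)) _ ?_ ?_
  · filter_upwards [eventually_ge_atTop s] with r hr
    have := hX.mul_dist_rayPoint_le x ξ η hr
    rw [div_mul_eq_mul_div, div_le_iff₀ hs0]
    linarith
  · exact (NNReal.tendsto_coe_atTop.2 tendsto_id).const_mul_atTop (by positivity)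

theorem IsCAT0.smul_rayPoint (hX : IsCAT0 X) (g : X ≃ᵢ X) (x : X) (r : ℝ≥0) (ξ : Boundary X) :
    rayPoint (g x) r (g • ξ) = g (rayPoint x r ξ) := by
  obtain ⟨c, h0, hc, h⟩ := hX.exists_ray_of_boundary x ξ
  rw [h, ← hc, ← h0, smul_mk]
  exact hX.rayPoint_eq (mapRay g c) r

/-- Two rays that are close at times 0 and `T` have asymptotic rays from `x` that are at most `2 * D
+ 2` apart at time `T`; convexity shrinks this by the factor `r / T` at time `r`. The choice of `T`
makes the result smaller than `ε`. -/
theorem IsCAT0.continuous_rayPoint (hX : IsCAT0 X) (x : X) (r : ℝ≥0) :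
    Continuous (rayPoint x r) := by
  have hq : IsQuotientMap (Quotient.mk (asymptoticSetoid X)) := isQuotientMap_quotient_mk'
  rw [hq.continuous_iff, continuous_iff_continuousAt]
  intro c
  rw [ContinuousAt, Metric.tendsto_nhds]
  intro ε hε
  set D := dist x (c.1 0) with hD
  have hD0 : 0 ≤ D := dist_nonneg
  set T : ℝ≥0 := r + ⟨r * (2 * D + 3) / ε, by positivity⟩ with hT
  have hTr : r ≤ T := le_self_add
  have hTε : r * (2 * D + 3) ≤ T * ε := by
    have : (T : ℝ) = r + r * (2 * D + 3) / ε := rfl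
    rw [this, add_mul, div_mul_cancel₀ _ hε.ne']
    nlinarith [r.2]
  have ev : ∀ s : ℝ≥0, ∀ᶠ c' in 𝓝 c, dist (c'.1 s) (c.1 s) < 1 := fun s =>
    (Metric.tendsto_nhds.1 (((continuous_eval_const s).comp continuous_subtype_val).tendsto c)
      1 one_pos)
  filter_upwards [ev 0, ev T] with c' h0 hT'
  rcases eq_or_ne T 0 with h | h
  · have : r = 0 := le_antisymm (h ▸ hTr) zero_le
    subst this
    simp only [Function.comp, hX.rayPoint_zero, dist_self, hε]
  have hTpos : (0 : ℝ) < T := by exact_mod_cast pos_iff_ne_zero.2 h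
  have h1 := hX.dist_rayPoint_ray_le x c T
  have h2 := hX.dist_rayPoint_ray_le x c' T
  have h3 : dist x (c'.1 0) ≤ D + 1 := by
    have := dist_triangle x (c.1 0) (c'.1 0)
    rw [dist_comm (c.1 0)] at this
    linarith
  have h4 := hX.mul_dist_rayPoint_le x (Quotient.mk _ c') (Quotient.mk _ c) hTr
  have h5 := dist_triangle4 (rayPoint x T (Quotient.mk _ c')) (c'.1 T) (c.1 T)
    (rayPoint x T (Quotient.mk _ c))
  rw [dist_comm (c.1 T)] at h5
  have h6 : dist (rayPoint x T (Quotient.mk _ c')) (rayPoint x T (Quotient.mk _ c)) ≤ 2 * D + 2 := by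
    linarith
  rcases eq_or_ne r 0 with hr | hr
  · subst hr
    simp only [Function.comp, hX.rayPoint_zero, dist_self, hε]
  have hrpos : (0 : ℝ) < r := by exact_mod_cast pos_iff_ne_zero.2 hr
  have h7 : (T : ℝ) * dist (rayPoint x r (Quotient.mk _ c')) (rayPoint x r (Quotient.mk _ c)) <
      T * ε := by nlinarith
  exact lt_of_mul_lt_mul_left h7 hTpos.le

end Rays
/-! ### Contracting sets -/

section Contracting

variable {X : Type*} [MetricSpace X]

/-- `p` is a point of `S` closest to `x`. -/
def IsFoot (S : Set X) (x p : X) : Prop := p ∈ S ∧ dist x p = Metric.infDist x S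

theorem range_comp_neg {α : Type*} (γ : ℝ → α) : range (fun t => γ (-t)) = range γ :=
  (Equiv.neg ℝ).surjective.range_comp γ

theorem IsFoot.of_mem {S : Set X} {x p : X} (hx : x ∈ S) (h : IsFoot S x p) : p = x := by
  have := h.2
  rw [Metric.infDist_zero_of_mem hx, dist_eq_zero] at this
  exact this.symm

theorem IsContracting.dist_le {B : ℝ} {S : Set X} (hS : IsContracting B S) {x y p q : X}
    (h : dist x y < Metric.infDist x S) (hp : IsFoot S x p) (hq : IsFoot S y q) :
    dist p q ≤ B := by
  refine hS x (dist x y) ?_ x (Metric.mem_closedBall_self dist_nonneg) y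
    (by rw [Metric.mem_closedBall, dist_comm]) p hp.1 q hq.1 hp.2 hq.2
  rw [Set.disjoint_left]
  intro s hs hsS
  have := Metric.infDist_le_dist_of_mem (x := x) hsS
  rw [Metric.mem_closedBall, dist_comm] at hs
  linarith

/-- The projection is coarsely Lipschitz: if no ball around `x` avoiding `S` contains `y`, then both
points are so close to `S` that the triangle inequality suffices. -/
theorem IsContracting.dist_le_max {B : ℝ} {S : Set X} (hS : IsContracting B S) {x y p q : X}
    (hp : IsFoot S x p) (hq : IsFoot S y q) : dist p q ≤ max B (4 * dist x y) := by
  rcases lt_or_ge (dist x y) (Metric.infDist x S) with h | h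
  · exact (hS.dist_le h hp hq).trans (le_max_left _ _)
  · refine le_trans ?_ (le_max_right _ _)
    have h1 := dist_triangle4 p x y q
    have h2 : Metric.infDist y S ≤ Metric.infDist x S + dist y x := Metric.infDist_le_infDist_add_dist
    rw [dist_comm p x, hp.2, hq.2] at h1
    rw [dist_comm y x] at h2
    linarith

variable [ProperSpace X]

theorem exists_isFoot {S : Set X} (hc : IsClosed S) (hne : S.Nonempty) (x : X) :
    ∃ p, IsFoot S x p := by
  obtain ⟨p, hp, h⟩ := hc.exists_infDist_eq_dist hne x
  exact ⟨p, hp, h.symm⟩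

/-- If the sum exceeded `dist x y`, some point `w` of a segment from `x` to `y` would lie in balls
around both endpoints that avoid `S`. Its foot would then be `B`-close to both feet. -/
theorem IsCAT0.infDist_add_infDist_le (hX : IsCAT0 X) {B : ℝ} (hB : 0 ≤ B) {S : Set X}
    (hc : IsClosed S) (hne : S.Nonempty) (hS : IsContracting B S) {x y p q : X}
    (hp : IsFoot S x p) (hq : IsFoot S y q) (h : 2 * B < dist p q) :
    Metric.infDist x S + Metric.infDist y S ≤ dist x y := by
  by_contra! hlt
  rcases lt_or_ge (dist x y) (Metric.infDist x S) with h1 | h1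
  · linarith [hS.dist_le h1 hp hq]
  rcases lt_or_ge (dist x y) (Metric.infDist y S) with h2 | h2
  · rw [dist_comm] at h2
    linarith [hS.dist_le h2 hq hp, dist_comm p q]
  obtain ⟨w, hw, hw'⟩ := hX.exists_segment x y
    ((dist x y - Metric.infDist y S + Metric.infDist x S) / 2)
    (by linarith [Metric.infDist_nonneg (x := x) (s := S)]) (by
      linarith [Metric.infDist_nonneg (x := y) (s := S)])
  obtain ⟨z, hz⟩ := exists_isFoot hc hne w
  have h3 := hS.dist_le (by linarith) hp hz
  have h4 := hS.dist_le (by rw [dist_comm]; linarith) hq hz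
  have := dist_triangle_right p q z
  linarith

/-- A geodesic from `x` to a far away point of a contracting set `S` passes near the foot of `x`
in `S`. -/
theorem IsCAT0.dist_geodesic_foot_le (hX : IsCAT0 X) {B : ℝ} (hB : 0 < B) {S : Set X}
    (hc : IsClosed S) (hne : S.Nonempty) (hS : IsContracting B S) {x y p : X}
    (hp : IsFoot S x p) (hy : y ∈ S) (hpy : 6 * B ≤ dist p y) {e : ℝ → X} (e0 : e 0 = x)
    (e1 : e (dist x y) = y)
    (he : ∀ s ∈ Icc 0 (dist x y), ∀ t ∈ Icc 0 (dist x y), dist (e s) (e t) = |s - t|) :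
    dist (e (Metric.infDist x S)) p ≤ 8 * B := by
  set L := dist x y with hL
  have hL0 : 0 ≤ L := dist_nonneg
  set d := Metric.infDist x S with hd
  have hd0 : 0 ≤ d := Metric.infDist_nonneg
  have hdL : d ≤ L := Metric.infDist_le_dist_of_mem hy
  have hf : ∀ z, ∃ q, IsFoot S z q ∧ (z = x → q = p) := fun z => by
    by_cases h : z = x
    · exact ⟨p, h ▸ hp, fun _ => rfl⟩
    · obtain ⟨q, hq⟩ := exists_isFoot hc hne z
      exact ⟨q, hq, fun h' => absurd h' h⟩
  choose f hf hfx using hf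
  rcases hd0.eq_or_lt with h0 | hdpos
  · rw [← h0, e0, hp.2, ← hd, ← h0]; positivity
  have hxe : ∀ t ∈ Icc 0 L, dist x (e t) = t := fun t ht => by
    conv_lhs => rw [← e0]
    rw [he 0 ⟨le_rfl, hL0⟩ t ht, zero_sub, abs_neg, abs_of_nonneg ht.1]
  obtain ⟨N, hN⟩ := exists_nat_gt (4 * L / B)
  have hN0 : (0 : ℝ) < N := lt_of_le_of_lt (by positivity) hN
  set δ := L / N with hδ
  have hδ0 : 0 ≤ δ := by positivity
  have hδB : 4 * δ ≤ B := by
    rw [div_lt_iff₀ hB] at hN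
    rw [hδ, mul_div_assoc', div_le_iff₀ hN0]
    linarith
  have hkL : ∀ k : ℕ, k ≤ N → (k : ℝ) * δ ∈ Icc 0 L := fun k hk => by
    refine ⟨by positivity, ?_⟩
    have h1 : (k : ℝ) ≤ N := by exact_mod_cast hk
    calc (k : ℝ) * δ ≤ N * δ := by gcongr
      _ = L := by rw [hδ]; field_simp
  -- Along a subdivision of mesh at most `B / 4` the foot moves by at most `B` per step, and it goes
  -- from `p` to `y`. So at some time `t` it is between `5 * B` and `6 * B` from `p`.
  obtain ⟨k, hkN, hk1, hk2⟩ : ∃ k : ℕ, k + 1 ≤ N ∧ dist p (f (e (k * δ))) < 5 * B ∧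
      5 * B ≤ dist p (f (e ((k + 1 : ℕ) * δ))) := by
    by_contra! hcon
    have : ∀ k : ℕ, k ≤ N → dist p (f (e (k * δ))) < 5 * B := fun k => by
      induction k with
      | zero =>
        intro _
        rw [Nat.cast_zero, zero_mul, e0, hfx x rfl, dist_self]; positivity
      | succ k ih => exact fun hk => hcon k hk (ih (by omega))
    have h1 := this N le_rfl
    have h2 : (N : ℝ) * δ = L := by rw [hδ]; field_simp
    rw [h2, e1, (hf y).of_mem hy] at h1
    linarith
  set t := ((k + 1 : ℕ) : ℝ) * δ with ht
  have htL := hkL (k + 1) hkN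
  have hstep : dist (f (e (k * δ))) (f (e t)) ≤ B := by
    refine (hS.dist_le_max (hf _) (hf _)).trans (max_le le_rfl ?_)
    rw [he _ (hkL k (by omega)) _ htL]
    have : (k : ℝ) * δ - ((k + 1 : ℕ) : ℝ) * δ = -δ := by push_cast; ring
    rw [this, abs_neg, abs_of_nonneg hδ0]
    exact hδB
  have h6 : dist p (f (e t)) ≤ 6 * B := by
    have := dist_triangle p (f (e (k * δ))) (f (e t))
    linarith
  have hdt : d ≤ t := by
    by_contra! hlt
    have := hS.dist_le (by rw [hxe t htL]; exact hlt) hp (hf (e t))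
    linarith
  -- A time slightly before `d`: the ball up to `e w` still avoids `S`, so its foot is `B`-close to
  -- `p`, and one more short step reaches `e d`.
  set w := d - min d (B / 4) with hw
  have hw0 : 0 ≤ w := sub_nonneg.2 (min_le_left _ _)
  have hwd : w < d := by
    have : 0 < min d (B / 4) := lt_min hdpos (by positivity)
    linarith
  have hwL : w ∈ Icc 0 L := ⟨hw0, by linarith⟩
  have hdI : d ∈ Icc 0 L := ⟨hd0, hdL⟩
  have h7 : dist p (f (e w)) ≤ B := hS.dist_le (by rw [hxe w hwL]; exact hwd) hp (hf _)
  have h8 : dist (f (e w)) (f (e d)) ≤ B := by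
    refine (hS.dist_le_max (hf _) (hf _)).trans (max_le le_rfl ?_)
    rw [he w hwL d hdI, abs_sub_comm, abs_of_nonneg (by linarith)]
    have : min d (B / 4) ≤ B / 4 := min_le_right _ _
    linarith
  have h9 : dist p (f (e d)) ≤ 2 * B := by
    have := dist_triangle p (f (e w)) (f (e d))
    linarith
  have h10 : 2 * B < dist (f (e d)) (f (e t)) := by
    have := dist_triangle p (f (e d)) (f (e t))
    linarith
  -- The feet of `e d` and `e t` are more than `2 * B` apart, so the distances of these two points
  -- to `S` add up to at most `t - d`. Since `t` is at most `d + 6 * B` plus the distance of `e t`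
  -- to `S`, the point `e d` is within `6 * B` of `S`, and its foot is within `2 * B` of `p`.
  have h11 := hX.infDist_add_infDist_le hB.le hc hne hS (hf _) (hf _) h10
  rw [he d hdI t htL, abs_sub_comm, abs_of_nonneg (by linarith)] at h11
  have h12 := dist_triangle4 x p (f (e t)) (e t)
  rw [hxe t htL, hp.2, dist_comm _ (e t), (hf (e t)).2] at h12
  have h13 := dist_triangle (e d) (f (e d)) p
  rw [(hf (e d)).2, dist_comm (f (e d))] at h13
  linarith

theorem IsCAT0.mul_dist_segment_rayPoint_le (hX : IsCAT0 X) (c : GeodesicRay X) {x p : X}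
    {n s : ℝ≥0} (hs : s ≤ dist x (c.1 n)) (hxp : dist x p = s)
    (hpc : dist p (c.1 n) = dist x (c.1 n) - s) :
    dist x (c.1 n) * dist p (rayPoint x s (Quotient.mk _ c)) ≤ s * (2 * dist x (c.1 0)) := by
  set L := dist x (c.1 n) with hL
  set ξ : Boundary X := Quotient.mk _ c
  have hLn : 0 ≤ L := dist_nonneg
  rcases hLn.eq_or_lt with h0 | h0
  · rw [← h0, zero_mul]; positivity
  set L' : ℝ≥0 := ⟨L, hLn⟩
  have hL' : (L' : ℝ) = L := rfl
  have hsL : s ≤ L' := hs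
  have hsL1 : (s : ℝ) / L ≤ 1 := by rw [div_le_one h0]; exact hs
  have hL0 : L ≠ 0 := h0.ne'
  have d1 : dist (rayPoint x s ξ) (rayPoint x L' ξ) = L - s := by
    rw [hX.dist_rayPoint_rayPoint, abs_sub_comm, hL', abs_of_nonneg (sub_nonneg.2 hs)]
  have d2 : dist x (rayPoint x L' ξ) = L := hX.dist_rayPoint x L' ξ
  have h1 := hX.dist_le_mul (x := x) (y := c.1 n) (z := rayPoint x L' ξ) (p := p)
    (q := rayPoint x s ξ) (t := s / L) (by positivity) hsL1
    (by rw [hxp, ← hL]; field_simp) (by rw [hpc, ← hL]; field_simp)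
    (by rw [hX.dist_rayPoint, d2]; field_simp) (by rw [d1, d2]; field_simp)
  rw [div_mul_eq_mul_div, le_div_iff₀ h0] at h1
  have h2 := hX.dist_rayPoint_ray_le x c n
  have h3 : dist (rayPoint x n ξ) (rayPoint x L' ξ) ≤ dist x (c.1 0) := by
    rw [hX.dist_rayPoint_rayPoint]
    have e1 := dist_triangle x (c.1 0) (c.1 n)
    have e2 := dist_triangle_left (c.1 0) (c.1 n) x
    have e3 : dist (c.1 0) (c.1 n) = n := by rw [c.dist_eq' zero_le]; simp
    rw [e3] at e1 e2
    rw [hL']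
    exact abs_le.2 ⟨by linarith, by linarith⟩
  have h4 := dist_triangle_left (c.1 n) (rayPoint x L' ξ) (rayPoint x n ξ)
  calc L * dist p (rayPoint x s ξ) ≤ s * dist (c.1 n) (rayPoint x L' ξ) := by linarith
    _ ≤ s * (2 * dist x (c.1 0)) := by gcongr; linarith

end Contracting

/-! ### Geodesic lines -/

section Lines

variable {X : Type*} [MetricSpace X]

/-- `γ` is a geodesic line from `ξ` to `η`. -/
structure Joins (γ : ℝ → X) (ξ η : Boundary X) : Prop where
  isometry : Isometry γ
  neg : negEnd γ isometry = ξ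
  pos : posEnd γ isometry = η

theorem Joins.symm {γ : ℝ → X} {ξ η : Boundary X} (h : Joins γ ξ η) :
    Joins (fun t => γ (-t)) η ξ := by
  rcases h with ⟨hγ, rfl, rfl⟩
  refine ⟨hγ.comp (IsometryEquiv.neg ℝ).isometry, ?_, rfl⟩
  simp only [negEnd, neg_neg]

theorem Joins.smul {γ : ℝ → X} {ξ η : Boundary X} (h : Joins γ ξ η) (g : X ≃ᵢ X) :
    Joins (fun t => g (γ t)) (g • ξ) (g • η) := by
  rcases h with ⟨hγ, rfl, rfl⟩
  exact ⟨g.isometry.comp hγ, rfl, rfl⟩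

theorem IsContracting.smul {B : ℝ} {γ : ℝ → X} (h : IsContracting B (range γ)) (g : X ≃ᵢ X) :
    IsContracting B (range fun t => g (γ t)) := by
  have hr : (range fun t => g (γ t)) = g '' range γ := range_comp g γ
  rw [hr]
  intro z r hd x hx y hy p hp q hq hxp hyq
  obtain ⟨p, hp, rfl⟩ := hp
  obtain ⟨q, hq, rfl⟩ := hq
  have hi : ∀ x, Metric.infDist x (g '' range γ) = Metric.infDist (g.symm x) (range γ) := fun x => by
    conv_lhs => rw [← g.apply_symm_apply x]
    exact Metric.infDist_image g.isometry
  have hdist : ∀ x y, dist x (g y) = dist (g.symm x) y := fun x y => by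
    conv_lhs => rw [← g.apply_symm_apply x]
    exact g.isometry.dist_eq _ _
  rw [g.isometry.dist_eq]
  refine h (g.symm z) r ?_ (g.symm x) ?_ (g.symm y) ?_ p hp q hq ?_ ?_
  · rw [Set.disjoint_left] at hd ⊢
    intro w hw hwS
    refine hd ?_ (mem_image_of_mem g hwS)
    rwa [Metric.mem_closedBall, dist_comm, hdist, dist_comm]
  · rwa [Metric.mem_closedBall, g.symm.isometry.dist_eq]
  · rwa [Metric.mem_closedBall, g.symm.isometry.dist_eq]
  · rw [← hdist, hxp, hi]
  · rw [← hdist, hyq, hi]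

theorem mem_contractingPairs {B : ℝ} {c : Boundary X × Boundary X} :
    c ∈ contractingPairs X B ↔
      c.1 ≠ c.2 ∧ ∃ γ, Joins γ c.1 c.2 ∧ IsContracting B (range γ) :=
  ⟨fun ⟨h, γ, h1, h2, h3, h4⟩ => ⟨h, γ, ⟨h1, h2, h3⟩, h4⟩,
    fun ⟨h, γ, h1, h2⟩ => ⟨h, γ, h1.1, h1.2, h1.3, h2⟩⟩

theorem swap_mem_contractingPairs {B : ℝ} {c : Boundary X × Boundary X}
    (h : c ∈ contractingPairs X B) : c.swap ∈ contractingPairs X B := by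
  rw [mem_contractingPairs] at h ⊢
  obtain ⟨h, γ, h1, h2⟩ := h
  exact ⟨h.symm, _, h1.symm, by rwa [range_comp_neg]⟩

theorem smul_mem_contractingPairs {B : ℝ} {c : Boundary X × Boundary X}
    (h : c ∈ contractingPairs X B) (g : X ≃ᵢ X) : g • c ∈ contractingPairs X B := by
  rw [mem_contractingPairs] at h ⊢
  obtain ⟨h, γ, h1, h2⟩ := h
  exact ⟨fun h' => h (smul_left_cancel g h'), _, h1.smul g, h2.smul g⟩

/-- The ray `t ↦ γ (s + t)`. -/
def lineRay (γ : ℝ → X) (hγ : Isometry γ) (s : ℝ) : GeodesicRay X :=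
  ⟨⟨fun t : ℝ≥0 => γ (s + t), hγ.continuous.comp (by fun_prop)⟩,
    hγ.comp ((IsometryEquiv.addLeft s).isometry.comp isometry_subtype_coe)⟩

theorem mk_lineRay (γ : ℝ → X) (hγ : Isometry γ) (s : ℝ) :
    (Quotient.mk _ (lineRay γ hγ s) : Boundary X) = posEnd γ hγ := by
  refine Quotient.sound ⟨|s|, fun t => le_of_eq ?_⟩
  change dist (γ (s + t)) (γ t) = |s|
  rw [hγ.dist_eq, Real.dist_eq]
  simp

theorem Joins.mk_lineRay {γ : ℝ → X} {ξ η : Boundary X} (h : Joins γ ξ η) (s : ℝ) :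
    Quotient.mk _ (lineRay γ h.isometry s) = η := by
  rw [RankOne.mk_lineRay, h.pos]

theorem Joins.isClosed_range {γ : ℝ → X} {ξ η : Boundary X} (h : Joins γ ξ η) :
    IsClosed (range γ) :=
  h.isometry.isClosedEmbedding.isClosed_range

/-- A Busemann function. -/
theorem IsCAT0.exists_busemann (hX : IsCAT0 X) (η : Boundary X) :
    ∃ b : X → ℝ, (∀ x y, |b x - b y| ≤ dist x y) ∧
      ∀ γ ξ, Joins γ ξ η → ∀ s, b (γ s) = b (γ 0) - s := by
  induction η using Quotient.inductionOn with | _ c =>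
  have hlim : ∀ x, ∃ l, Tendsto (fun t : ℝ≥0 => dist x (c.1 t) - t) atTop (𝓝 l) := fun x => by
    refine ⟨_, tendsto_atTop_ciInf (fun s t hst => ?_) ⟨-dist x (c.1 0), ?_⟩⟩
    · have := dist_triangle x (c.1 s) (c.1 t)
      rw [c.dist_eq' hst] at this
      linarith
    · rintro _ ⟨t, rfl⟩
      have := dist_triangle_left (c.1 0) (c.1 t) x
      rw [c.dist_eq' zero_le, NNReal.coe_zero] at this
      change _ ≤ dist x (c.1 t) - t
      linarith
  choose b hb using hlim
  have hLip : ∀ x y, b x - b y ≤ dist x y := fun x y => by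
    refine le_of_tendsto ((hb x).sub (hb y)) (Eventually.of_forall fun t => ?_)
    have := dist_triangle x y (c.1 t)
    linarith
  refine ⟨b, fun x y => abs_le.2 ⟨by linarith [hLip y x, dist_comm x y], hLip x y⟩, ?_⟩
  have key : ∀ γ ξ, Joins γ ξ (Quotient.mk _ c) → ∀ s s', s ≤ s' → b (γ s') = b (γ s) - (s' - s) := by
    intro γ ξ hγ s s' hss'
    refine le_antisymm ?_ ?_
    -- The line is only asymptotic to the ray `c` defining `b`. Convexity of the distance to `c t`
    -- along `γ` from `s` to `s + t` gives the bound up to an error `2 * D * (s' - s) / t`, which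
    -- disappears in the limit.
    · set c' := lineRay γ hγ.isometry s
      have hcc' : c' ≈ c := Quotient.exact (hγ.mk_lineRay s)
      set D := dist (c'.1 0) (c.1 0)
      have hD : ∀ t, dist (c'.1 t) (c.1 t) ≤ D := hX.dist_le_of_asymptotic hcc'
      have hc' : ∀ t, c'.1 t = γ (s + t) := fun _ => rfl
      have hlim2 : Tendsto (fun t : ℝ≥0 => dist (γ s) (c.1 t) - t - (s' - s) +
          2 * D * (s' - s) / t) atTop (𝓝 (b (γ s) - (s' - s) + 0)) := by
        refine ((hb (γ s)).sub_const _).add ?_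
        exact Tendsto.div_atTop tendsto_const_nhds (NNReal.tendsto_coe_atTop.2 tendsto_id)
      rw [add_zero] at hlim2
      refine le_of_tendsto_of_tendsto (hb (γ s')) hlim2 ?_
      filter_upwards [eventually_ge_atTop (⟨s' - s, by linarith⟩ : ℝ≥0), eventually_gt_atTop 0]
        with t ht ht0
      have ht' : s' - s ≤ (t : ℝ) := ht
      have ht0' : (0 : ℝ) < t := ht0
      have hl1 : (s' - s) / t ≤ 1 := by rw [div_le_one ht0']; exact ht'
      have hl0 : 0 ≤ (s' - s) / t := div_nonneg (by linarith) ht0'.le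
      have h1 := hX.dist_le_convex (x := c.1 t) (y := γ s) (z := c'.1 t) (p := γ s') hl0 hl1
        (by rw [hc', hγ.isometry.dist_eq, hγ.isometry.dist_eq, Real.dist_eq, Real.dist_eq,
              abs_sub_comm, abs_of_nonneg (by linarith)]
            simp
            field_simp)
        (by rw [hc', hγ.isometry.dist_eq, hγ.isometry.dist_eq, Real.dist_eq, Real.dist_eq,
              abs_sub_comm, abs_of_nonneg (by linarith)]
            simp
            field_simp
            ring)
      have h2 := hD t
      rw [dist_comm] at h2
      have h3 : t - D ≤ dist (γ s) (c.1 t) := by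
        have := dist_triangle (γ s) (c.1 t) (c'.1 t)
        have h4 : dist (γ s) (c'.1 t) = t := by
          rw [hc', hγ.isometry.dist_eq, Real.dist_eq]; simp
        linarith
      rw [dist_comm (c.1 t), dist_comm (c.1 t)] at h1
      have h5 : (s' - s) / t * dist (c.1 t) (c'.1 t) ≤ (s' - s) / t * D := by gcongr
      have h6 : (s' - s) / t * (t - D) ≤ (s' - s) / t * dist (γ s) (c.1 t) := by gcongr
      have h7 : (s' - s) / t * (t - D) = (s' - s) - (s' - s) / t * D := by field_simp
      have h8 : 2 * D * (s' - s) / t = 2 * ((s' - s) / t * D) := by ring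
      rw [h8]
      linarith
    · have := hLip (γ s) (γ s')
      rw [hγ.isometry.dist_eq, Real.dist_eq, abs_sub_comm, abs_of_nonneg (by linarith)] at this
      linarith
  intro γ ξ hγ s
  rcases le_total 0 s with h | h
  · rw [key γ ξ hγ 0 s h]; ring
  · rw [key γ ξ hγ s 0 h]; ring

theorem Joins.rayPoint (hX : IsCAT0 X) {γ : ℝ → X} {ξ η : Boundary X} (h : Joins γ ξ η)
    (s : ℝ) (r : ℝ≥0) : rayPoint (γ s) r η = γ (s + r) := by
  have := hX.rayPoint_eq (lineRay γ h.isometry s) r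
  have h0 : (lineRay γ h.isometry s).1 0 = γ s := by
    change γ (s + (0 : ℝ≥0)) = γ s
    simp
  rw [h.mk_lineRay, h0] at this
  exact this

variable [ProperSpace X]

theorem Joins.exists_dist_eq {γ : ℝ → X} {ξ η : Boundary X} (h : Joins γ ξ η) (x : X) :
    ∃ s, dist x (γ s) = Metric.infDist x (range γ) := by
  obtain ⟨p, ⟨s, rfl⟩, hs⟩ := exists_isFoot h.isClosed_range (range_nonempty γ) x
  exact ⟨s, hs⟩

/-- The segments from `x` to points far out on the line pass within `8 * B` of the foot at time `d`,
and they converge to the ray towards `η`. -/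
theorem Joins.dist_rayPoint_foot_le (hX : IsCAT0 X) {B : ℝ} (hB : 0 < B) {γ : ℝ → X}
    {ξ η : Boundary X} (h : Joins γ ξ η) (hγ : IsContracting B (range γ)) {x p : X}
    (hp : IsFoot (range γ) x p) {d : ℝ≥0} (hd : d = Metric.infDist x (range γ)) :
    dist (RankOne.rayPoint x d η) p ≤ 8 * B := by
  obtain ⟨s, rfl⟩ := hp.1
  set c := lineRay γ h.isometry s
  have hc : ∀ t, c.1 t = γ (s + t) := fun t => rfl
  have hcη : Quotient.mk _ c = η := h.mk_lineRay s
  have hc0 : c.1 0 = γ s := by simp [hc]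
  refine le_of_forall_pos_le_add fun ε hε => ?_
  obtain ⟨n, hn⟩ := exists_nat_gt (max (6 * B) (d + d * (2 * d) / ε))
  set n' : ℝ≥0 := (n : ℝ≥0)
  have hn' : (n' : ℝ) = n := by simp [n']
  have hn1 : 6 * B < n := (le_max_left _ _).trans_lt hn
  have hn2 : d + d * (2 * d) / ε < n := (le_max_right _ _).trans_lt hn
  obtain ⟨e, e0, e1, he⟩ := hX.geodesic x (c.1 n')
  have hdist : dist (γ s) (c.1 n') = n := by
    rw [← hc0, c.dist_eq' zero_le, hn']; simp
  have h1 := hX.dist_geodesic_foot_le hB h.isClosed_range (range_nonempty γ) hγ hp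
    (y := c.1 n') ⟨s + n', rfl⟩ (by rw [hdist]; exact hn1.le) e0 e1 he
  rw [← hd] at h1
  have hxs : dist x (c.1 0) = d := by rw [hc0, hp.2, hd]
  have hL : (n : ℝ) - d ≤ dist x (c.1 n') := by
    have := dist_triangle_left (γ s) (c.1 n') x
    rw [hdist, hp.2, ← hd] at this
    linarith
  have hdd : 0 ≤ (d : ℝ) * (2 * d) / ε := by positivity
  have hdL : (d : ℝ) ≤ dist x (c.1 n') := by
    rw [hd]; exact Metric.infDist_le_dist_of_mem ⟨s + n', rfl⟩
  have hdI : (d : ℝ) ∈ Icc 0 (dist x (c.1 n')) := ⟨d.2, hdL⟩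
  have h2 := hX.mul_dist_segment_rayPoint_le c (x := x) (p := e d) (n := n') (s := d) hdL
    (by conv_lhs => rw [← e0]
        rw [he 0 ⟨le_rfl, dist_nonneg⟩ d hdI]; simp)
    (by conv_lhs => rw [← e1]
        rw [he d hdI _ ⟨dist_nonneg, le_rfl⟩, abs_sub_comm, abs_of_nonneg (by linarith)])
  rw [hcη, hxs] at h2
  have h3 : dist (e d) (RankOne.rayPoint x d η) ≤ ε := by
    by_contra! hlt
    have h4 : (d : ℝ) * (2 * d) / ε < dist x (c.1 n') := by linarith
    rw [div_lt_iff₀ hε] at h4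
    have : dist x (c.1 n') * ε ≤ dist x (c.1 n') * dist (e d) (RankOne.rayPoint x d η) := by
      gcongr
    linarith
  have := dist_triangle_left (RankOne.rayPoint x d η) (γ s) (e d)
  linarith

/-- At time `d`, the distance from `x` to the line, both rays are within `8 * B` of the same foot.
Convexity carries the bound `16 * B` back to a time `r ≤ d` with the factor `r / d`; for `r ≥ d` the
trivial bound `2 * r` is enough. -/
theorem Joins.infDist_mul_dist_le (hX : IsCAT0 X) {B : ℝ} (hB : 0 < B) {γ : ℝ → X}
    {ξ η : Boundary X} (h : Joins γ ξ η) (hγ : IsContracting B (range γ)) (x : X) (r : ℝ≥0) :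
    Metric.infDist x (range γ) * dist (RankOne.rayPoint x r ξ) (RankOne.rayPoint x r η) ≤
      r * max (16 * B) (2 * r) := by
  obtain ⟨p, hp⟩ := exists_isFoot h.isClosed_range (range_nonempty γ) x
  set d : ℝ≥0 := ⟨Metric.infDist x (range γ), Metric.infDist_nonneg⟩
  have hd : (d : ℝ) = Metric.infDist x (range γ) := rfl
  have h1 := h.dist_rayPoint_foot_le hX hB hγ hp hd
  have h2 := h.symm.dist_rayPoint_foot_le hX hB (by rwa [range_comp_neg])
    (p := p) (by rwa [range_comp_neg]) (d := d) (by rw [range_comp_neg, hd])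
  rw [← hd]
  rcases le_total r d with hr | hr
  · refine (hX.mul_dist_rayPoint_le x ξ η hr).trans ?_
    gcongr
    refine le_trans ?_ (le_max_left _ _)
    have := dist_triangle_right (RankOne.rayPoint x d ξ) (RankOne.rayPoint x d η) p
    linarith
  · have hr' : (d : ℝ) ≤ r := hr
    refine mul_le_mul hr' (le_trans ?_ (le_max_right _ _)) dist_nonneg r.2
    have := dist_triangle_left (RankOne.rayPoint x r ξ) (RankOne.rayPoint x r η) x
    rw [hX.dist_rayPoint, hX.dist_rayPoint] at this
    linarith

/-- Points which are close to all three sides of an ideal triangle are close to each other. -/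
theorem IsCAT0.dist_le_of_infDist_le (hX : IsCAT0 X) {γ₁ γ₂ γ₃ : ℝ → X} {σ η β : Boundary X}
    (h₁ : Joins γ₁ σ η) (h₂ : Joins γ₂ η β) (h₃ : Joins γ₃ β σ) {m : ℝ} {x y : X}
    (x₁ : Metric.infDist x (range γ₁) ≤ m) (x₂ : Metric.infDist x (range γ₂) ≤ m)
    (x₃ : Metric.infDist x (range γ₃) ≤ m) (y₁ : Metric.infDist y (range γ₁) ≤ m)
    (y₂ : Metric.infDist y (range γ₂) ≤ m) (y₃ : Metric.infDist y (range γ₃) ≤ m) :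
    dist x y ≤ 10 * m := by
  obtain ⟨bσ, lσ, eσ⟩ := hX.exists_busemann σ
  obtain ⟨bη, lη, eη⟩ := hX.exists_busemann η
  obtain ⟨bβ, lβ, eβ⟩ := hX.exists_busemann β
  -- Along a side the Busemann functions of its two ends vary with slopes 1 and -1, so near it their
  -- increments from `x` to `y` cancel up to `4 * m`, and either increment determines `dist x y` up
  -- to `4 * m`. Around a triangle each increment is nearly the negative of the next, which, three
  -- being odd, forces it to be at most `6 * m`.
  have key : ∀ {b b' : X → ℝ} {ξ ζ : Boundary X} {γ : ℝ → X},
      (∀ x y, |b x - b y| ≤ dist x y) → (∀ x y, |b' x - b' y| ≤ dist x y) →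
      (∀ γ ξ', Joins γ ξ' ξ → ∀ s, b (γ s) = b (γ 0) - s) →
      (∀ γ ξ', Joins γ ξ' ζ → ∀ s, b' (γ s) = b' (γ 0) - s) → Joins γ ξ ζ →
      Metric.infDist x (range γ) ≤ m → Metric.infDist y (range γ) ≤ m →
      |(b x - b y) + (b' x - b' y)| ≤ 4 * m ∧ dist x y ≤ |b x - b y| + 4 * m := by
    intro b b' ξ ζ γ l l' e e' hγ hx hy
    obtain ⟨s, hs⟩ := hγ.exists_dist_eq x
    obtain ⟨t, ht⟩ := hγ.exists_dist_eq y
    rw [← hs] at hx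
    rw [← ht] at hy
    have f1 : ∀ s, b (γ s) = b (γ 0) + s := fun s => by
      have := e _ _ hγ.symm (-s)
      simp only [neg_neg, neg_zero] at this
      linarith
    have f2 := e' _ _ hγ
    have a1 := abs_le.1 ((l x (γ s)).trans hx)
    have a2 := abs_le.1 ((l y (γ t)).trans hy)
    have a3 := abs_le.1 ((l' x (γ s)).trans hx)
    have a4 := abs_le.1 ((l' y (γ t)).trans hy)
    rw [f1] at a1 a2
    rw [f2] at a3 a4
    refine ⟨abs_le.2 ⟨by linarith, by linarith⟩, ?_⟩
    have h1 := dist_triangle4 x (γ s) (γ t) y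
    rw [hγ.isometry.dist_eq, Real.dist_eq, dist_comm (γ t)] at h1
    have h2 : |s - t| ≤ |b x - b y| + 2 * m := by
      have := abs_le.1 (le_refl |b x - b y|)
      exact abs_le.2 ⟨by linarith, by linarith⟩
    linarith
  obtain ⟨k1, k1'⟩ := key lσ lη eσ eη h₁ x₁ y₁
  obtain ⟨k2, -⟩ := key lη lβ eη eβ h₂ x₂ y₂
  obtain ⟨k3, -⟩ := key lβ lσ eβ eσ h₃ x₃ y₃
  rw [abs_le] at k1 k2 k3
  have : |bσ x - bσ y| ≤ 6 * m := abs_le.2 ⟨by linarith, by linarith⟩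
  linarith

end Lines
/-! ### The isometry group -/

section IsometryGroup

variable {X : Type*} [MetricSpace X] [ProperSpace X]

/-- Isometries are equicontinuous, so pointwise convergence is already locally uniform. -/
theorem tendsto_isometryEquiv_iff {ι : Type*} {l : Filter ι} {F : ι → X ≃ᵢ X} {g : X ≃ᵢ X} :
    Tendsto F l (𝓝 g) ↔ ∀ x, Tendsto (fun i => F i x) l (𝓝 (g x)) := by
  have hi : IsInducing (fun g : X ≃ᵢ X => (⟨g, g.continuous⟩ : C(X, X))) := ⟨rfl⟩
  rw [hi.tendsto_nhds_iff]
  refine ⟨fun h x => ((continuous_eval_const (F := C(X, X)) x).tendsto _).comp h,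
    fun h => ?_⟩
  rw [ContinuousMap.tendsto_iff_tendstoLocallyUniformly, Metric.tendstoLocallyUniformly_iff]
  intro ε hε x
  refine ⟨Metric.ball x (ε / 3), Metric.ball_mem_nhds _ (by positivity), ?_⟩
  filter_upwards [Metric.tendsto_nhds.1 (h x) (ε / 3) (by positivity)] with i hi y hy
  rw [Metric.mem_ball] at hy
  change dist (g y) (F i y) < ε
  have h1 := dist_triangle4 (g y) (g x) (F i x) (F i y)
  rw [g.isometry.dist_eq, (F i).isometry.dist_eq, dist_comm (g x), dist_comm x] at h1
  linarith

theorem continuous_isometryEquiv_apply : Continuous fun q : (X ≃ᵢ X) × X => q.1 q.2 := by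
  rw [continuous_iff_continuousAt]
  rintro ⟨g, x⟩
  rw [ContinuousAt, tendsto_iff_dist_tendsto_zero]
  have h1 : Tendsto (fun q : (X ≃ᵢ X) × X => q.1 x) (𝓝 (g, x)) (𝓝 (g x)) :=
    tendsto_isometryEquiv_iff.1 continuousAt_fst x
  have h2 : Tendsto (fun q : (X ≃ᵢ X) × X => q.2) (𝓝 (g, x)) (𝓝 x) := continuousAt_snd
  rw [tendsto_iff_dist_tendsto_zero] at h1 h2
  refine squeeze_zero (fun _ => dist_nonneg) (fun q => ?_) (by simpa using h2.add h1)
  refine (dist_triangle _ (q.1 x) _).trans_eq ?_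
  rw [q.1.isometry.dist_eq]

instance : ContinuousMul (X ≃ᵢ X) where
  continuous_mul := by
    rw [continuous_iff_continuousAt]
    intro q
    refine tendsto_isometryEquiv_iff.2 fun x => ?_
    have h : Continuous fun q : (X ≃ᵢ X) × (X ≃ᵢ X) => q.1 (q.2 x) :=
      continuous_isometryEquiv_apply.comp (continuous_fst.prodMk
        (continuous_isometryEquiv_apply.comp (continuous_snd.prodMk continuous_const)))
    exact h.tendsto q

instance : SecondCountableTopology (X ≃ᵢ X) :=
  IsInducing.secondCountableTopology
    (f := fun g : X ≃ᵢ X => (⟨g, g.continuous⟩ : C(X, X))) ⟨rfl⟩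

/-- This is Arzelà-Ascoli. The inverses also keep points in bounded sets, and their limit provides
surjectivity of the limit isometry. -/
theorem exists_tendsto_of_ultrafilter {ι : Type*} (U : Ultrafilter ι) (F : ι → X ≃ᵢ X) (x y : X)
    (R : ℝ) (h : ∀ᶠ i in (U : Filter ι), dist (F i x) y ≤ R) : ∃ g, Tendsto F U (𝓝 g) := by
  have hlim : ∀ f : ι → X, ∀ R, (∀ᶠ i in (U : Filter ι), dist (f i) y ≤ R) →
      ∃ z, Tendsto f U (𝓝 z) := fun f R hf => by
    obtain ⟨z, -, hz⟩ := (isCompact_closedBall y R).ultrafilter_le_nhds (U.map f)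
      (by rw [le_principal_iff]; exact hf)
    exact ⟨z, hz⟩
  have h1 : ∀ w, ∃ z, Tendsto (fun i => F i w) U (𝓝 z) := fun w => by
    refine hlim _ (dist w x + R) ?_
    filter_upwards [h] with i hi
    have := dist_triangle (F i w) (F i x) y
    rw [(F i).isometry.dist_eq] at this
    linarith
  have h2 : ∀ w, ∃ z, Tendsto (fun i => (F i).symm w) U (𝓝 z) := fun w => by
    refine hlim _ (dist w y + R + dist x y) ?_
    filter_upwards [h] with i hi
    have h3 := dist_triangle ((F i).symm w) x y
    have h4 : dist ((F i).symm w) x = dist w (F i x) := by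
      rw [← (F i).isometry.dist_eq, (F i).apply_symm_apply]
    have h5 := dist_triangle w y (F i x)
    rw [dist_comm y] at h5
    linarith
  choose f hf using h1
  choose k hk using h2
  have hfi : Isometry f := Isometry.of_dist_eq fun a b =>
    tendsto_nhds_unique ((hf a).dist (hf b)) (by simp [(F _).isometry.dist_eq])
  have hfk : ∀ w, f (k w) = w := fun w => by
    rw [← dist_eq_zero]
    refine tendsto_nhds_unique ((hf (k w)).dist tendsto_const_nhds) ?_
    have := (hk w).dist (tendsto_const_nhds (x := k w))
    rw [dist_self] at this
    refine this.congr fun i => ?_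
    rw [dist_comm, ← (F i).isometry.dist_eq, (F i).apply_symm_apply]
  refine ⟨⟨⟨f, k, fun w => hfi.injective (hfk _), hfk⟩, hfi⟩, tendsto_isometryEquiv_iff.2 hf⟩

variable {G : Subgroup (X ≃ᵢ X)}

instance : SecondCountableTopology G :=
  IsInducing.secondCountableTopology (f := ((↑) : G → X ≃ᵢ X)) ⟨rfl⟩

instance : ContinuousMul G := inferInstanceAs (ContinuousMul G.toSubmonoid)

theorem continuous_subgroup_apply : Continuous fun q : G × X => (q.1 : X ≃ᵢ X) q.2 :=
  continuous_isometryEquiv_apply.comp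
    ((continuous_subtype_val.comp continuous_fst).prodMk continuous_snd)

@[fun_prop]
theorem continuous_subgroup_apply_const (x : X) : Continuous fun g : G => (g : X ≃ᵢ X) x :=
  continuous_subgroup_apply.comp (continuous_id.prodMk continuous_const)

theorem exists_tendsto_subgroup (hG : IsClosed (G : Set (X ≃ᵢ X))) {ι : Type*} (U : Ultrafilter ι)
    (F : ι → G) (x y : X) (R : ℝ)
    (h : ∀ᶠ i in (U : Filter ι), dist ((F i : X ≃ᵢ X) x) y ≤ R) : ∃ g, Tendsto F U (𝓝 g) := by
  obtain ⟨g, hg⟩ := exists_tendsto_of_ultrafilter U (fun i => (F i : X ≃ᵢ X)) x y R h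
  exact ⟨⟨g, hG.mem_of_tendsto hg (Eventually.of_forall fun i => (F i).2)⟩,
    tendsto_subtype_rng.2 hg⟩

theorem isCompact_setOf_dist_le (hG : IsClosed (G : Set (X ≃ᵢ X))) (x y : X) (R : ℝ) :
    IsCompact {g : G | dist ((g : X ≃ᵢ X) x) y ≤ R} := by
  rw [isCompact_iff_ultrafilter_le_nhds]
  intro U hU
  rw [le_principal_iff] at hU
  obtain ⟨g, hg⟩ := exists_tendsto_subgroup hG U id x y R hU
  have hc : IsClosed {g : G | dist ((g : X ≃ᵢ X) x) y ≤ R} :=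
    isClosed_le (by fun_prop) continuous_const
  exact ⟨g, hc.mem_of_tendsto hg hU, hg⟩

theorem weaklyLocallyCompactSpace_subgroup (hG : IsClosed (G : Set (X ≃ᵢ X))) (x : X) :
    WeaklyLocallyCompactSpace G where
  exists_compact_mem_nhds g := by
    refine ⟨_, isCompact_setOf_dist_le hG x ((g : X ≃ᵢ X) x) 1, ?_⟩
    have hc : IsOpen {h : G | dist ((h : X ≃ᵢ X) x) ((g : X ≃ᵢ X) x) < 1} :=
      isOpen_lt (by fun_prop) continuous_const
    exact mem_of_superset (hc.mem_nhds (by simp)) fun h hh => by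
      rw [mem_ofPred_eq] at hh ⊢
      exact hh.le

/-- The measure of the group elements which move `x` into a ball of radius `R` is bounded
independently of the ball. -/
theorem measure_setOf_dist_le_le [MeasurableSpace G] [BorelSpace G] (μ : Measure G)
    [μ.IsMulLeftInvariant] (x y : X) (R : ℝ) :
    μ {g : G | dist ((g : X ≃ᵢ X) x) y ≤ R} ≤ μ {g : G | dist ((g : X ≃ᵢ X) x) x ≤ 2 * R} := by
  rcases eq_empty_or_nonempty {g : G | dist ((g : X ≃ᵢ X) x) y ≤ R} with h | ⟨g₀, h₀⟩
  · rw [h]; simp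
  rw [← measure_preimage_mul μ g₀⁻¹ {g : G | dist ((g : X ≃ᵢ X) x) x ≤ 2 * R}]
  refine measure_mono fun g hg => ?_
  change dist (((g₀⁻¹ * g : G) : X ≃ᵢ X) x) x ≤ 2 * R
  rw [mem_ofPred_eq] at hg
  have h₀' : dist ((g₀ : X ≃ᵢ X) x) y ≤ R := h₀
  rw [← (g₀ : X ≃ᵢ X).isometry.dist_eq]
  have : (g₀ : X ≃ᵢ X) (((g₀⁻¹ * g : G) : X ≃ᵢ X) x) = (g : X ≃ᵢ X) x := by
    change ((g₀ * (g₀⁻¹ * g) : G) : X ≃ᵢ X) x = _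
    rw [mul_inv_cancel_left]
  rw [this]
  have := dist_triangle_right ((g : X ≃ᵢ X) x) ((g₀ : X ≃ᵢ X) x) y
  linarith

end IsometryGroup
/-! ### The cocycle on points -/

section PairFun

variable {X : Type*} [MetricSpace X]

/-- A bump function around `u`. -/
def bump (u y : X) : ℝ := max 0 (1 - dist y u)

theorem bump_nonneg (u y : X) : 0 ≤ bump u y := le_max_left _ _

theorem bump_le_one (u y : X) : bump u y ≤ 1 :=
  max_le zero_le_one (by linarith [dist_nonneg (x := y) (y := u)])

theorem bump_self (u : X) : bump u u = 1 := by simp [bump]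

theorem bump_eq_zero {u y : X} (h : 1 ≤ dist y u) : bump u y = 0 :=
  max_eq_left (by linarith)

theorem dist_lt_of_bump_ne_zero {u y : X} (h : bump u y ≠ 0) : dist y u < 1 := by
  by_contra! h'
  exact h (bump_eq_zero h')

theorem abs_bump_sub_le (u y z : X) : |bump u y - bump u z| ≤ dist y z := by
  refine (abs_max_sub_max_le_max 0 (1 - dist y u) 0 (1 - dist z u)).trans (max_le (by simp) ?_)
  have : 1 - dist y u - (1 - dist z u) = -(dist y u - dist z u) := by ring
  rw [this, abs_neg]
  exact abs_dist_sub_le y z u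

theorem Isometry.bump_eq {f : X → X} (hf : Isometry f) (u y : X) :
    bump (f u) (f y) = bump u y := by
  rw [bump, bump, hf.dist_eq]

theorem continuous_bump : Continuous fun q : X × X => bump q.1 q.2 := by
  unfold bump; fun_prop

/-- An antisymmetric function of `(y, z)`, concentrated near `(u, v)` and `(v, u)`. -/
def pairFun (u v y z : X) : ℝ := bump u y * bump v z - bump u z * bump v y

theorem pairFun_swap (u v y z : X) : pairFun u v z y = -pairFun u v y z := by
  unfold pairFun; ring

theorem abs_pairFun_le_one (u v y z : X) : |pairFun u v y z| ≤ 1 := by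
  have h1 := mul_le_one₀ (bump_le_one u y) (bump_nonneg v z) (bump_le_one v z)
  have h2 := mul_le_one₀ (bump_le_one u z) (bump_nonneg v y) (bump_le_one v y)
  have h3 := mul_nonneg (bump_nonneg u y) (bump_nonneg v z)
  have h4 := mul_nonneg (bump_nonneg u z) (bump_nonneg v y)
  unfold pairFun
  exact abs_le.2 ⟨by linarith, by linarith⟩

theorem abs_pairFun_sub_le (u v w y z : X) :
    |pairFun u v w y - pairFun u v w z| ≤ 2 * dist y z := by
  have e : pairFun u v w y - pairFun u v w z =
      bump u w * (bump v y - bump v z) - bump v w * (bump u y - bump u z) := by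
    unfold pairFun; ring
  rw [e]
  refine (abs_sub _ _).trans ?_
  rw [abs_mul, abs_mul, abs_of_nonneg (bump_nonneg u w), abs_of_nonneg (bump_nonneg v w)]
  have h1 : bump u w * |bump v y - bump v z| ≤ 1 * dist y z :=
    mul_le_mul (bump_le_one _ _) (abs_bump_sub_le _ _ _) (abs_nonneg _) zero_le_one
  have h2 : bump v w * |bump u y - bump u z| ≤ 1 * dist y z :=
    mul_le_mul (bump_le_one _ _) (abs_bump_sub_le _ _ _) (abs_nonneg _) zero_le_one
  linarith

theorem abs_pairFun_le (u v y z : X) : |pairFun u v y z| ≤ 2 * dist y z := by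
  have h := abs_pairFun_sub_le u v y z y
  have : pairFun u v y y = 0 := by unfold pairFun; ring
  rwa [this, sub_zero, dist_comm] at h

/-- When two of the three points merge, antisymmetry makes the cyclic sum vanish. This cancellation
is the source of the decay of the coboundary. -/
theorem abs_pairFun_sum_le (u v y z w : X) :
    |pairFun u v y z + pairFun u v z w + pairFun u v w y| ≤ 4 * dist y z := by
  have e : pairFun u v y z + pairFun u v z w + pairFun u v w y =
      pairFun u v y z + (pairFun u v w y - pairFun u v w z) := by
    rw [pairFun_swap u v w z]; ring
  rw [e]
  refine (abs_add_le _ _).trans ?_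
  linarith [abs_pairFun_le u v y z, abs_pairFun_sub_le u v w y z]

theorem near_of_pairFun_ne_zero {u v y z : X} (h : pairFun u v y z ≠ 0) :
    (dist y u < 1 ∧ dist z v < 1) ∨ (dist z u < 1 ∧ dist y v < 1) := by
  by_contra! hn
  refine h ?_
  have h1 : bump u y * bump v z = 0 := by
    by_contra h'
    exact (bump_eq_zero (hn.1 (dist_lt_of_bump_ne_zero (left_ne_zero_of_mul h')))) ▸
      (right_ne_zero_of_mul h') <| rfl
  have h2 : bump u z * bump v y = 0 := by
    by_contra h'
    exact (bump_eq_zero (hn.2 (dist_lt_of_bump_ne_zero (left_ne_zero_of_mul h')))) ▸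
      (right_ne_zero_of_mul h') <| rfl
  rw [pairFun, h1, h2, sub_zero]

theorem one_le_dist_of_pairFun_ne_zero {u v y z : X} (huv : 3 ≤ dist u v)
    (h : pairFun u v y z ≠ 0) : 1 ≤ dist y z := by
  rcases near_of_pairFun_ne_zero h with ⟨h1, h2⟩ | ⟨h1, h2⟩
  · have := dist_triangle4 u y z v
    rw [dist_comm u y] at this
    linarith
  · have := dist_triangle4 u z y v
    rw [dist_comm u z, dist_comm z y] at this
    linarith

theorem Isometry.pairFun_eq {f : X → X} (hf : Isometry f) (u v y z : X) :
    pairFun (f u) (f v) (f y) (f z) = pairFun u v y z := by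
  simp only [pairFun, Isometry.bump_eq hf]

theorem pairFun_self {u v : X} (h : 1 ≤ dist u v) : pairFun u v u v = 1 := by
  rw [pairFun, bump_self, bump_self, bump_eq_zero (by rwa [dist_comm])]; ring

theorem pairFun_eq_zero_right {u v w : X} (y : X) (hu : 1 ≤ dist w u) (hv : 1 ≤ dist w v) :
    pairFun u v y w = 0 := by
  rw [pairFun, bump_eq_zero hu, bump_eq_zero hv]; ring

theorem pairFun_eq_zero_left {u v w : X} (y : X) (hu : 1 ≤ dist w u) (hv : 1 ≤ dist w v) :
    pairFun u v w y = 0 := by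
  rw [pairFun, bump_eq_zero hu, bump_eq_zero hv]; ring

end PairFun

/-! ### The cochain -/

section Cochain

variable {X : Type*} [MetricSpace X]

variable (G : Subgroup (X ≃ᵢ X)) (x₀ : X) (r : ℝ≥0) (u v : X)

/-- The value of the cochain at a pair of boundary points, seen from `g x₀`. -/
noncomputable def pairKernel (c : Boundary X × Boundary X) (g : G) : ℝ :=
  pairFun ((g : X ≃ᵢ X) u) ((g : X ≃ᵢ X) v) (rayPoint ((g : X ≃ᵢ X) x₀) r c.1)
    (rayPoint ((g : X ≃ᵢ X) x₀) r c.2)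

/-- The coboundary of `pairKernel`. -/
noncomputable def tripleKernel (t : Fin 3 → Boundary X) (g : G) : ℝ :=
  pairKernel G x₀ r u v (t 0, t 1) g + pairKernel G x₀ r u v (t 1, t 2) g +
    pairKernel G x₀ r u v (t 2, t 0) g

variable {G x₀ r u v}

theorem pairKernel_swap (c : Boundary X × Boundary X) (g : G) :
    pairKernel G x₀ r u v c.swap g = -pairKernel G x₀ r u v c g :=
  pairFun_swap _ _ _ _

theorem abs_pairKernel_le_one (c : Boundary X × Boundary X) (g : G) :
    |pairKernel G x₀ r u v c g| ≤ 1 := abs_pairFun_le_one _ _ _ _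

theorem abs_tripleKernel_le (t : Fin 3 → Boundary X) (g : G) (i : Fin 3) :
    |tripleKernel G x₀ r u v t g| ≤ 4 * dist (rayPoint ((g : X ≃ᵢ X) x₀) r (t i))
      (rayPoint ((g : X ≃ᵢ X) x₀) r (t (i + 1))) := by
  have h := abs_pairFun_sum_le ((g : X ≃ᵢ X) u) ((g : X ≃ᵢ X) v)
    (rayPoint ((g : X ≃ᵢ X) x₀) r (t i)) (rayPoint ((g : X ≃ᵢ X) x₀) r (t (i + 1)))
    (rayPoint ((g : X ≃ᵢ X) x₀) r (t (i + 2)))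
  refine le_trans (le_of_eq ?_) h
  unfold tripleKernel pairKernel
  congr 1
  fin_cases i
  · rfl
  · change _ = pairFun _ _ _ (rayPoint _ r (t 2)) + pairFun _ _ _ (rayPoint _ r (t 0)) +
      pairFun _ _ (rayPoint _ r (t 0)) (rayPoint _ r (t 1))
    rw [add_rotate]
    rfl
  · rw [add_rotate, add_rotate]
    rfl

theorem abs_tripleKernel_le_three (t : Fin 3 → Boundary X) (g : G) :
    |tripleKernel G x₀ r u v t g| ≤ 3 := by
  refine (abs_add_three _ _ _).trans ?_
  linarith [abs_pairKernel_le_one (x₀ := x₀) (r := r) (u := u) (v := v) (t 0, t 1) g,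
    abs_pairKernel_le_one (x₀ := x₀) (r := r) (u := u) (v := v) (t 1, t 2) g,
    abs_pairKernel_le_one (x₀ := x₀) (r := r) (u := u) (v := v) (t 2, t 0) g]

theorem exists_pairKernel_ne_zero {t : Fin 3 → Boundary X} {g : G}
    (h : tripleKernel G x₀ r u v t g ≠ 0) : ∃ i, pairKernel G x₀ r u v (t i, t (i + 1)) g ≠ 0 := by
  by_contra! hn
  exact h (by
    have h0 := hn 0
    have h1 := hn 1
    have h2 := hn 2
    unfold tripleKernel
    simp only [zero_add] at h0
    rw [h0, show pairKernel G x₀ r u v (t 1, t 2) g = 0 from h1,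
      show pairKernel G x₀ r u v (t 2, t 0) g = 0 from h2]
    simp)

theorem tripleKernel_comp (σ : Equiv.Perm (Fin 3)) (t : Fin 3 → Boundary X) (g : G) :
    tripleKernel G x₀ r u v (t ∘ σ) g =
      (Equiv.Perm.sign σ : ℤ) * tripleKernel G x₀ r u v t g := by
  have hσ : ∀ σ : Equiv.Perm (Fin 3), ((σ 0, σ 1, σ 2) = (0, 1, 2) ∧ Equiv.Perm.sign σ = 1) ∨
      ((σ 0, σ 1, σ 2) = (1, 2, 0) ∧ Equiv.Perm.sign σ = 1) ∨
      ((σ 0, σ 1, σ 2) = (2, 0, 1) ∧ Equiv.Perm.sign σ = 1) ∨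
      ((σ 0, σ 1, σ 2) = (1, 0, 2) ∧ Equiv.Perm.sign σ = -1) ∨
      ((σ 0, σ 1, σ 2) = (0, 2, 1) ∧ Equiv.Perm.sign σ = -1) ∨
      ((σ 0, σ 1, σ 2) = (2, 1, 0) ∧ Equiv.Perm.sign σ = -1) := by decide
  have hs : ∀ a b : Boundary X,
      pairKernel G x₀ r u v (a, b) g = -pairKernel G x₀ r u v (b, a) g :=
    fun a b => pairKernel_swap (b, a) g
  unfold tripleKernel
  simp only [Function.comp]
  rcases hσ σ with ⟨h, h'⟩ | ⟨h, h'⟩ | ⟨h, h'⟩ | ⟨h, h'⟩ | ⟨h, h'⟩ | ⟨h, h'⟩ <;>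
    simp only [Prod.mk.injEq] at h <;> rw [h', h.1, h.2.1, h.2.2] <;> push_cast
  · ring
  · ring
  · ring
  · rw [hs (t 1), hs (t 0) (t 2), hs (t 2) (t 1)]; ring
  · rw [hs (t 0) (t 2), hs (t 2) (t 1), hs (t 1) (t 0)]; ring
  · rw [hs (t 0) (t 2), hs (t 2) (t 1), hs (t 1) (t 0)]; ring

variable [ProperSpace X]

theorem IsCAT0.continuous_rayPoint_prod (hX : IsCAT0 X) (r : ℝ≥0) :
    Continuous fun q : X × Boundary X => rayPoint q.1 r q.2 :=
  continuous_prod_of_continuous_lipschitzWith _ 1 (fun x => hX.continuous_rayPoint x r)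
    fun ξ => LipschitzWith.of_dist_le_mul fun x y => by
      simpa using hX.dist_rayPoint_le x y r ξ

theorem IsCAT0.continuous_rayPoint_subgroup (hX : IsCAT0 X) {Y : Type*} [TopologicalSpace Y]
    {f : Y → G} {k : Y → Boundary X} (hf : Continuous f) (hk : Continuous k) :
    Continuous fun y => rayPoint ((f y : X ≃ᵢ X) x₀) r (k y) :=
  (hX.continuous_rayPoint_prod r).comp
    (((continuous_subgroup_apply_const x₀).comp hf).prodMk hk)

theorem IsCAT0.continuous_pairKernel (hX : IsCAT0 X) :
    Continuous fun q : (Boundary X × Boundary X) × G => pairKernel G x₀ r u v q.1 q.2 := by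
  have h1 : Continuous fun q : (Boundary X × Boundary X) × G =>
      rayPoint ((q.2 : X ≃ᵢ X) x₀) r q.1.1 :=
    hX.continuous_rayPoint_subgroup continuous_snd (by fun_prop)
  have h2 : Continuous fun q : (Boundary X × Boundary X) × G =>
      rayPoint ((q.2 : X ≃ᵢ X) x₀) r q.1.2 :=
    hX.continuous_rayPoint_subgroup continuous_snd (by fun_prop)
  have hu : ∀ u : X, Continuous fun q : (Boundary X × Boundary X) × G => (q.2 : X ≃ᵢ X) u :=
    fun u => (continuous_subgroup_apply_const u).comp continuous_snd
  exact ((continuous_bump.comp ((hu u).prodMk h1)).mul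
    (continuous_bump.comp ((hu v).prodMk h2))).sub
    ((continuous_bump.comp ((hu u).prodMk h2)).mul (continuous_bump.comp ((hu v).prodMk h1)))

theorem IsCAT0.continuous_tripleKernel (hX : IsCAT0 X) :
    Continuous fun q : (Fin 3 → Boundary X) × G => tripleKernel G x₀ r u v q.1 q.2 := by
  have h : ∀ i j : Fin 3, Continuous fun q : (Fin 3 → Boundary X) × G =>
      pairKernel G x₀ r u v (q.1 i, q.1 j) q.2 := fun i j =>
    hX.continuous_pairKernel.comp (f := fun q : (Fin 3 → Boundary X) × G =>
      ((q.1 i, q.1 j), q.2)) (by fun_prop)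
  exact ((h 0 1).add (h 1 2)).add (h 2 0)

theorem IsCAT0.pairKernel_smul (hX : IsCAT0 X) (c : Boundary X × Boundary X) (g h : G) :
    pairKernel G x₀ r u v (g • c) (g * h) = pairKernel G x₀ r u v c h := by
  have e : ∀ y : X, ((g * h : G) : X ≃ᵢ X) y = (g : X ≃ᵢ X) ((h : X ≃ᵢ X) y) := fun _ => rfl
  have e1 : (g • c).1 = (g : X ≃ᵢ X) • c.1 := rfl
  have e2 : (g • c).2 = (g : X ≃ᵢ X) • c.2 := rfl
  simp only [pairKernel, e, e1, e2, hX.smul_rayPoint]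
  exact Isometry.pairFun_eq (g : X ≃ᵢ X).isometry _ _ _ _

variable (G x₀ r u v)

/-- The cochain, as a function on `G × G`. -/
noncomputable def cochain (hX : IsCAT0 X) (c : Boundary X × Boundary X) : C(G × G, ℝ) where
  toFun z := bump ((z.1 : X ≃ᵢ X) x₀) ((z.2 : X ≃ᵢ X) x₀) * pairKernel G x₀ r u v c z.1
  continuous_toFun := by
    refine (continuous_bump.comp (((continuous_subgroup_apply_const x₀).comp
      continuous_fst).prodMk ((continuous_subgroup_apply_const x₀).comp continuous_snd))).mul ?_
    exact hX.continuous_pairKernel.comp (continuous_const.prodMk continuous_fst)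

variable {G x₀ r u v}

theorem cochain_apply (hX : IsCAT0 X) (c : Boundary X × Boundary X) (z : G × G) :
    cochain G x₀ r u v hX c z =
      bump ((z.1 : X ≃ᵢ X) x₀) ((z.2 : X ≃ᵢ X) x₀) * pairKernel G x₀ r u v c z.1 := rfl

theorem continuous_cochain (hX : IsCAT0 X) : Continuous (cochain G x₀ r u v hX) := by
  refine ContinuousMap.continuous_of_continuous_uncurry _ ?_
  refine (continuous_bump.comp (((continuous_subgroup_apply_const x₀).comp
    (continuous_fst.comp continuous_snd)).prodMk ((continuous_subgroup_apply_const x₀).comp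
    (continuous_snd.comp continuous_snd)))).mul ?_
  exact hX.continuous_pairKernel.comp (continuous_fst.prodMk (continuous_fst.comp continuous_snd))

theorem abs_cochain_le_one (hX : IsCAT0 X) (c : Boundary X × Boundary X) (z : G × G) :
    |cochain G x₀ r u v hX c z| ≤ 1 := by
  rw [cochain_apply, abs_mul, abs_of_nonneg (bump_nonneg _ _)]
  exact mul_le_one₀ (bump_le_one _ _) (abs_nonneg _) (abs_pairKernel_le_one _ _)

theorem cochain_smul (hX : IsCAT0 X) (c : Boundary X × Boundary X) (g : G) (z : G × G) :
    cochain G x₀ r u v hX (g • c) (g * z.1, g * z.2) = cochain G x₀ r u v hX c z := by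
  have e : ∀ h : G, ((g * h : G) : X ≃ᵢ X) x₀ = (g : X ≃ᵢ X) ((h : X ≃ᵢ X) x₀) := fun _ => rfl
  simp only [cochain_apply, hX.pairKernel_smul, e, Isometry.bump_eq (g : X ≃ᵢ X).isometry]

theorem cochain_swap (hX : IsCAT0 X) (c : Boundary X × Boundary X) :
    cochain G x₀ r u v hX c.swap = -cochain G x₀ r u v hX c := by
  ext z
  rw [ContinuousMap.neg_apply, cochain_apply, cochain_apply, pairKernel_swap, mul_neg]

end Cochain
/-! ### Integrability of the coboundary -/

section Integrability

variable {X : Type*} [MetricSpace X]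

/-- The lines `γ i` are the sides of an ideal triangle with `B`-contracting sides. -/
def IsContractingTriangle (B : ℝ) (t : Fin 3 → Boundary X) (γ : Fin 3 → ℝ → X) : Prop :=
  ∀ i, Joins (γ i) (t i) (t (i + 1)) ∧ IsContracting B (range (γ i))

/-- The triples of boundary points any two of which are joined by a contracting line. -/
def joinedTriples (X : Type*) [MetricSpace X] (B : ℝ) : Set (Fin 3 → Boundary X) :=
  {t | ∀ i, (t i, t (i + 1)) ∈ contractingPairs X B}

theorem joinedTriples_pair {B : ℝ} {t : Fin 3 → Boundary X} (h : t ∈ joinedTriples X B)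
    {i j : Fin 3} (hij : i ≠ j) : (t i, t j) ∈ contractingPairs X B := by
  have : j = i + 1 ∨ i = j + 1 := by revert i j; decide
  rcases this with rfl | rfl
  · exact h i
  · exact swap_mem_contractingPairs (h j)

theorem exists_isContractingTriangle {B : ℝ} {t : Fin 3 → Boundary X}
    (h : t ∈ joinedTriples X B) : ∃ γ, IsContractingTriangle B t γ := by
  choose γ hγ using fun i => (mem_contractingPairs.1 (h i)).2
  exact ⟨γ, hγ⟩

variable [ProperSpace X]

theorem IsContractingTriangle.dist_le (hX : IsCAT0 X) {B : ℝ} {t : Fin 3 → Boundary X}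
    {γ : Fin 3 → ℝ → X} (h : IsContractingTriangle B t γ) {m : ℝ} {x y : X}
    (hx : ∀ i, Metric.infDist x (range (γ i)) ≤ m) (hy : ∀ i, Metric.infDist y (range (γ i)) ≤ m) :
    dist x y ≤ 10 * m :=
  hX.dist_le_of_infDist_le (h 0).1 (h 1).1 (h 2).1 (hx 0) (hx 1) (hx 2) (hy 0) (hy 1) (hy 2)

/-- Separation of the rays from `x` at a fixed time is an open condition on the triple, and it
bounds the distance from `x` to every contracting side. -/
theorem IsCAT0.eventually_infDist_le (hX : IsCAT0 X) {B : ℝ} (hB : 0 < B) (x : X)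
    {t₀ : Fin 3 → Boundary X} (h : ∀ i, t₀ i ≠ t₀ (i + 1)) :
    ∃ m : ℝ, ∀ᶠ t in 𝓝 t₀, ∀ γ, IsContractingTriangle B t γ →
      ∀ i, Metric.infDist x (range (γ i)) ≤ m := by
  obtain ⟨s, hs⟩ : ∃ s, ∀ i, 1 < dist (rayPoint x s (t₀ i)) (rayPoint x s (t₀ (i + 1))) :=
    (eventually_all.2 fun i => (hX.tendsto_dist_rayPoint x (h i)).eventually_gt_atTop 1).exists
  refine ⟨s * max (16 * B) (2 * s), ?_⟩
  have hc : ∀ i, Continuous fun t : Fin 3 → Boundary X => rayPoint x s (t i) := fun i =>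
    (hX.continuous_rayPoint x s).comp (continuous_apply i)
  have : ∀ᶠ t in 𝓝 t₀, ∀ i, 1 < dist (rayPoint x s (t i)) (rayPoint x s (t (i + 1))) :=
    eventually_all.2 fun i =>
      (((hc i).dist (hc (i + 1))).tendsto t₀).eventually (lt_mem_nhds (hs i))
  filter_upwards [this] with t ht γ hγ i
  refine le_trans ?_ ((hγ i).1.infDist_mul_dist_le hX hB (hγ i).2 x s)
  exact le_mul_of_one_le_right Metric.infDist_nonneg (ht i).le

variable {G : Subgroup (X ≃ᵢ X)} {x₀ : X} {r : ℝ≥0} {u v : X}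

theorem infDist_le_of_pairKernel_ne_zero (hX : IsCAT0 X) {B : ℝ} (hB : 0 < B)
    (huv : 3 ≤ dist u v) {γ : ℝ → X} {c : Boundary X × Boundary X} (h : Joins γ c.1 c.2)
    (hγ : IsContracting B (range γ)) {g : G} (hg : pairKernel G x₀ r u v c g ≠ 0) :
    Metric.infDist ((g : X ≃ᵢ X) x₀) (range γ) ≤ r * max (16 * B) (2 * r) := by
  refine le_trans ?_ (h.infDist_mul_dist_le hX hB hγ ((g : X ≃ᵢ X) x₀) r)
  refine le_mul_of_one_le_right Metric.infDist_nonneg (one_le_dist_of_pairFun_ne_zero ?_ hg)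
  rwa [(g : X ≃ᵢ X).isometry.dist_eq]

/-- The group elements which move `x₀` into the `m`-neighborhood of all and the `R`-neighborhood
of one of the sides. -/
def nearSides (G : Subgroup (X ≃ᵢ X)) (x₀ : X) (γ : Fin 3 → ℝ → X) (R m : ℝ) : Set G :=
  {g | (∀ i, Metric.infDist ((g : X ≃ᵢ X) x₀) (range (γ i)) ≤ m) ∧
    ∃ i, Metric.infDist ((g : X ≃ᵢ X) x₀) (range (γ i)) ≤ R}

theorem continuous_infDist_apply (S : Set X) :
    Continuous fun g : G => Metric.infDist ((g : X ≃ᵢ X) x₀) S :=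
  (Metric.continuous_infDist_pt S).comp (continuous_subgroup_apply_const x₀)

theorem isClosed_nearSides (γ : Fin 3 → ℝ → X) (R m : ℝ) : IsClosed (nearSides G x₀ γ R m) := by
  have : nearSides G x₀ γ R m =
      (⋂ i, {g : G | Metric.infDist ((g : X ≃ᵢ X) x₀) (range (γ i)) ≤ m}) ∩
        ⋃ i, {g : G | Metric.infDist ((g : X ≃ᵢ X) x₀) (range (γ i)) ≤ R} := by
    ext; simp [nearSides]
  rw [this]
  have hc : ∀ (a : ℝ) i, IsClosed {g : G | Metric.infDist ((g : X ≃ᵢ X) x₀) (range (γ i)) ≤ a} :=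
    fun a i => isClosed_le (continuous_infDist_apply _) continuous_const
  exact (isClosed_iInter (hc m)).inter (isClosed_iUnion_of_finite (hc R))

variable [MeasurableSpace G] [BorelSpace G] (μ : Measure G) [μ.IsMulLeftInvariant]

/-- The set lies within `R` of segments of bounded length on the three sides: any two of its orbit
points are at most `10 * m` apart, so projections to one side differ by at most `R + 11 * m`. Balls
of radius `R + 1` at integer spacing cover these segments. What matters is linear growth in `m`. -/
theorem measure_nearSides_le (hX : IsCAT0 X) {B : ℝ} {t : Fin 3 → Boundary X}
    {γ : Fin 3 → ℝ → X} (h : IsContractingTriangle B t γ) (R m : ℕ) :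
    μ (nearSides G x₀ γ R m) ≤ (3 * (2 * (R + 11 * m + 1) + 1) : ℕ) *
      μ {g : G | dist ((g : X ≃ᵢ X) x₀) x₀ ≤ 2 * (R + 1)} := by
  rcases (nearSides G x₀ γ R m).eq_empty_or_nonempty with h0 | ⟨g₀, h₀, -⟩
  · rw [h0]; simp
  choose s hs using fun i => (h i).1.exists_dist_eq ((g₀ : X ≃ᵢ X) x₀)
  set N : ℤ := R + 11 * m + 1
  have hsub : nearSides G x₀ γ R m ⊆ ⋃ q ∈ (Finset.univ : Finset (Fin 3)) ×ˢ Finset.Icc (-N) N,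
      {g : G | dist ((g : X ≃ᵢ X) x₀) (γ q.1 (s q.1 + q.2)) ≤ R + 1} := by
    rintro g ⟨hg, i, hi⟩
    obtain ⟨a, ha⟩ := (h i).1.exists_dist_eq ((g : X ≃ᵢ X) x₀)
    have h1 := h.dist_le hX hg h₀
    have h2 := dist_triangle4 (γ i a) ((g : X ≃ᵢ X) x₀) ((g₀ : X ≃ᵢ X) x₀) (γ i (s i))
    rw [(h i).1.isometry.dist_eq, Real.dist_eq, dist_comm (γ i a), ha, hs] at h2
    have h3 := h₀ i
    have h4 := abs_le.1 h2
    have f1 := Int.floor_le (a - s i)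
    have f2 := Int.lt_floor_add_one (a - s i)
    simp only [mem_iUnion]
    refine ⟨(i, ⌊a - s i⌋), ?_, ?_⟩
    · simp only [Finset.mem_product, Finset.mem_univ, true_and, Finset.mem_Icc]
      have hN : (N : ℝ) = R + 11 * m + 1 := by simp [N]
      constructor
      · have : ((-N : ℤ) : ℝ) < ⌊a - s i⌋ + 1 := by push_cast; rw [hN]; linarith
        have h5 : (-N : ℤ) < ⌊a - s i⌋ + 1 := by exact_mod_cast this
        omega
      · have : ((⌊a - s i⌋ : ℤ) : ℝ) ≤ N := by rw [hN]; linarith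
        exact_mod_cast this
    · change dist ((g : X ≃ᵢ X) x₀) (γ i (s i + ⌊a - s i⌋)) ≤ R + 1
      have h5 := dist_triangle ((g : X ≃ᵢ X) x₀) (γ i a) (γ i (s i + ⌊a - s i⌋))
      rw [(h i).1.isometry.dist_eq, Real.dist_eq, ha, abs_of_nonneg (by linarith)] at h5
      linarith
  refine (measure_mono hsub).trans ((measure_biUnion_finset_le _ _).trans ?_)
  refine (Finset.sum_le_sum fun q _ => measure_setOf_dist_le_le μ x₀ _ _).trans_eq ?_
  rw [Finset.sum_const, nsmul_eq_mul]
  congr 2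
  rw [Finset.card_product, Int.card_Icc]
  simp only [Finset.card_univ, Fintype.card_fin, N]
  omega

/-- Uniform control of the tails of the `p`-th power of `tripleKernel`. -/
theorem exists_tail_bound [IsFiniteMeasureOnCompacts μ] (hX : IsCAT0 X)
    (hG : IsClosed (G : Set (X ≃ᵢ X))) {B : ℝ} (hB : 0 < B) (huv : 3 ≤ dist u v) {p : ℝ}
    (hp : 1 < p) :
    ∃ τ : ℕ → ℝ≥0∞, τ 0 ≠ ∞ ∧ Tendsto τ atTop (𝓝 0) ∧
      ∀ t γ, IsContractingTriangle B t γ → ∀ (K : ℕ) (A : Set G), MeasurableSet A →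
        (∀ g ∈ A, ∃ i, 2 ^ K ≤ 1 + Metric.infDist ((g : X ≃ᵢ X) x₀) (range (γ i))) →
        ∫⁻ g in A, ‖tripleKernel G x₀ r u v t g‖ₑ ^ p ∂μ ≤ τ K := by
  set R' : ℝ := r * max (16 * B) (2 * r) with hR'
  have hR'0 : 0 ≤ R' := by positivity
  obtain ⟨R, hR⟩ := exists_nat_ge R'
  set M := μ {g : G | dist ((g : X ≃ᵢ X) x₀) x₀ ≤ 2 * (R + 1)} with hM
  have hMtop : M ≠ ∞ := (isCompact_setOf_dist_le hG x₀ x₀ _).measure_ne_top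
  set C : ℝ := 3 + 4 * R' with hC
  -- Passing to the next dyadic shell multiplies the `p`-th power of the value by `2⁻¹ ^ p` and the
  -- measure by 2 in the bounds; the ratio is less than 1 precisely because `p > 1`.
  set q : ℝ≥0∞ := 2⁻¹ ^ p * 2 with hq
  have hq1 : q < 1 := by
    have h1 : (2⁻¹ : ℝ≥0∞) ^ p < 2⁻¹ ^ (1 : ℝ) :=
      ENNReal.rpow_lt_rpow_of_exponent_gt (by simp) (by simp) hp
    rw [ENNReal.rpow_one] at h1
    calc q < 2⁻¹ * 2 := ENNReal.mul_lt_mul_left (by simp) (by simp) h1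
      _ = 1 := ENNReal.inv_mul_cancel (by simp) (by simp)
  set D : ℝ≥0∞ := ENNReal.ofReal C ^ p * ((3 * (2 * R + 3 + 44) : ℕ) * M) with hD
  have hDtop : D ≠ ∞ :=
    ENNReal.mul_ne_top (ENNReal.rpow_ne_top_of_nonneg (by linarith) ENNReal.ofReal_ne_top)
      (ENNReal.mul_ne_top (ENNReal.natCast_ne_top _) hMtop)
  have hsum : ∑' k, D * q ^ k ≠ ∞ := by
    rw [ENNReal.tsum_mul_left, ENNReal.tsum_geometric]
    exact ENNReal.mul_ne_top hDtop (ENNReal.inv_ne_top.2 (tsub_pos_of_lt hq1).ne')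
  refine ⟨fun K => ∑' k, D * q ^ (k + K), by simpa using hsum,
    ENNReal.tendsto_sum_nat_add _ hsum, ?_⟩
  intro t γ h K A hA hAK
  set E : ℕ → Set G := fun n => nearSides G x₀ γ R ((2 ^ (n + 1) : ℕ) : ℝ) with hE
  have hEm : ∀ n, MeasurableSet (E n) := fun n => (isClosed_nearSides γ _ _).measurableSet
  have hbound : ∀ g i, |tripleKernel G x₀ r u v t g| *
      (1 + Metric.infDist ((g : X ≃ᵢ X) x₀) (range (γ i))) ≤ C := fun g i => by
    have h1 := abs_tripleKernel_le_three (x₀ := x₀) (r := r) (u := u) (v := v) t g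
    have h2 := abs_tripleKernel_le (x₀ := x₀) (r := r) (u := u) (v := v) t g i
    have h3 := (h i).1.infDist_mul_dist_le hX hB (h i).2 ((g : X ≃ᵢ X) x₀) r
    have h4 := mul_le_mul_of_nonneg_right h2
      (Metric.infDist_nonneg (x := (g : X ≃ᵢ X) x₀) (s := range (γ i)))
    rw [← hR'] at h3
    linarith
  have hpt : ∀ g ∈ A, ‖tripleKernel G x₀ r u v t g‖ₑ ^ p ≤
      ∑' k, (E (k + K)).indicator (fun _ => (ENNReal.ofReal C * 2⁻¹ ^ (k + K)) ^ p) g := by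
    intro g hg
    by_cases hS : tripleKernel G x₀ r u v t g = 0
    · rw [hS, enorm_zero, ENNReal.zero_rpow_of_pos (by linarith)]
      exact zero_le
    obtain ⟨j, hj⟩ := Finite.exists_max fun i => Metric.infDist ((g : X ≃ᵢ X) x₀) (range (γ i))
    set d := Metric.infDist ((g : X ≃ᵢ X) x₀) (range (γ j)) with hd
    have hd0 : 0 ≤ d := Metric.infDist_nonneg
    -- The dyadic shell of `g` is determined by its distance to the farthest side.
    obtain ⟨n, hn1, hn2⟩ := exists_nat_pow_near (x := 1 + d) (y := 2) (by linarith) (by norm_num)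
    have hKn : K ≤ n := by
      obtain ⟨i, hi⟩ := hAK g hg
      have h1 : (2 : ℝ) ^ K < 2 ^ (n + 1) := by linarith [hj i]
      have := (pow_lt_pow_iff_right₀ (by norm_num : (1 : ℝ) < 2)).1 h1
      omega
    obtain ⟨k, rfl⟩ : ∃ k, n = k + K := ⟨n - K, by omega⟩
    have hgE : g ∈ E (k + K) := by
      refine ⟨fun i => (hj i).trans ?_, ?_⟩
      · push_cast
        linarith
      · obtain ⟨i, hi⟩ := exists_pairKernel_ne_zero hS
        exact ⟨i, (infDist_le_of_pairKernel_ne_zero hX hB huv (h i).1 (h i).2 hi).trans hR⟩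
    refine le_trans ?_ (ENNReal.le_tsum k)
    rw [indicator_of_mem hgE]
    refine ENNReal.rpow_le_rpow ?_ (by linarith)
    have h2 : |tripleKernel G x₀ r u v t g| ≤ C * (2⁻¹) ^ (k + K) := by
      rw [inv_pow, ← div_eq_mul_inv, le_div_iff₀ (by positivity)]
      refine le_trans ?_ (hbound g j)
      gcongr
    have h3 : ENNReal.ofReal (C * (2⁻¹) ^ (k + K)) = ENNReal.ofReal C * 2⁻¹ ^ (k + K) := by
      rw [ENNReal.ofReal_mul (by positivity), ENNReal.ofReal_pow (by positivity),
        ENNReal.ofReal_inv_of_pos (by norm_num), ENNReal.ofReal_ofNat]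
    rw [Real.enorm_eq_ofReal_abs, ← h3]
    exact ENNReal.ofReal_le_ofReal h2
  calc ∫⁻ g in A, ‖tripleKernel G x₀ r u v t g‖ₑ ^ p ∂μ
      ≤ ∫⁻ g in A, ∑' k, (E (k + K)).indicator
          (fun _ => (ENNReal.ofReal C * 2⁻¹ ^ (k + K)) ^ p) g ∂μ := setLIntegral_mono' hA hpt
    _ ≤ ∫⁻ g, ∑' k, (E (k + K)).indicator
          (fun _ => (ENNReal.ofReal C * 2⁻¹ ^ (k + K)) ^ p) g ∂μ := setLIntegral_le_lintegral _ _
    _ = ∑' k, (ENNReal.ofReal C * 2⁻¹ ^ (k + K)) ^ p * μ (E (k + K)) := by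
        rw [lintegral_tsum fun k => (measurable_const.indicator (hEm _)).aemeasurable]
        congr 1
        ext k
        rw [lintegral_indicator_const (hEm _)]
    _ ≤ ∑' k, D * q ^ (k + K) := by
        refine ENNReal.tsum_le_tsum fun k => ?_
        generalize k + K = n
        have h1 := measure_nearSides_le (x₀ := x₀) μ hX h R (2 ^ (n + 1))
        have h2 : ((3 * (2 * (R + 11 * 2 ^ (n + 1) + 1) + 1) : ℕ) : ℝ≥0∞) ≤
            ((3 * (2 * R + 3 + 44) : ℕ) : ℝ≥0∞) * 2 ^ n := by
          have : 3 * (2 * (R + 11 * 2 ^ (n + 1) + 1) + 1) ≤ 3 * (2 * R + 3 + 44) * 2 ^ n := by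
            have h3 : 1 ≤ 2 ^ n := Nat.one_le_two_pow
            rw [pow_succ]
            nlinarith
          exact_mod_cast this
        calc (ENNReal.ofReal C * 2⁻¹ ^ n) ^ p * μ (E n)
            ≤ (ENNReal.ofReal C * 2⁻¹ ^ n) ^ p *
              (((3 * (2 * R + 3 + 44) : ℕ) : ℝ≥0∞) * 2 ^ n * M) := by
              gcongr
              exact h1.trans (by gcongr)
          _ = D * q ^ n := by
              rw [ENNReal.mul_rpow_of_nonneg _ _ (by linarith), hD, hq, mul_pow,
                ← ENNReal.rpow_natCast (2⁻¹) n, ← ENNReal.rpow_mul, mul_comm (n : ℝ) p,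
                ENNReal.rpow_mul, ENNReal.rpow_natCast]
              ring

end Integrability
/-! ### The cocycle with values in `L^p` -/

section Cocycle

variable {X : Type*} [MetricSpace X] [ProperSpace X] {G : Subgroup (X ≃ᵢ X)} {x₀ : X} {r : ℝ≥0}
  {u v : X}

/-- The coboundary of the cochain, as a function on `G × G`. -/
noncomputable def coboundaryFun (G : Subgroup (X ≃ᵢ X)) (x₀ : X) (r : ℝ≥0) (u v : X)
    (t : Fin 3 → Boundary X) (z : G × G) : ℝ :=
  bump ((z.1 : X ≃ᵢ X) x₀) ((z.2 : X ≃ᵢ X) x₀) * tripleKernel G x₀ r u v t z.1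

theorem continuous_bump_apply : Continuous fun z : G × G =>
    bump ((z.1 : X ≃ᵢ X) x₀) ((z.2 : X ≃ᵢ X) x₀) :=
  continuous_bump.comp (((continuous_subgroup_apply_const x₀).comp
    continuous_fst).prodMk ((continuous_subgroup_apply_const x₀).comp continuous_snd))

theorem IsCAT0.continuous_tripleKernel_right (hX : IsCAT0 X) (t : Fin 3 → Boundary X) :
    Continuous (tripleKernel G x₀ r u v t) :=
  Continuous.uncurry_left t hX.continuous_tripleKernel

theorem IsCAT0.tripleKernel_smul (hX : IsCAT0 X) (t : Fin 3 → Boundary X) (g h : G) :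
    tripleKernel G x₀ r u v (g • t) (g * h) = tripleKernel G x₀ r u v t h := by
  unfold tripleKernel
  rw [← hX.pairKernel_smul (t 0, t 1) g, ← hX.pairKernel_smul (t 1, t 2) g,
    ← hX.pairKernel_smul (t 2, t 0) g]
  rfl

theorem IsCAT0.coboundaryFun_smul (hX : IsCAT0 X) (t : Fin 3 → Boundary X) (g : G) (z : G × G) :
    coboundaryFun G x₀ r u v (g • t) (g * z.1, g * z.2) = coboundaryFun G x₀ r u v t z := by
  have e : ∀ h : G, ((g * h : G) : X ≃ᵢ X) x₀ = (g : X ≃ᵢ X) ((h : X ≃ᵢ X) x₀) := fun _ => rfl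
  simp only [coboundaryFun, hX.tripleKernel_smul, e, Isometry.bump_eq (g : X ≃ᵢ X).isometry]

theorem coboundaryFun_eq (hX : IsCAT0 X) (t : Fin 3 → Boundary X) (z : G × G) :
    coboundaryFun G x₀ r u v t z = cochain G x₀ r u v hX (t 0, t 1) z +
      cochain G x₀ r u v hX (t 1, t 2) z + cochain G x₀ r u v hX (t 2, t 0) z := by
  simp only [coboundaryFun, cochain_apply, tripleKernel]
  ring

theorem IsCAT0.continuous_coboundaryFun (hX : IsCAT0 X) (t : Fin 3 → Boundary X) :
    Continuous (coboundaryFun G x₀ r u v t) := by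
  rw [funext (coboundaryFun_eq hX t)]
  exact ((map_continuous _).add (map_continuous _)).add (map_continuous _)

variable [MeasurableSpace G] (μ : Measure G) [μ.IsHaarMeasure]

theorem sigmaFinite_of_isClosed (hG : IsClosed (G : Set (X ≃ᵢ X))) (x₀ : X) : SigmaFinite μ := by
  have := weaklyLocallyCompactSpace_subgroup hG x₀
  infer_instance

variable [BorelSpace G]

theorem lintegral_bump_ne_top (hG : IsClosed (G : Set (X ≃ᵢ X))) {p : ℝ} (hp : 0 < p) :
    ∫⁻ h : G, ‖bump x₀ ((h : X ≃ᵢ X) x₀)‖ₑ ^ p ∂μ ≠ ∞ := by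
  set Q := {g : G | dist ((g : X ≃ᵢ X) x₀) x₀ ≤ 1}
  have hQ : IsCompact Q := isCompact_setOf_dist_le hG x₀ x₀ 1
  have hQm : MeasurableSet Q := (isClosed_le (by fun_prop) continuous_const).measurableSet
  refine ne_top_of_le_ne_top (hQ.measure_ne_top (μ := μ)) ?_
  rw [← lintegral_indicator_one hQm]
  refine lintegral_mono fun g => ?_
  by_cases hg : g ∈ Q
  · rw [indicator_of_mem hg, Pi.one_apply]
    refine ENNReal.rpow_le_one ?_ hp.le
    rw [Real.enorm_eq_ofReal (bump_nonneg _ _)]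
    exact ENNReal.ofReal_le_one.2 (bump_le_one _ _)
  · have : bump x₀ ((g : X ≃ᵢ X) x₀) = 0 := bump_eq_zero (not_le.1 hg).le
    rw [this, enorm_zero, ENNReal.zero_rpow_of_pos hp]
    exact zero_le

/-- For nearby triples `x₀` stays within `m` of all sides, so outside one compact set `Q` the orbit
point is far from some side and the uniform tail bound applies to both kernels. On `Q` the
convergence is uniform. -/
theorem tendsto_lintegral_tripleKernel_sub (hX : IsCAT0 X) (hG : IsClosed (G : Set (X ≃ᵢ X)))
    {B : ℝ} (hB : 0 < B) (huv : 3 ≤ dist u v) {p : ℝ} (hp : 1 < p) {t₀ : Fin 3 → Boundary X}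
    (ht₀ : t₀ ∈ joinedTriples X B) :
    Tendsto (fun t => ∫⁻ g, ‖tripleKernel G x₀ r u v t g - tripleKernel G x₀ r u v t₀ g‖ₑ ^ p ∂μ)
      (𝓝[joinedTriples X B] t₀) (𝓝 0) := by
  obtain ⟨τ, -, hτ0, hτ⟩ := exists_tail_bound (x₀ := x₀) (r := r) μ hX hG hB huv hp
  have hp0 : 0 < p := by linarith
  obtain ⟨m, hm⟩ := hX.eventually_infDist_le hB x₀ (t₀ := t₀) fun i => (ht₀ i).1
  rw [ENNReal.tendsto_nhds_zero]
  intro ε hε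
  have hε2 : 0 < ε / 2 := ENNReal.half_pos hε.ne'
  obtain ⟨K, hK1, hK2⟩ : ∃ K : ℕ, m ≤ 2 ^ K ∧ 2 ^ (p - 1) * (2 * τ K) ≤ ε / 2 := by
    have h1 : Tendsto (fun K => 2 ^ (p - 1) * (2 * τ K)) atTop (𝓝 (2 ^ (p - 1) * (2 * 0))) :=
      ENNReal.Tendsto.const_mul (ENNReal.Tendsto.const_mul hτ0 (Or.inr (by simp)))
        (Or.inr (ENNReal.rpow_ne_top_of_nonneg (by linarith) (by simp)))
    rw [mul_zero, mul_zero] at h1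
    have h2 := (ENNReal.tendsto_nhds_zero.1 h1) (ε / 2) hε2
    have h3 : ∀ᶠ K : ℕ in atTop, m ≤ 2 ^ K :=
      (tendsto_pow_atTop_atTop_of_one_lt (by norm_num : (1 : ℝ) < 2)).eventually_ge_atTop m
    exact (h3.and h2).exists
  set Q : Set G := {g : G | dist ((g : X ≃ᵢ X) x₀) x₀ ≤ 10 * 2 ^ K} with hQdef
  have hQ : IsCompact Q := isCompact_setOf_dist_le hG x₀ x₀ _
  have hQm : MeasurableSet Q := (isClosed_le (by fun_prop) continuous_const).measurableSet
  obtain ⟨δ, hδ, hδ0⟩ : ∃ δ : ℝ, ENNReal.ofReal δ ^ p * μ Q ≤ ε / 2 ∧ 0 < δ := by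
    have h1 : Tendsto (fun δ : ℝ => ENNReal.ofReal δ ^ p * μ Q) (𝓝[>] 0)
        (𝓝 (ENNReal.ofReal 0 ^ p * μ Q)) := by
      refine ENNReal.Tendsto.mul_const ?_ (Or.inr hQ.measure_ne_top)
      exact ((ENNReal.continuous_rpow_const.comp ENNReal.continuous_ofReal).tendsto 0).mono_left
        nhdsWithin_le_nhds
    rw [ENNReal.ofReal_zero, ENNReal.zero_rpow_of_pos hp0, zero_mul] at h1
    exact (((ENNReal.tendsto_nhds_zero.1 h1) (ε / 2) hε2).and self_mem_nhdsWithin).exists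
  have hunif : ∀ᶠ t in 𝓝 t₀, ∀ g ∈ Q,
      dist (tripleKernel G x₀ r u v t₀ g) (tripleKernel G x₀ r u v t g) < δ := by
    let Φ : C((Fin 3 → Boundary X) × G, ℝ) := ⟨_, hX.continuous_tripleKernel (x₀ := x₀) (r := r)
      (u := u) (v := v)⟩
    -- Joint continuity means continuity into the compact open topology, that is, uniform
    -- convergence on `Q`.
    have h1 := Φ.curry.continuous.tendsto t₀
    rw [ContinuousMap.tendsto_iff_forall_isCompact_tendstoUniformlyOn] at h1
    exact Metric.tendstoUniformlyOn_iff.1 (h1 Q hQ) δ hδ0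
  have htail : ∀ t ∈ joinedTriples X B, (∀ γ, IsContractingTriangle B t γ →
      ∀ i, Metric.infDist x₀ (range (γ i)) ≤ m) →
      ∫⁻ g in Qᶜ, ‖tripleKernel G x₀ r u v t g‖ₑ ^ p ∂μ ≤ τ K := by
    intro t ht h
    obtain ⟨γ, hγ⟩ := exists_isContractingTriangle ht
    refine hτ t γ hγ K _ hQm.compl fun g hg => ?_
    by_contra! hn
    refine hg (hγ.dist_le hX (fun i => ?_) fun i => (h γ hγ i).trans hK1)
    linarith [hn i]
  have hSm : ∀ t, Measurable (tripleKernel G x₀ r u v t) := fun t =>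
    (hX.continuous_tripleKernel_right t).measurable
  have hm' := hm.self_of_nhds
  filter_upwards [self_mem_nhdsWithin, mem_nhdsWithin_of_mem_nhds hm,
    mem_nhdsWithin_of_mem_nhds hunif] with t ht hmt hut
  rw [← lintegral_add_compl _ hQm, ← ENNReal.add_halves ε]
  refine add_le_add ?_ ?_
  · refine le_trans ?_ hδ
    rw [← setLIntegral_const]
    refine setLIntegral_mono' hQm fun g hg => ENNReal.rpow_le_rpow ?_ hp0.le
    rw [Real.enorm_eq_ofReal_abs, ← Real.dist_eq, dist_comm]
    exact ENNReal.ofReal_le_ofReal (hut g hg).le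
  · refine le_trans ?_ hK2
    calc ∫⁻ g in Qᶜ, ‖tripleKernel G x₀ r u v t g - tripleKernel G x₀ r u v t₀ g‖ₑ ^ p ∂μ
        ≤ ∫⁻ g in Qᶜ, 2 ^ (p - 1) * (‖tripleKernel G x₀ r u v t g‖ₑ ^ p +
            ‖tripleKernel G x₀ r u v t₀ g‖ₑ ^ p) ∂μ := by
          refine lintegral_mono fun g => ?_
          exact (ENNReal.rpow_le_rpow enorm_sub_le hp0.le).trans
            (ENNReal.rpow_add_le_mul_rpow_add_rpow _ _ hp.le)
      _ = 2 ^ (p - 1) * (∫⁻ g in Qᶜ, ‖tripleKernel G x₀ r u v t g‖ₑ ^ p ∂μ +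
            ∫⁻ g in Qᶜ, ‖tripleKernel G x₀ r u v t₀ g‖ₑ ^ p ∂μ) := by
          rw [lintegral_const_mul' _ _ (ENNReal.rpow_ne_top_of_nonneg (by linarith) (by simp)),
            lintegral_add_left ((hSm t).enorm.pow_const p)]
      _ ≤ 2 ^ (p - 1) * (2 * τ K) := by
          rw [two_mul]
          gcongr
          · exact htail t ht hmt
          · exact htail t₀ ht₀ hm'

variable [SigmaFinite μ]

/-- For each `g` the substitution `h ↦ g * h` turns the inner integral of the bump factor into a
constant, so `L^p` questions on `G × G` reduce to `G`. -/
theorem lintegral_bump_mul {f : G → ℝ} (hf : Continuous f) {p : ℝ} (hp : 0 ≤ p) :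
    ∫⁻ z : G × G, ‖bump ((z.1 : X ≃ᵢ X) x₀) ((z.2 : X ≃ᵢ X) x₀) * f z.1‖ₑ ^ p ∂(μ.prod μ) =
      (∫⁻ h : G, ‖bump x₀ ((h : X ≃ᵢ X) x₀)‖ₑ ^ p ∂μ) * ∫⁻ g, ‖f g‖ₑ ^ p ∂μ := by
  have hc : Continuous fun z : G × G => bump ((z.1 : X ≃ᵢ X) x₀) ((z.2 : X ≃ᵢ X) x₀) * f z.1 :=
    continuous_bump_apply.mul (hf.comp continuous_fst)
  rw [lintegral_prod _ (hc.measurable.enorm.pow_const p).aemeasurable,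
    ← lintegral_const_mul _ (hf.measurable.enorm.pow_const p)]
  refine lintegral_congr fun g => ?_
  have hm : Measurable fun h : G => ‖bump ((g : X ≃ᵢ X) x₀) ((h : X ≃ᵢ X) x₀)‖ₑ ^ p :=
    ((continuous_bump_apply.comp (continuous_const.prodMk continuous_id)).measurable.enorm).pow_const p
  simp only [enorm_mul, ENNReal.mul_rpow_of_nonneg _ _ hp]
  rw [lintegral_mul_const _ hm, ← lintegral_mul_left_eq_self _ g]
  congr 2
  ext h
  have e : ((g * h : G) : X ≃ᵢ X) x₀ = (g : X ≃ᵢ X) ((h : X ≃ᵢ X) x₀) := rfl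
  rw [e, Isometry.bump_eq (g : X ≃ᵢ X).isometry]

theorem eLpNorm_bump_mul {f : G → ℝ} (hf : Continuous f) {p : ℝ≥0∞} (h0 : p ≠ 0) (ht : p ≠ ∞) :
    eLpNorm (fun z : G × G => bump ((z.1 : X ≃ᵢ X) x₀) ((z.2 : X ≃ᵢ X) x₀) * f z.1) p (μ.prod μ) =
      ((∫⁻ h : G, ‖bump x₀ ((h : X ≃ᵢ X) x₀)‖ₑ ^ p.toReal ∂μ) *
        ∫⁻ g, ‖f g‖ₑ ^ p.toReal ∂μ) ^ (1 / p.toReal) := by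
  rw [eLpNorm_eq_lintegral_rpow_enorm_toReal h0 ht, lintegral_bump_mul μ hf ENNReal.toReal_nonneg]

theorem exists_cocycle (hX : IsCAT0 X) (hG : IsClosed (G : Set (X ≃ᵢ X))) {B : ℝ} (hB : 0 < B)
    (huv : 3 ≤ dist u v) (p : ℝ≥0∞) [Fact (1 ≤ p)] (hp : 1 < p) (hp' : p < ∞) :
    ∃ ω : (Fin 3 → Boundary X) → Lp ℝ p (μ.prod μ),
      (∀ t ∈ contractingTriples G B, ω t =ᵐ[μ.prod μ] coboundaryFun G x₀ r u v t) ∧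
      IsContinuousBoundedCocycle G μ B p ω ∧
      ∀ t ∈ contractingTriples G B, tripleKernel G x₀ r u v t 1 ≠ 0 → ω t ≠ 0 := by
  classical
  have hp0 : p ≠ 0 := (zero_lt_one.trans hp).ne'
  have hpr : 1 < p.toReal := by
    rw [← ENNReal.toReal_one]; exact (ENNReal.toReal_lt_toReal (by simp) hp'.ne).2 hp
  set c₀ := ∫⁻ h : G, ‖bump x₀ ((h : X ≃ᵢ X) x₀)‖ₑ ^ p.toReal ∂μ
  have hc₀ : c₀ ≠ ∞ := lintegral_bump_ne_top μ hG (by linarith)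
  obtain ⟨τ, hτ, -, hτ'⟩ := exists_tail_bound (x₀ := x₀) (r := r) μ hX hG hB huv hpr
  set D := (c₀ * τ 0) ^ (1 / p.toReal)
  have hD : D ≠ ∞ := ENNReal.rpow_ne_top_of_nonneg (by positivity) (ENNReal.mul_ne_top hc₀ hτ)
  have hnorm : ∀ t ∈ joinedTriples X B, eLpNorm (coboundaryFun G x₀ r u v t) p (μ.prod μ) ≤ D := by
    intro t ht
    obtain ⟨γ, hγ⟩ := exists_isContractingTriangle ht
    have h1 := hτ' t γ hγ 0 univ MeasurableSet.univ fun g _ => ⟨0, by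
      simp [Metric.infDist_nonneg]⟩
    rw [setLIntegral_univ] at h1
    refine (eLpNorm_bump_mul μ (hX.continuous_tripleKernel_right t) hp0 hp'.ne).trans_le ?_
    exact ENNReal.rpow_le_rpow (by gcongr) (by positivity)
  have hmem : ∀ t ∈ joinedTriples X B, MemLp (coboundaryFun G x₀ r u v t) p (μ.prod μ) :=
    fun t ht => ⟨(hX.continuous_coboundaryFun t).aestronglyMeasurable,
      (hnorm t ht).trans_lt (lt_top_iff_ne_top.2 hD)⟩
  let ω : (Fin 3 → Boundary X) → Lp ℝ p (μ.prod μ) := fun t =>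
    if h : MemLp (coboundaryFun G x₀ r u v t) p (μ.prod μ) then h.toLp else 0
  have hω : ∀ t (ht : t ∈ joinedTriples X B), ω t = (hmem t ht).toLp := fun t ht =>
    dif_pos (hmem t ht)
  have hωae : ∀ t ∈ joinedTriples X B, ω t =ᵐ[μ.prod μ] coboundaryFun G x₀ r u v t :=
    fun t ht => by rw [hω t ht]; exact (hmem t ht).coeFn_toLp
  have hsub : contractingTriples G B ⊆ joinedTriples X B := fun t ht => ht.2.2
  refine ⟨ω, fun t ht => hωae t (hsub ht), ⟨?_, ?_, ?_, ?_, ?_⟩, ?_⟩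
  · refine ContinuousOn.mono (fun t₀ ht₀ => ?_) hsub
    rw [ContinuousWithinAt, tendsto_iff_edist_tendsto_0]
    have h1 := tendsto_lintegral_tripleKernel_sub (x₀ := x₀) (r := r) μ hX hG hB huv hpr ht₀
    have h2 : Tendsto (fun t => (c₀ * ∫⁻ g, ‖tripleKernel G x₀ r u v t g -
        tripleKernel G x₀ r u v t₀ g‖ₑ ^ p.toReal ∂μ) ^ (1 / p.toReal))
        (𝓝[joinedTriples X B] t₀) (𝓝 ((c₀ * 0) ^ (1 / p.toReal))) :=
      (ENNReal.Tendsto.const_mul h1 (Or.inr hc₀)).ennrpow_const _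
    rw [mul_zero, ENNReal.zero_rpow_of_pos (by positivity)] at h2
    refine h2.congr' ?_
    filter_upwards [self_mem_nhdsWithin] with t ht
    rw [hω t ht, hω t₀ ht₀, Lp.edist_toLp_toLp, ← eLpNorm_bump_mul μ
      (f := fun g => tripleKernel G x₀ r u v t g - tripleKernel G x₀ r u v t₀ g) ((hX.continuous_tripleKernel_right t).sub (hX.continuous_tripleKernel_right t₀)) hp0 hp'.ne]
    congr 1
    ext z
    simp only [Pi.sub_apply, coboundaryFun]
    ring
  · refine ⟨D.toReal, fun t ht => ?_⟩
    rw [hω t (hsub ht), Lp.norm_toLp]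
    exact ENNReal.toReal_mono hD (hnorm t (hsub ht))
  · intro g t ht
    have hgt : g • t ∈ joinedTriples X B := fun i =>
      smul_mem_contractingPairs (hsub ht i) (g : X ≃ᵢ X)
    have hT := (measurePreserving_mul_left μ g).prod (measurePreserving_mul_left μ g)
    filter_upwards [hT.quasiMeasurePreserving.ae (hωae _ hgt), hωae t (hsub ht)] with z h1 h2
    rw [h2, ← hX.coboundaryFun_smul t g z]
    exact h1
  · intro σ t ht
    have hσ : t ∘ σ ∈ joinedTriples X B := fun i =>
      joinedTriples_pair (hsub ht) (σ.injective.ne (by revert i; decide))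
    rw [← Int.cast_smul_eq_zsmul ℝ]
    refine Lp.ext ?_
    filter_upwards [hωae _ hσ, hωae t (hsub ht), Lp.coeFn_smul (((Equiv.Perm.sign σ : ℤ) : ℝ))
      (ω t)] with z h1 h2 h3
    rw [h1, h3, Pi.smul_apply, h2, coboundaryFun, coboundaryFun, tripleKernel_comp, smul_eq_mul]
    ring
  · intro a₁ a₂ a₃ a₄ hnd _ hpair
    have hj : ∀ a b c : Boundary X, a ∈ [a₁, a₂, a₃, a₄] → b ∈ [a₁, a₂, a₃, a₄] →
        c ∈ [a₁, a₂, a₃, a₄] → a ≠ b → b ≠ c → c ≠ a → ![a, b, c] ∈ joinedTriples X B := by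
      intro a b c ha hb hc hab hbc hca i
      fin_cases i
      · exact hpair a ha b hb hab
      · exact hpair b hb c hc hbc
      · exact hpair c hc a ha hca
    simp only [List.nodup_cons, List.mem_cons, List.not_mem_nil, or_false, not_or] at hnd
    obtain ⟨⟨n12, n13, n14⟩, ⟨n23, n24⟩, n34, -⟩ := hnd
    have h1 := hωae _ (hj a₂ a₃ a₄ (by simp) (by simp) (by simp) n23 n34 (Ne.symm n24))
    have h2 := hωae _ (hj a₁ a₃ a₄ (by simp) (by simp) (by simp) n13 n34 (Ne.symm n14))
    have h3 := hωae _ (hj a₁ a₂ a₄ (by simp) (by simp) (by simp) n12 n24 (Ne.symm n14))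
    have h4 := hωae _ (hj a₁ a₂ a₃ (by simp) (by simp) (by simp) n12 n23 (Ne.symm n13))
    refine Lp.ext ?_
    filter_upwards [h1, h2, h3, h4, Lp.coeFn_zero ℝ p (μ.prod μ),
      Lp.coeFn_sub (ω ![a₂, a₃, a₄]) (ω ![a₁, a₃, a₄]),
      Lp.coeFn_add (ω ![a₂, a₃, a₄] - ω ![a₁, a₃, a₄]) (ω ![a₁, a₂, a₄]),
      Lp.coeFn_sub (ω ![a₂, a₃, a₄] - ω ![a₁, a₃, a₄] + ω ![a₁, a₂, a₄]) (ω ![a₁, a₂, a₃])]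
      with z e1 e2 e3 e4 e0 s1 s2 s3
    rw [s3, Pi.sub_apply, s2, Pi.add_apply, s1, Pi.sub_apply, e0, e1, e2, e3, e4, Pi.zero_apply]
    have k1 : pairKernel G x₀ r u v (a₄, a₂) z.1 = -pairKernel G x₀ r u v (a₂, a₄) z.1 :=
      pairKernel_swap (a₂, a₄) z.1
    have k2 : pairKernel G x₀ r u v (a₃, a₁) z.1 = -pairKernel G x₀ r u v (a₁, a₃) z.1 :=
      pairKernel_swap (a₁, a₃) z.1
    simp only [coboundaryFun, tripleKernel, Matrix.cons_val_zero, Matrix.cons_val_one,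
      Matrix.cons_val]
    rw [k1, k2]
    ring
  · intro t ht h1 h0
    have h2 := hωae t (hsub ht)
    rw [h0] at h2
    have h3 : coboundaryFun G x₀ r u v t =ᵐ[μ.prod μ] fun _ => 0 :=
      h2.symm.trans (Lp.coeFn_zero ℝ p (μ.prod μ))
    -- Haar measure charges every nonempty open set, so continuous functions that agree almost
    -- everywhere are equal; evaluation at the identity then contradicts the assumption.
    have h4 := (hX.continuous_coboundaryFun t).ae_eq_iff_eq (μ := μ.prod μ) continuous_const |>.1 h3
    have h5 := congrFun h4 (1, 1)
    rw [coboundaryFun, bump_self, one_mul] at h5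
    exact h1 h5

end Cocycle
/-! ### The support of the cochain -/

section Support

variable {X : Type*} [MetricSpace X]

theorem endpoint_eq_point {c : GeneralizedRay X} {T : ℝ≥0}
    (h : ∀ s t, dist (c.1 s) (c.1 t) = dist (min s T) (min t T)) :
    c.endpoint = .point (c.1 T) := by
  have hn : ¬ Isometry c.1 := fun hi => by
    have h1 := hi.dist_eq T (T + 1)
    rw [h, min_self, min_eq_right le_self_add, dist_self, NNReal.dist_eq] at h1
    simp at h1
  rw [GeneralizedRay.endpoint, dif_neg hn]
  have h' := Classical.choose_spec (c.2.resolve_left hn)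
  set T' := Classical.choose (c.2.resolve_left hn)
  congr 1
  rw [← dist_eq_zero]
  rcases le_total T T' with hT | hT
  · rw [h, min_self, min_eq_right hT, dist_self]
  · rw [h', min_self, min_eq_right hT, dist_self]

theorem endpoint_eq_ideal (c : GeodesicRay X) :
    GeneralizedRay.endpoint ⟨c.1, Or.inl c.2⟩ = .ideal (Quotient.mk _ c) := by
  rw [GeneralizedRay.endpoint, dif_pos c.2]

theorem continuous_point : Continuous (Bordification.point : X → Bordification X) := by
  have h0 : ∀ (x : X) (s t : ℝ≥0), dist (ContinuousMap.const ℝ≥0 x s)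
      (ContinuousMap.const ℝ≥0 x t) = dist (min s 0) (min t 0) := fun x s t => by
    simp
  let f : X → GeneralizedRay X := fun x => ⟨ContinuousMap.const ℝ≥0 x, Or.inr ⟨0, h0 x⟩⟩
  have hf : Continuous f := ContinuousMap.continuous_const'.subtype_mk _
  have he : (Bordification.point : X → Bordification X) = GeneralizedRay.endpoint ∘ f :=
    funext fun x => (endpoint_eq_point (c := f x) (h0 x)).symm
  rw [he]
  exact continuous_coinduced_rng.comp hf

theorem IsCAT0.exists_generalizedRay (hX : IsCAT0 X) (x y : X) : ∃ c : GeneralizedRay X,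
    c.endpoint = .point y ∧ ∀ t : ℝ≥0, t ≤ dist x y →
      dist x (c.1 t) = t ∧ dist (c.1 t) y = dist x y - t := by
  obtain ⟨e, e0, e1, he⟩ := hX.geodesic x y
  set T : ℝ≥0 := ⟨dist x y, dist_nonneg⟩
  have hT : (T : ℝ) = dist x y := rfl
  have hI : ∀ s : ℝ≥0, ((min s T : ℝ≥0) : ℝ) ∈ Icc 0 (dist x y) := fun s =>
    ⟨NNReal.coe_nonneg _, by rw [← hT]; exact_mod_cast min_le_right s T⟩
  have hd : ∀ s t : ℝ≥0, dist (e (min s T : ℝ≥0)) (e (min t T : ℝ≥0)) =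
      dist (min s T) (min t T) := fun s t => by
    rw [he _ (hI s) _ (hI t), NNReal.dist_eq]
  have hc : Continuous fun s : ℝ≥0 => e (min s T : ℝ≥0) := by
    rw [Metric.continuous_iff']
    intro s ε hε
    have h1 : Continuous fun s : ℝ≥0 => min s T := by fun_prop
    filter_upwards [Metric.continuous_iff'.1 h1 s ε hε] with t ht
    rwa [hd]
  refine ⟨⟨⟨_, hc⟩, Or.inr ⟨T, hd⟩⟩, ?_, fun t ht => ?_⟩
  · rw [endpoint_eq_point (T := T) hd]
    change Bordification.point (e (min T T : ℝ≥0)) = _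
    rw [min_self, hT, e1]
  · have ht' : t ≤ T := ht
    change dist x (e (min t T : ℝ≥0)) = t ∧ dist (e (min t T : ℝ≥0)) y = _
    rw [min_eq_left ht']
    have hti : (t : ℝ) ∈ Icc 0 (dist x y) := ⟨t.2, ht⟩
    constructor
    · conv_lhs => rw [← e0]
      rw [he 0 ⟨le_rfl, dist_nonneg⟩ t hti]
      simp
    · conv_lhs => rw [← e1]
      rw [he t hti _ ⟨dist_nonneg, le_rfl⟩, abs_sub_comm, abs_of_nonneg (by linarith)]

/-- Points close to a ray and far away are close to its endpoint in the bordification. -/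
theorem Joins.eventually_point_mem (hX : IsCAT0 X) {γ : ℝ → X} {ξ η : Boundary X}
    (h : Joins γ ξ η) (R : ℝ) {A : Set (Bordification X)} (hA : IsOpen A)
    (hη : Bordification.ideal η ∈ A) :
    ∃ T : ℝ, ∀ s, T ≤ s → ∀ y, dist y (γ s) ≤ R → Bordification.point y ∈ A := by
  by_contra! hcon
  choose s hs y hy hyA using fun n : ℕ => hcon n
  set x₀ := γ 0
  set c := lineRay γ h.isometry 0
  have hc : ∀ t : ℝ≥0, c.1 t = γ t := fun t => by
    change γ (0 + t) = γ t
    rw [zero_add]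
  have hcη : Quotient.mk _ c = η := h.mk_lineRay 0
  have hR : 0 ≤ R := dist_nonneg.trans (hy 0)
  choose e he he' using fun n => hX.exists_generalizedRay x₀ (y n)
  have hlen : ∀ n : ℕ, |s n - dist x₀ (y n)| ≤ R := fun n => by
    have hsn : (0 : ℝ) ≤ s n := (Nat.cast_nonneg n).trans (hs n)
    have h1 : dist x₀ (γ (s n)) = s n := by
      rw [h.isometry.dist_eq, Real.dist_eq, zero_sub, abs_neg, abs_of_nonneg hsn]
    have h2 := dist_triangle x₀ (y n) (γ (s n))
    have h3 := dist_triangle_right x₀ (y n) (γ (s n))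
    have h4 := hy n
    rw [h1] at h2 h3
    exact abs_le.2 ⟨by linarith, by linarith⟩
  -- If the claim failed, the segments from `γ 0` to the bad points `y n` would converge to the ray
  -- towards `η` as generalized rays: their endpoints are within `2 * R` of that ray at matching
  -- times, and convexity shrinks this at bounded times.
  have htend : Tendsto e atTop (𝓝 ⟨c.1, Or.inl c.2⟩) := by
    rw [tendsto_subtype_rng, ContinuousMap.tendsto_iff_tendstoLocallyUniformly,
      Metric.tendstoLocallyUniformly_iff]
    intro ε hε q
    refine ⟨Iio (q + 1), Iio_mem_nhds (by simp), ?_⟩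
    obtain ⟨N, hN⟩ := exists_nat_gt (R + (q + 1) + (q + 1) * (2 * R) / ε)
    filter_upwards [eventually_ge_atTop N] with n hn t ht
    have hnN : (N : ℝ) ≤ n := by exact_mod_cast hn
    have ht1 : (t : ℝ) < q + 1 := by exact_mod_cast ht
    have h1 := abs_le.1 (hlen n)
    have h2 := hs n
    have hq : (0 : ℝ) ≤ q := q.2
    have ht0 : (0 : ℝ) ≤ t := t.2
    have h3 : 0 ≤ ((q : ℝ) + 1) * (2 * R) / ε := by positivity
    set L := dist x₀ (y n) with hL
    have hLpos : 0 < L := by linarith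
    have htL : (t : ℝ) ≤ L := by linarith
    set L' : ℝ≥0 := ⟨L, hLpos.le⟩
    have hL' : (L' : ℝ) = L := rfl
    have hcx : ∀ t : ℝ≥0, dist x₀ (c.1 t) = t := fun t => by
      rw [hc, h.isometry.dist_eq, Real.dist_eq]; simp
    have h4 := hX.dist_le_mul (x := x₀) (y := y n) (z := c.1 L') (p := (e n).1 t) (q := c.1 t)
      (t := t / L) (by positivity) (by rwa [div_le_one hLpos])
      (by rw [(he' n t htL).1, ← hL]; field_simp)
      (by rw [(he' n t htL).2, ← hL]; field_simp)
      (by rw [hcx, hcx, hL']; field_simp)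
      (by rw [c.dist_eq' htL, hcx, hL']; field_simp)
    have h5 : dist (y n) (c.1 L') ≤ 2 * R := by
      have h6 := dist_triangle (y n) (γ (s n)) (c.1 L')
      rw [hc, h.isometry.dist_eq, Real.dist_eq, hL'] at h6
      rw [hc, hL']
      linarith [hy n, hlen n]
    rw [dist_comm]
    refine h4.trans_lt ?_
    rw [div_mul_eq_mul_div, div_lt_iff₀ hLpos]
    have h7 : (t : ℝ) * dist (y n) (c.1 L') ≤ (q + 1) * (2 * R) := by gcongr
    have h8 : ((q : ℝ) + 1) * (2 * R) / ε < L := by linarith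
    rw [div_lt_iff₀ hε] at h8
    linarith
  have hopen : IsOpen (GeneralizedRay.endpoint ⁻¹' A) := isOpen_coinduced.1 hA
  have hmem : (⟨c.1, Or.inl c.2⟩ : GeneralizedRay X) ∈ GeneralizedRay.endpoint ⁻¹' A := by
    rw [mem_preimage, endpoint_eq_ideal, hcη]
    exact hη
  obtain ⟨n, hn⟩ := (htend.eventually (hopen.mem_nhds hmem)).exists
  rw [he] at hn
  exact hyA n hn

variable [ProperSpace X]

theorem Joins.exists_dist_le (hX : IsCAT0 X) {γ : ℝ → X} {ξ η : Boundary X}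
    (h : Joins γ ξ η) (R : ℝ) (x : X) {A₁ A₂ : Set (Bordification X)} (hA₁ : IsOpen A₁)
    (hξ : Bordification.ideal ξ ∈ A₁) (hA₂ : IsOpen A₂) (hη : Bordification.ideal η ∈ A₂) :
    ∃ ρ : ℝ, ∀ y, Metric.infDist y (range γ) ≤ R → Bordification.point y ∉ A₁ ∪ A₂ →
      dist y x ≤ ρ := by
  obtain ⟨T₁, h₁⟩ := h.symm.eventually_point_mem hX R hA₁ hξ
  obtain ⟨T₂, h₂⟩ := h.eventually_point_mem hX R hA₂ hη
  refine ⟨R + max T₁ T₂ + dist (γ 0) x, fun y hy hyA => ?_⟩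
  obtain ⟨s, hs⟩ := h.exists_dist_eq y
  rw [← hs] at hy
  have h3 : s < T₂ := by
    by_contra! hn
    exact hyA (Or.inr (h₂ s hn y hy))
  have h4 : -s < T₁ := by
    by_contra! hn
    exact hyA (Or.inl (h₁ (-s) hn y (by rwa [neg_neg])))
  have h5 : |s| ≤ max T₁ T₂ := abs_le.2 ⟨by linarith [le_max_left T₁ T₂],
    by linarith [le_max_right T₁ T₂]⟩
  have h6 := dist_triangle4 y (γ s) (γ 0) x
  rw [h.isometry.dist_eq, Real.dist_eq, sub_zero] at h6
  linarith

variable {G : Subgroup (X ≃ᵢ X)} {x₀ : X} {r : ℝ≥0} {u v : X}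

/-- On the support `g x₀` stays in a bounded neighborhood of the line and `h x₀` within 1 of `g x₀`.
Removing neighborhoods of both ends leaves a bounded part of the neighborhood, and the orbit map of
a closed group is proper. -/
theorem isCompact_tsupport_cochain (hX : IsCAT0 X) (hG : IsClosed (G : Set (X ≃ᵢ X))) {B : ℝ}
    (hB : 0 < B) (huv : 3 ≤ dist u v) {c : Boundary X × Boundary X}
    (hc : c ∈ contractingPairs X B) {A₁ A₂ : Set (Bordification X)} (hA₁ : IsOpen A₁)
    (hc₁ : Bordification.ideal c.1 ∈ A₁) (hA₂ : IsOpen A₂) (hc₂ : Bordification.ideal c.2 ∈ A₂) :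
    IsCompact (tsupport (cochain G x₀ r u v hX c) ∩
      {z : G × G | Bordification.point ((z.1 : X ≃ᵢ X) x₀) ∉ A₁ ∪ A₂}) := by
  obtain ⟨-, γ, hγ, hγB⟩ := mem_contractingPairs.1 hc
  set R : ℝ := r * max (16 * B) (2 * r)
  obtain ⟨ρ, hρ⟩ := hγ.exists_dist_le hX R x₀ hA₁ hc₁ hA₂ hc₂
  have hclosed : IsClosed {z : G × G | dist ((z.2 : X ≃ᵢ X) x₀) ((z.1 : X ≃ᵢ X) x₀) ≤ 1 ∧
      Metric.infDist ((z.1 : X ≃ᵢ X) x₀) (range γ) ≤ R} := by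
    have hf : ∀ f : G × G → G, Continuous f → Continuous fun z => (f z : X ≃ᵢ X) x₀ := fun f hf =>
      (continuous_subgroup_apply_const x₀).comp hf
    have h1 := isClosed_le ((hf _ continuous_snd).dist (hf _ continuous_fst))
      (continuous_const (y := (1 : ℝ)))
    have h2 := isClosed_le ((Metric.continuous_infDist_pt (range γ)).comp (hf _ continuous_fst))
      (continuous_const (y := R))
    exact h1.inter h2
  have hsub : tsupport (cochain G x₀ r u v hX c) ⊆
      {z : G × G | dist ((z.2 : X ≃ᵢ X) x₀) ((z.1 : X ≃ᵢ X) x₀) ≤ 1 ∧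
      Metric.infDist ((z.1 : X ≃ᵢ X) x₀) (range γ) ≤ R} := by
    refine closure_minimal (fun z hz => ?_) hclosed
    rw [Function.mem_support, cochain_apply] at hz
    exact ⟨(dist_lt_of_bump_ne_zero (left_ne_zero_of_mul hz)).le,
      infDist_le_of_pairKernel_ne_zero hX hB huv hγ hγB (right_ne_zero_of_mul hz)⟩
  refine ((isCompact_setOf_dist_le hG x₀ x₀ ρ).prod
    (isCompact_setOf_dist_le hG x₀ x₀ (1 + ρ))).of_isClosed_subset ?_ ?_
  · refine (isClosed_tsupport _).inter ?_
    have : Continuous fun z : G × G => Bordification.point ((z.1 : X ≃ᵢ X) x₀) :=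
      continuous_point.comp ((continuous_subgroup_apply_const x₀).comp continuous_fst)
    exact (hA₁.union hA₂).isClosed_compl.preimage this
  · rintro z ⟨hz, hzA⟩
    obtain ⟨h1, h2⟩ := hsub hz
    have h3 := hρ _ h2 hzA
    refine ⟨h3, ?_⟩
    have := dist_triangle ((z.2 : X ≃ᵢ X) x₀) ((z.1 : X ≃ᵢ X) x₀) x₀
    change dist ((z.2 : X ≃ᵢ X) x₀) x₀ ≤ 1 + ρ
    linarith

theorem isAdmissibleMap_cochain (hX : IsCAT0 X) (hG : IsClosed (G : Set (X ≃ᵢ X)))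
    [MeasurableSpace G] [BorelSpace G] (μ : Measure G) [μ.IsHaarMeasure] {B : ℝ}
    (hB : 0 < B) (huv : 3 ≤ dist u v) {a b ξ : Boundary X}
    (hT : ![a, b, ξ] ∈ contractingTriples G B)
    (hne : tripleKernel G x₀ r u v ![a, b, ξ] 1 ≠ 0) :
    IsAdmissibleMap G μ B x₀ a b ξ (cochain G x₀ r u v hX) where
  continuousOn := (continuous_cochain hX).continuousOn
  bounded c _ := ⟨1, abs_cochain_le_one hX c⟩
  equivariant c _ g z := cochain_smul hX c g z
  antisymmetric c _ := cochain_swap hX c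
  support c hc _ _ hA₁ hc₁ hA₂ hc₂ := isCompact_tsupport_cochain hX hG hB huv hc hA₁ hc₁ hA₂ hc₂
  coboundary p _ hp hp' := by
    have := sigmaFinite_of_isClosed μ hG x₀
    obtain ⟨ω, h1, h2, h3⟩ := exists_cocycle (x₀ := x₀) (r := r) μ hX hG hB huv p hp hp'
    refine ⟨ω, fun t ht => ?_, h2, h3 _ hT hne⟩
    filter_upwards [h1 t ht] with z hz
    rw [hz, coboundaryFun_eq hX]

end Support
/-! ### Orbits of pairs of fixed points -/

section Axes

variable {X : Type*} [MetricSpace X]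

theorem Joins.smul_eq_of_translate {γ : ℝ → X} {ξ η : Boundary X} (h : Joins γ ξ η) {g : X ≃ᵢ X}
    {τ : ℝ} (hg : ∀ t, g (γ t) = γ (t + τ)) : g • η = η := by
  conv_lhs => rw [← h.mk_lineRay 0, smul_mk]
  refine Eq.trans ?_ (h.mk_lineRay τ)
  congr 1
  apply Subtype.ext
  ext t
  change g (γ (0 + t)) = γ (τ + t)
  rw [hg]
  congr 1
  ring

variable (G : Subgroup (X ≃ᵢ X))

/-- Some element of `G` translates a contracting line from `a` to `b` in the direction of `b`. -/
def HasContractingAxis (a b : Boundary X) : Prop :=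
  ∃ (h : G) (γ : ℝ → X) (τ B : ℝ), 0 < τ ∧ 0 < B ∧ Joins γ a b ∧ IsContracting B (range γ) ∧
    ∀ t, (h : X ≃ᵢ X) (γ t) = γ (t + τ)

variable {G}

theorem HasContractingAxis.symm {a b : Boundary X} (h : HasContractingAxis G a b) :
    HasContractingAxis G b a := by
  obtain ⟨h, γ, τ, B, hτ, hB, hγ, hc, ht⟩ := h
  refine ⟨h⁻¹, _, τ, B, hτ, hB, hγ.symm, by rwa [range_comp_neg], fun t => ?_⟩
  have : γ (-t) = (h : X ≃ᵢ X) (γ (-(t + τ))) := by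
    rw [ht]; congr 1; ring
  rw [this]
  exact (h : X ≃ᵢ X).symm_apply_apply _

theorem HasContractingAxis.smul {a b : Boundary X} (h : HasContractingAxis G a b) (g : G) :
    HasContractingAxis G (g • a) (g • b) := by
  obtain ⟨h, γ, τ, B, hτ, hB, hγ, hc, ht⟩ := h
  refine ⟨g * h * g⁻¹, _, τ, B, hτ, hB, hγ.smul (g : X ≃ᵢ X), hc.smul (g : X ≃ᵢ X), fun t => ?_⟩
  change (g : X ≃ᵢ X) ((h : X ≃ᵢ X) ((g : X ≃ᵢ X).symm ((g : X ≃ᵢ X) (γ t)))) = _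
  rw [(g : X ≃ᵢ X).symm_apply_apply, ht]

theorem zpow_translate {γ : ℝ → X} {g : X ≃ᵢ X} {τ : ℝ} (hg : ∀ t, g (γ t) = γ (t + τ)) (k : ℤ)
    (t : ℝ) : (g ^ k) (γ t) = γ (t + k * τ) := by
  induction k using Int.induction_on with
  | zero => simp
  | succ k ih =>
    rw [add_comm, zpow_add, zpow_one]
    change g ((g ^ (k : ℤ)) (γ t)) = _
    rw [ih, hg]
    congr 1
    push_cast
    ring
  | pred k ih =>
    rw [sub_eq_add_neg, add_comm, zpow_add, zpow_neg_one]
    change g.symm ((g ^ (-(k : ℤ))) (γ t)) = _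
    rw [ih, IsometryEquiv.symm_apply_eq, hg]
    congr 1
    push_cast
    ring

theorem zpow_smul_eq {g : G} {ξ : Boundary X} (h : g • ξ = ξ) (k : ℤ) : g ^ k • ξ = ξ :=
  (MulAction.stabilizer G ξ).zpow_mem (MulAction.mem_stabilizer_iff.2 h) k

theorem Joins.ne (hX : IsCAT0 X) {γ : ℝ → X} {ξ η : Boundary X} (h : Joins γ ξ η) : ξ ≠ η := by
  rintro rfl
  have h1 := h.rayPoint hX 0 1
  have h2 := h.symm.rayPoint hX 0 1
  simp only [neg_zero] at h2
  rw [h1] at h2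
  have := h.isometry.injective h2
  norm_num at this

/-- The endpoints of the axis are distinct fixed points, hence are `a` and `b` in some order; the
inverse element corrects the orientation. -/
theorem IsRankOnePair.hasContractingAxis (hX : IsCAT0 X) {a b : Boundary X}
    (h : IsRankOnePair G a b) : HasContractingAxis G a b := by
  obtain ⟨hab, g, hgG, ⟨⟨τ₀, hτ₀, hl₀⟩, B, hB, γ, ⟨hγ, τ, hl, ht⟩, hc⟩, hfix⟩ := h
  obtain rfl := hl₀.unique hl
  have hj : Joins γ (negEnd γ hγ) (posEnd γ hγ) := ⟨hγ, rfl, rfl⟩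
  have h1 : posEnd γ hγ ∈ ({a, b} : Set (Boundary X)) := by
    rw [← hfix]; exact hj.smul_eq_of_translate ht
  have h2 : negEnd γ hγ ∈ ({a, b} : Set (Boundary X)) := by
    rw [← hfix]
    exact hj.symm.smul_eq_of_translate (τ := -τ₀) fun t => by rw [ht]; congr 1; ring
  have key : HasContractingAxis G (negEnd γ hγ) (posEnd γ hγ) :=
    ⟨⟨g, hgG⟩, γ, τ₀, B, hτ₀, hB, hj, hc, ht⟩
  have hne := hj.ne hX
  rcases h1 with h1 | h1 <;> rcases h2 with h2 | h2
  · exact absurd (h2.trans h1.symm) hne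
  · rw [h1, h2] at key; exact key.symm
  · rw [h1, h2] at key; exact key
  · exact absurd (h2.trans h1.symm) hne

variable [ProperSpace X]

/-- The pair `c` is close to the pair `e`, as seen from `x₀`. -/
def IsNear (x₀ : X) (n : ℝ≥0) (c e : Boundary X × Boundary X) : Prop :=
  dist (rayPoint x₀ n c.1) (rayPoint x₀ n e.1) ≤ 1 ∧
    dist (rayPoint x₀ n c.2) (rayPoint x₀ n e.2) ≤ 1

theorem IsNear.mono (hX : IsCAT0 X) {x₀ : X} {m n : ℝ≥0} (hmn : m ≤ n)
    {c e : Boundary X × Boundary X} (h : IsNear x₀ n c e) : IsNear x₀ m c e :=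
  ⟨(hX.dist_rayPoint_mono x₀ _ _ hmn).trans h.1, (hX.dist_rayPoint_mono x₀ _ _ hmn).trans h.2⟩

theorem IsCAT0.tendsto_rayPoint_smul (hX : IsCAT0 X) {ι : Type*} {l : Filter ι} {F : ι → X ≃ᵢ X}
    {g : X ≃ᵢ X} (hF : Tendsto F l (𝓝 g)) (x : X) (s : ℝ≥0) (ξ : Boundary X) :
    Tendsto (fun i => rayPoint x s (F i • ξ)) l (𝓝 (rayPoint x s (g • ξ))) := by
  rw [tendsto_isometryEquiv_iff] at hF
  have h1 := hF (rayPoint (g.symm x) s ξ)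
  have h2 := hF (g.symm x)
  rw [← hX.smul_rayPoint, g.apply_symm_apply] at h1
  rw [g.apply_symm_apply] at h2
  refine h1.congr_dist (squeeze_zero (fun _ => dist_nonneg) (fun i => ?_)
    (tendsto_iff_dist_tendsto_zero.1 h2))
  rw [← hX.smul_rayPoint]
  exact hX.dist_rayPoint_le _ _ _ _

/-- The orbit of the pair of endpoints of a contracting axis is closed. -/
theorem HasContractingAxis.exists_smul_eq (hX : IsCAT0 X) (hG : IsClosed (G : Set (X ≃ᵢ X)))
    (x₀ : X) {c e : Boundary X × Boundary X} (hc : HasContractingAxis G c.1 c.2)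
    (he : e.1 ≠ e.2) (h : ∀ n : ℕ, ∃ g : G, IsNear x₀ n (g • c) e) : ∃ g : G, g • c = e := by
  obtain ⟨a, γ, τ, B, hτ, hB, hγ, hγB, ha⟩ := hc
  have hac : ∀ k : ℤ, a ^ k • c = c := fun k => Prod.ext
    (zpow_smul_eq (hγ.symm.smul_eq_of_translate (τ := -τ) fun t => by rw [ha]; congr 1; ring) k)
    (zpow_smul_eq (hγ.smul_eq_of_translate ha) k)
  choose g hg using h
  -- Once the rays to `e` are 3 apart, the rays to any pair near `e` are at least 1 apart. The
  -- translates `g n` of the axis then pass within `R` of `x₀`.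
  obtain ⟨N, hN⟩ : ∃ N : ℕ, 3 ≤ dist (rayPoint x₀ N e.1) (rayPoint x₀ N e.2) :=
    (((hX.tendsto_dist_rayPoint x₀ he).comp tendsto_natCast_atTop_atTop).eventually_ge_atTop
      3).exists
  set R : ℝ := (N : ℝ≥0) * max (16 * B) (2 * (N : ℝ≥0))
  have hclose : ∀ n, N ≤ n → ∃ k : ℤ,
      dist (((g n * a ^ k : G) : X ≃ᵢ X) (γ 0)) x₀ ≤ τ + R := fun n hn => by
    have hnear := (hg n).mono hX (m := N) (by exact_mod_cast hn)
    have hγn := hγ.smul (g n : X ≃ᵢ X)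
    have h1 := hγn.infDist_mul_dist_le hX hB (hγB.smul (g n : X ≃ᵢ X)) x₀ N
    have h2 : 1 ≤ dist (rayPoint x₀ N ((g n : X ≃ᵢ X) • c.1))
        (rayPoint x₀ N ((g n : X ≃ᵢ X) • c.2)) := by
      have h3 := dist_triangle4 (rayPoint x₀ N e.1) (rayPoint x₀ N (g n • c).1)
        (rayPoint x₀ N (g n • c).2) (rayPoint x₀ N e.2)
      have h4 := hnear.1
      rw [dist_comm] at h4
      change 1 ≤ dist (rayPoint x₀ N (g n • c).1) (rayPoint x₀ N (g n • c).2)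
      linarith [hnear.2]
    obtain ⟨s, hs⟩ := hγn.exists_dist_eq x₀
    have h5 := (le_mul_of_one_le_right Metric.infDist_nonneg h2).trans h1
    rw [← hs] at h5
    -- A power of `a` fixes the pair `c` and moves `γ 0` along the axis to within `τ` of `γ s`.
    -- After this correction the group elements stay in a compact set.
    refine ⟨⌊s / τ⌋, ?_⟩
    have h6 : ((g n * a ^ ⌊s / τ⌋ : G) : X ≃ᵢ X) (γ 0) = (g n : X ≃ᵢ X) (γ (0 + ⌊s / τ⌋ * τ)) := by
      rw [← zpow_translate ha ⌊s / τ⌋ 0]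
      rfl
    rw [h6]
    refine (dist_triangle _ ((g n : X ≃ᵢ X) (γ s)) _).trans (add_le_add ?_ ?_)
    · rw [(g n : X ≃ᵢ X).isometry.dist_eq, hγ.isometry.dist_eq, Real.dist_eq, zero_add,
        abs_sub_comm]
      have f1 := Int.floor_le (s / τ)
      have f2 := Int.lt_floor_add_one (s / τ)
      rw [le_div_iff₀ hτ] at f1
      rw [div_lt_iff₀ hτ] at f2
      exact abs_le.2 ⟨by linarith, by linarith⟩
    · rw [dist_comm]; exact h5
  have hclose' : ∀ n, ∃ k : ℤ, N ≤ n → dist (((g n * a ^ k : G) : X ≃ᵢ X) (γ 0)) x₀ ≤ τ + R :=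
    fun n => by
      by_cases hn : N ≤ n
      · obtain ⟨k, hk⟩ := hclose n hn
        exact ⟨k, fun _ => hk⟩
      · exact ⟨0, fun h => absurd h hn⟩
  choose k hk using hclose'
  have hU : (hyperfilter ℕ : Filter ℕ) ≤ atTop := Nat.hyperfilter_le_atTop
  obtain ⟨w, hw⟩ := exists_tendsto_subgroup hG (hyperfilter ℕ) (fun n => g n * a ^ k n) (γ 0) x₀
    (τ + R) (hU ((eventually_ge_atTop N).mono fun n hn => hk n hn))
  have hw' : Tendsto (fun n => ((g n * a ^ k n : G) : X ≃ᵢ X)) (hyperfilter ℕ) (𝓝 (w : X ≃ᵢ X)) :=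
    tendsto_subtype_rng.1 hw
  have hgc : ∀ n, (g n * a ^ k n) • c = g n • c := fun n => by rw [mul_smul, hac]
  have key : ∀ (ξ η : Boundary X),
      (∀ n : ℕ, dist (rayPoint x₀ n ((g n * a ^ k n) • ξ)) (rayPoint x₀ n η) ≤ 1) →
      w • ξ = η := by
    intro ξ η hξ
    refine hX.eq_of_rayPoint_eq x₀ fun s => ?_
    refine tendsto_nhds_unique (hX.tendsto_rayPoint_smul hw' x₀ s ξ) ?_
    rw [tendsto_iff_dist_tendsto_zero]
    have h1 : Tendsto (fun n : ℕ => (s : ℝ) / n) (hyperfilter ℕ) (𝓝 0) :=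
      (tendsto_const_div_atTop_nhds_zero_nat (s : ℝ)).mono_left hU
    refine squeeze_zero' (Eventually.of_forall fun _ => dist_nonneg) (hU ?_) h1
    obtain ⟨m, hm⟩ := exists_nat_gt s
    filter_upwards [eventually_ge_atTop m] with n hn
    have hsn : s ≤ (n : ℝ≥0) := hm.le.trans (by exact_mod_cast hn)
    have hn0 : (0 : ℝ) < n := by
      have : (0 : ℝ≥0) < n := (zero_le.trans_lt hm).trans_le (by exact_mod_cast hn)
      exact_mod_cast this
    have h2 := hX.mul_dist_rayPoint_le x₀ ((g n * a ^ k n) • ξ) η hsn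
    rw [NNReal.coe_natCast] at h2
    rw [le_div_iff₀ hn0]
    change dist (rayPoint x₀ s ((g n * a ^ k n) • ξ)) (rayPoint x₀ s η) * n ≤ s
    have h3 : (s : ℝ) * dist (rayPoint x₀ n ((g n * a ^ k n) • ξ)) (rayPoint x₀ n η) ≤ s * 1 := by
      gcongr
      exact hξ n
    linarith
  refine ⟨w, Prod.ext (key c.1 e.1 fun n => ?_) (key c.2 e.2 fun n => ?_)⟩
  · have := (hg n).1
    rwa [← hgc] at this
  · have := (hg n).2
    rwa [← hgc] at this

/-- Two axes with a common endpoint have pairs of endpoints in the same orbit. -/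
theorem HasContractingAxis.exists_smul_eq_of_common (hX : IsCAT0 X)
    (hG : IsClosed (G : Set (X ≃ᵢ X))) {B : ℝ} (hB : 0 < B) {x y z : Boundary X}
    (hx : HasContractingAxis G x z) (hy : HasContractingAxis G y z)
    (hxy : (x, y) ∈ contractingPairs X B) : ∃ g : G, g • x = y ∧ g • z = z := by
  have hx' := hx
  obtain ⟨-, γ₁, -, -, -, -, hγ₁, -, -⟩ := hx'
  obtain ⟨a, γ, τ, -, hτ, -, hγ, -, ha⟩ := hy
  obtain ⟨-, γ₂, hγ₂, hγ₂B⟩ := mem_contractingPairs.1 hxy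
  have hay : ∀ k : ℤ, a ^ k • y = y := zpow_smul_eq
    (hγ.symm.smul_eq_of_translate (τ := -τ) fun t => by rw [ha]; congr 1; ring)
  have haz : ∀ k : ℤ, a ^ k • z = z := zpow_smul_eq (hγ.smul_eq_of_translate ha)
  set x₀ := γ 0
  have hak : ∀ k : ℤ, ((a ^ k : G) : X ≃ᵢ X) x₀ = γ (k * τ) := fun k => by
    have := zpow_translate ha k 0
    rw [zero_add] at this
    exact this
  -- Going towards `z` along the axis stays close to `γ` and to `γ₁`, which also ends at `z`.
  -- Staying close to `γ₂` as well would bound the diameter of this sequence.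
  have hfar : ∀ m : ℝ, ∃ k : ℕ, m < Metric.infDist (γ (k * τ)) (range γ₂) := by
    intro m
    by_contra! hcon
    set M := max (max m 0) (dist (γ 0) (γ₁ 0))
    have hM : ∀ k : ℕ, Metric.infDist (γ (k * τ)) (range γ) ≤ M ∧
        Metric.infDist (γ (k * τ)) (range fun t => γ₁ (-t)) ≤ M ∧
        Metric.infDist (γ (k * τ)) (range γ₂) ≤ M := fun k => by
      refine ⟨?_, ?_, (hcon k).trans ((le_max_left _ _).trans (le_max_left _ _))⟩
      · rw [Metric.infDist_zero_of_mem (mem_range_self _)]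
        exact (le_max_right _ _).trans (le_max_left _ _)
      · rw [range_comp_neg]
        refine (Metric.infDist_le_dist_of_mem (mem_range_self ((k : ℝ) * τ))).trans ?_
        refine le_trans ?_ (le_max_right _ _)
        set t : ℝ≥0 := ⟨k * τ, by positivity⟩
        have h1 := hX.dist_rayPoint_le (γ 0) (γ₁ 0) t z
        rw [hγ.rayPoint hX, hγ₁.rayPoint hX, zero_add] at h1
        exact h1
    obtain ⟨k, hk⟩ := exists_nat_gt (10 * M / τ)
    rw [div_lt_iff₀ hτ] at hk
    obtain ⟨h1, h2, h3⟩ := hM k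
    obtain ⟨h1', h2', h3'⟩ := hM 0
    have := hX.dist_le_of_infDist_le hγ hγ₁.symm hγ₂ h1 h2 h3 h1' h2' h3'
    rw [hγ.isometry.dist_eq, Real.dist_eq, Nat.cast_zero, zero_mul, sub_zero,
      abs_of_nonneg (by positivity)] at this
    linarith
  -- From a point `γ (k * τ)` far from the line joining `x` to `y`, the rays to these two points
  -- look alike. Pulling back by `a ^ k`, which fixes `y` and `z`, shows that translates of `(x, z)`
  -- accumulate at `(y, z)`; closedness of the orbit concludes.
  obtain ⟨g, hg⟩ := HasContractingAxis.exists_smul_eq hX hG x₀ (c := (x, z)) (e := (y, z)) hx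
    (hγ.ne hX) fun n => by
      set m : ℝ := (n : ℝ≥0) * max (16 * B) (2 * (n : ℝ≥0)) with hm
      have hm0 : 0 ≤ m := by positivity
      obtain ⟨k, hk⟩ := hfar m
      have h1 := hγ₂.infDist_mul_dist_le hX hB hγ₂B (γ (k * τ)) n
      rw [← hm] at h1
      have h2 : dist (rayPoint (γ (k * τ)) n x) (rayPoint (γ (k * τ)) n y) ≤ 1 := by
        by_contra! hlt
        nlinarith
      refine ⟨(a ^ (k : ℤ))⁻¹, ?_, ?_⟩
      · have e1 : ∀ ξ : Boundary X, rayPoint (γ (k * τ)) n ξ =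
            ((a ^ (k : ℤ) : G) : X ≃ᵢ X) (rayPoint x₀ n ((a ^ (k : ℤ))⁻¹ • ξ)) := fun ξ => by
          rw [← hX.smul_rayPoint, hak, Int.cast_natCast]
          congr 1
          exact (smul_inv_smul (a ^ (k : ℤ)) ξ).symm
        have e2 : (a ^ (k : ℤ))⁻¹ • y = y := by rw [← zpow_neg]; exact hay _
        rw [e1, e1, ((a ^ (k : ℤ) : G) : X ≃ᵢ X).isometry.dist_eq, e2] at h2
        exact h2
      · have e2 : (a ^ (k : ℤ))⁻¹ • z = z := by rw [← zpow_neg]; exact haz _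
        change dist (rayPoint x₀ n ((a ^ (k : ℤ))⁻¹ • z)) (rayPoint x₀ n z) ≤ 1
        rw [e2, dist_self]
        exact zero_le_one
  exact ⟨g, congrArg Prod.fst hg, congrArg Prod.snd hg⟩

end Axes

/-! ### Existence of the cochain -/

section Existence

variable {X : Type*} [MetricSpace X] {G : Subgroup (X ≃ᵢ X)}

/-- When `u` and `v` are the points seen in the directions of one side, that side contributes 1. In
the other two terms the third point is too far from `u` and `v` to count. -/
theorem tripleKernel_one_eq_one (x₀ : X) (r : ℝ≥0) (t : Fin 3 → Boundary X)
    (ht : ∀ i, 3 ≤ dist (rayPoint x₀ r (t i)) (rayPoint x₀ r (t (i + 1)))) (j : Fin 3) :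
    tripleKernel G x₀ r (rayPoint x₀ r (t j)) (rayPoint x₀ r (t (j + 1))) t 1 = 1 := by
  have e : ∀ y : X, ((1 : G) : X ≃ᵢ X) y = y := fun _ => rfl
  have h13 : (1 : ℝ) ≤ 3 := by norm_num
  have h0 : 1 ≤ dist (rayPoint x₀ r (t 0)) (rayPoint x₀ r (t 1)) := h13.trans (ht 0)
  have h1 : 1 ≤ dist (rayPoint x₀ r (t 1)) (rayPoint x₀ r (t 2)) := h13.trans (ht 1)
  have h2 : 1 ≤ dist (rayPoint x₀ r (t 2)) (rayPoint x₀ r (t 0)) := h13.trans (ht 2)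
  have h0' := h0
  have h1' := h1
  have h2' := h2
  rw [dist_comm] at h0' h1' h2'
  simp only [tripleKernel, pairKernel, e]
  fin_cases j
  · change pairFun (rayPoint x₀ r (t 0)) (rayPoint x₀ r (t 1)) _ _ +
      pairFun (rayPoint x₀ r (t 0)) (rayPoint x₀ r (t 1)) _ _ +
      pairFun (rayPoint x₀ r (t 0)) (rayPoint x₀ r (t 1)) _ _ = 1
    rw [pairFun_self h0, pairFun_eq_zero_right _ h2 h1', pairFun_eq_zero_left _ h2 h1']
    norm_num
  · change pairFun (rayPoint x₀ r (t 1)) (rayPoint x₀ r (t 2)) _ _ +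
      pairFun (rayPoint x₀ r (t 1)) (rayPoint x₀ r (t 2)) _ _ +
      pairFun (rayPoint x₀ r (t 1)) (rayPoint x₀ r (t 2)) _ _ = 1
    rw [pairFun_self h1, pairFun_eq_zero_right _ h0 h2', pairFun_eq_zero_left _ h0 h2']
    norm_num
  · change pairFun (rayPoint x₀ r (t 2)) (rayPoint x₀ r (t 0)) _ _ +
      pairFun (rayPoint x₀ r (t 2)) (rayPoint x₀ r (t 0)) _ _ +
      pairFun (rayPoint x₀ r (t 2)) (rayPoint x₀ r (t 0)) _ _ = 1
    rw [pairFun_self h2, pairFun_eq_zero_right _ h1 h0', pairFun_eq_zero_left _ h1 h0']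
    norm_num

variable [ProperSpace X]

/-- A nonzero value at `(c, z)` means that `z.1⁻¹ • c` is close to `e` or to its reverse, as seen
from `x₀`. `IsNear` uses a non-strict inequality so that this persists on the closure. -/
theorem not_mem_pairSupport_cochain (hX : IsCAT0 X) {x₀ : X} {r : ℝ≥0} (B : ℝ)
    {c e : Boundary X × Boundary X} (h : ∀ g : G, ¬ IsNear x₀ r (g • c) e)
    (h' : ∀ g : G, ¬ IsNear x₀ r (g • c) e.swap) (z : G × G) :
    (c, z) ∉ pairSupport G B
      (cochain G x₀ r (rayPoint x₀ r e.1) (rayPoint x₀ r e.2) hX) := by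
  set D : (Boundary X × Boundary X) × (G × G) → Boundary X → Boundary X → ℝ := fun w ξ η =>
    dist (rayPoint ((w.2.1 : X ≃ᵢ X) x₀) r ξ) ((w.2.1 : X ≃ᵢ X) (rayPoint x₀ r η)) with hD
  have hcont : ∀ (f : Boundary X × Boundary X → Boundary X), Continuous f → ∀ η,
      Continuous fun w => D w (f w.1) η := fun f hf η => by
    have h1 : Continuous fun w : (Boundary X × Boundary X) × (G × G) => w.2.1 := by fun_prop
    exact (hX.continuous_rayPoint_subgroup h1 (hf.comp continuous_fst)).dist
      ((continuous_subgroup_apply_const _).comp h1)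
  have hc1 := fun η => hcont Prod.fst continuous_fst η
  have hc2 := fun η => hcont Prod.snd continuous_snd η
  have hclosed : IsClosed ({w : (Boundary X × Boundary X) × (G × G) | D w w.1.1 e.1 ≤ 1} ∩
      {w | D w w.1.2 e.2 ≤ 1} ∪ {w | D w w.1.2 e.1 ≤ 1} ∩ {w | D w w.1.1 e.2 ≤ 1}) :=
    ((isClosed_le (hc1 _) continuous_const).inter (isClosed_le (hc2 _) continuous_const)).union
      ((isClosed_le (hc2 _) continuous_const).inter (isClosed_le (hc1 _) continuous_const))
  have hsub : pairSupport G B (cochain G x₀ r (rayPoint x₀ r e.1) (rayPoint x₀ r e.2) hX) ⊆ _ :=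
    closure_minimal (fun w hw => by
      have hw2 := hw.2
      rw [cochain_apply] at hw2
      rcases near_of_pairFun_ne_zero (right_ne_zero_of_mul hw2) with ⟨h1, h2⟩ | ⟨h1, h2⟩
      · exact Or.inl ⟨h1.le, h2.le⟩
      · exact Or.inr ⟨h1.le, h2.le⟩) hclosed
  have hDz : ∀ ξ η, D (c, z) ξ η = dist (rayPoint x₀ r (z.1⁻¹ • ξ)) (rayPoint x₀ r η) := by
    intro ξ η
    rw [← (z.1 : X ≃ᵢ X).isometry.dist_eq, ← hX.smul_rayPoint]
    simp only [hD]
    congr 2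
    exact (smul_inv_smul z.1 ξ).symm
  intro hz
  rcases hsub hz with ⟨h1, h2⟩ | ⟨h1, h2⟩
  · have h1 : D (c, z) c.1 e.1 ≤ 1 := h1
    have h2 : D (c, z) c.2 e.2 ≤ 1 := h2
    rw [hDz] at h1 h2
    exact h z.1⁻¹ ⟨h1, h2⟩
  · have h1 : D (c, z) c.2 e.1 ≤ 1 := h1
    have h2 : D (c, z) c.1 e.2 ≤ 1 := h2
    rw [hDz] at h1 h2
    exact h' z.1⁻¹ ⟨h2, h1⟩

theorem exists_side_not_mem_orbit (hX : IsCAT0 X) (hG : IsClosed (G : Set (X ≃ᵢ X))) {B : ℝ}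
    (hB : 0 < B) {a b ξ : Boundary X} (hT : ![a, b, ξ] ∈ joinedTriples X B)
    (hab : HasContractingAxis G a b) {ι : Type*} {c : ι → Boundary X × Boundary X}
    (hc : ∀ i, HasContractingAxis G (c i).1 (c i).2)
    (hd : ∀ i, Disjoint (MulAction.orbit G (c i)) (MulAction.orbit G (a, b))) :
    ∃ j, ∀ i, ∀ g : G, g • c i ≠ (![a, b, ξ] j, ![a, b, ξ] (j + 1)) ∧
      g • c i ≠ (![a, b, ξ] (j + 1), ![a, b, ξ] j) := by
  by_contra! hcon
  have hnot : ∀ i, ∀ g h : G, g • c i ≠ h • (a, b) := fun i g h heq =>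
    Set.disjoint_left.1 (hd i) ⟨g, rfl⟩ ⟨h, heq.symm⟩
  have haxis : ∀ j, HasContractingAxis G (![a, b, ξ] j) (![a, b, ξ] (j + 1)) := fun j => by
    obtain ⟨i, g, hg⟩ := hcon j
    have h1 := (hc i).smul g
    by_cases h : g • c i = (![a, b, ξ] j, ![a, b, ξ] (j + 1))
    · have h2 : HasContractingAxis G (g • c i).1 (g • c i).2 := h1
      rwa [h] at h2
    · have h2 : HasContractingAxis G (g • c i).1 (g • c i).2 := h1
      rw [hg h] at h2
      exact h2.symm
  have hbξ : HasContractingAxis G b ξ := haxis 1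
  have hξa : HasContractingAxis G ξ a := haxis 2
  have pab : (a, b) ∈ contractingPairs X B := hT 0
  have pbξ : (b, ξ) ∈ contractingPairs X B := hT 1
  have pξa : (ξ, a) ∈ contractingPairs X B := hT 2
  obtain ⟨u₁, h₁, h₁'⟩ := hab.exists_smul_eq_of_common hX hG hB hbξ.symm
    (swap_mem_contractingPairs pξa)
  obtain ⟨u₂, h₂, h₂'⟩ := hbξ.exists_smul_eq_of_common hX hG hB hξa.symm
    (swap_mem_contractingPairs pab)
  obtain ⟨u₃, h₃, h₃'⟩ := hξa.exists_smul_eq_of_common hX hG hB hab.symm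
    (swap_mem_contractingPairs pbξ)
  -- Pivoting successively about `b`, `ξ` and `a` takes `a` to `ξ`, to `ξ`, to `b`, and takes `b` to
  -- `b`, to `a`, to `a`. Hence both orientations of the first side lie in one orbit, which no given
  -- pair meets.
  have hflip : (u₃ * u₂ * u₁) • (a, b) = (b, a) := by
    refine Prod.ext ?_ ?_
    · change (u₃ * u₂ * u₁) • a = b
      rw [mul_smul, mul_smul, h₁, h₂', h₃]
    · change (u₃ * u₂ * u₁) • b = a
      rw [mul_smul, mul_smul, h₁', h₂, h₃']
  obtain ⟨i, g, hg⟩ := hcon 0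
  have hg' : g • c i = (b, a) := hg fun h => hnot i g 1 (by rw [h, one_smul]; rfl)
  exact hnot i g (u₃ * u₂ * u₁) (hg'.trans hflip.symm)

theorem exists_isAdmissibleMap (hX : IsCAT0 X) (hG : IsClosed (G : Set (X ≃ᵢ X)))
    [MeasurableSpace G] [BorelSpace G] (μ : Measure G) [μ.IsHaarMeasure] (x₀ : X) {B : ℝ}
    (hB : 0 < B) {a b ξ : Boundary X} (hT : ![a, b, ξ] ∈ contractingTriples G B)
    (hab : HasContractingAxis G a b) {ι : Type*} [Finite ι] {c : ι → Boundary X × Boundary X}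
    (hc : ∀ i, HasContractingAxis G (c i).1 (c i).2)
    (hd : ∀ i, Disjoint (MulAction.orbit G (c i)) (MulAction.orbit G (a, b))) :
    ∃ α : Boundary X × Boundary X → C(G × G, ℝ), IsAdmissibleMap G μ B x₀ a b ξ α ∧
      ∀ i, ∀ z : G × G, (c i, z) ∉ pairSupport G B α := by
  obtain ⟨j, hj⟩ := exists_side_not_mem_orbit hX hG hB hT.2.2 hab hc hd
  have hne : ∀ j, ![a, b, ξ] j ≠ ![a, b, ξ] (j + 1) := fun j => (hT.2.2 j).1
  set e : Boundary X × Boundary X := (![a, b, ξ] j, ![a, b, ξ] (j + 1))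
  -- If translates of `c i` were near `e` at every radius, closedness of the orbit would put `e` in
  -- it. Finiteness of the family gives one radius for all indices, which also serves to separate
  -- the three rays.
  have hfar : ∀ e : Boundary X × Boundary X, e.1 ≠ e.2 → (∀ i, ∀ g : G, g • c i ≠ e) →
      ∀ᶠ n : ℕ in atTop, ∀ i, ∀ g : G, ¬ IsNear x₀ n (g • c i) e := by
    intro e he h
    refine eventually_all.2 fun i => ?_
    obtain ⟨n, hn⟩ : ∃ n : ℕ, ∀ g : G, ¬ IsNear x₀ n (g • c i) e := by
      by_contra! hcon
      obtain ⟨g, hg⟩ := (hc i).exists_smul_eq hX hG x₀ he hcon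
      exact h i g hg
    filter_upwards [eventually_ge_atTop n] with m hm g hg
    exact hn g (hg.mono hX (by exact_mod_cast hm))
  have hdist : ∀ᶠ n : ℕ in atTop, ∀ i, 3 ≤ dist (rayPoint x₀ n (![a, b, ξ] i))
      (rayPoint x₀ n (![a, b, ξ] (i + 1))) := eventually_all.2 fun i =>
    ((hX.tendsto_dist_rayPoint x₀ (hne i)).comp tendsto_natCast_atTop_atTop).eventually_ge_atTop 3
  obtain ⟨n, h1, h2, h3⟩ := ((hfar e (hne j) fun i g => (hj i g).1).and
    ((hfar e.swap (hne j).symm fun i g => (hj i g).2).and hdist)).exists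
  refine ⟨cochain G x₀ n (rayPoint x₀ n e.1) (rayPoint x₀ n e.2) hX,
    isAdmissibleMap_cochain hX hG μ hB (h3 j) hT ?_,
    fun i => not_mem_pairSupport_cochain hX B (h1 i) (h2 i)⟩
  rw [tripleKernel_one_eq_one x₀ n _ h3 j]
  exact one_ne_zero

end Existence
end RankOne

open RankOne
-- The main theorem
theorem mainTheorem3 {X : Type*} [MetricSpace X] [ProperSpace X] (hX : IsCAT0 X)
    (G : Subgroup (X ≃ᵢ X)) (hclosed : IsClosed (G : Set (X ≃ᵢ X))) (hG : IsNonElementary G)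
    [MeasurableSpace G] [BorelSpace G] (μ : Measure G) [μ.IsHaarMeasure]
    (x₀ : X) (B : ℝ) (hB : 0 < B)
    (a b ξ : Boundary X) (hT : ![a, b, ξ] ∈ contractingTriples G B)
    (hab : IsRankOnePair G a b) :
    (∃ α : Boundary X × Boundary X → C(G × G, ℝ), IsAdmissibleMap G μ B x₀ a b ξ α) ∧
    (¬ IsTransitiveOnPairs G →
      ∀ (k : ℕ) (c : Fin k → Boundary X × Boundary X),
        (∀ i, c i ∈ contractingPairs X B) →
        (∀ i, IsRankOnePair G (c i).1 (c i).2) →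
        (∀ i, Disjoint (MulAction.orbit G (c i)) (MulAction.orbit G (a, b))) →
        ∃ α : Boundary X × Boundary X → C(G × G, ℝ), IsAdmissibleMap G μ B x₀ a b ξ α ∧
          ∀ i, ∀ z : G × G, (c i, z) ∉ pairSupport G B α) := by
  have hab' := hab.hasContractingAxis hX
  refine ⟨?_, fun _ k c _ hc hd => exists_isAdmissibleMap hX hclosed μ x₀ hB hT hab'
    (fun i => (hc i).hasContractingAxis hX) hd⟩
  -- With an empty family of pairs to avoid, the same construction gives the first assertion.
  obtain ⟨α, hα, -⟩ := exists_isAdmissibleMap hX hclosed μ x₀ hB hT hab' (ι := Empty)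
    (c := Empty.elim) (fun i => i.elim) fun i => i.elim
  exact ⟨α, hα⟩
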